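/- Let $K$ be an algebraically closed field, $n\ge 0$, $\nu\ge 1$, and let $W\subseteq\mathbb P^n(K)$ be an algebraic set. Let $X^*_0,\dots,X^*_{\nu-1}$ be copies of the dual coordinates $X^*=(X^*_0,\dots,X^*_n)$ of $\mathbb P^n$, and let $0\neq\mathfrak C\in K[X^*_{<\nu}]$ be a Chow form for $W$ in dimension $\nu-1$, i.e. for all linear forms $\mu_0,\dots,\mu_{\nu-1}$ over $K$: $\mathfrak C(\mu_{<\nu})=0\iff W\cap V(\mu_{<\nu})\ne\emptyset$. Let $D$ be the degree of $\mathfrak C$ in $X^*_0$. Notation. For $Y=(Y_0,\dots,Y_\nu)$ put $$\mathfrak C^\sharp(X^*_{\le\nu},Y)=\mathfrak C\Bigl(\tfrac{X^*_i}{Y_i}-\tfrac{X^*_\nu}{Y_\nu}:i<\nu\Bigr)\prod_{i\le\nu}Y_i^D,$$ and for a family $\lambda=(\lambda_i:i\le\nu)$ of linear forms in $X=(X_0,\dots,X_n)$ put $P_\lambda(Y)=\mathfrak C^\sharp(\lambda,Y)$. For an integral domain $A$, $f\in A[X]$ homogeneous of degree $d$ and $g\in A[X^*]$ homogeneous of degree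 $e$ which splits as $g=y\prod_{i<e}(X^*\cdot x_i)$ over the algebraic closure of $\mathrm{Frac}(A)$, let $f\wedge g=y^d\prod_{i<e}f(x_i)$ (with $0^0=1$), whenever this lies in $A$. For $h\in A[X^*_{<k}]$ and homogeneous $f=(f_i:i<k)$, let $f\wedge h=f_0\wedge(f_1\wedge\cdots(f_{k-1}\wedge h)\cdots)\in A$, where $f_i$ is wedged with respect to the variables $X^*_i$. For homogeneous $P,f_0,\dots,f_{\nu-1}\in A[Y]$ let $f\wedge P=(f_0,\dots,f_{\nu-1},P)\wedge\det(Y^*_0,\dots,Y^*_\nu)$. Prescribed homogeneous degrees are used throughout: $\det$ has degree $1$ in each group, $P_\lambda$ has degree $D$, and if $h$ has degree $e$ in each group then $f_{k-1}\wedge h$ has degree $e\deg f_{k-1}$ in each remaining group. Proposition. 1. $\mathfrak C^\sharp$ is a polynomial in $K[X^*_{\le\nu},Y]$. For linear forms $\lambda$ over $K$, $P_\lambda$ is homogeneous of degree $D$ in $Y$; $P_\lambda=0$ if and only if $V(\lambda)\cap W\neq\emptyset$; and if $V(\lambda)\cap W=\emptyset$, then the zero set of $P_\lambda$ in $\mathbb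 P^\nu(K)$ is the projection $\lambda W=\{[\lambda x]:[x]\in W\}$. 2. Let $R$ be an integral domain that is a $K$-algebra, $\lambda=(\lambda_i:i\le\nu)$ linear forms in $X$ over $R$, and $f=(f_i:i<\nu)$ homogeneous polynomials in $R[Y]$, of degrees $d_i\ge 0$. Then all the wedges involved are well defined, and $$f\wedge P_\lambda=(f\circ\lambda)\wedge\mathfrak C .$$ 3. Assume moreover that $\mathfrak C$ is irreducible in $K[X^*_{<\nu}]$. If $\lambda$ is indeterminate (its coefficients are independent indeterminates), then $P_\lambda$ is irreducible in $K[\lambda,Y]$. If in addition $f=(f_i:i<\nu)$ is a family of indeterminate homogeneous polynomials of degrees $d_i\ge1$, then $f\wedge P_\lambda=(f\circ\lambda)\wedge\mathfrak C$ is irreducible in $K[\lambda,f]$. -/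

import Mathlib

open MvPolynomial

universe u v

noncomputable section

namespace ChowProj

/-- Points of the projective space of dimension `n` over `K`. -/
abbrev PSpace (K : Type*) [Field K] (n : ℕ) := Projectivization K (Fin (n + 1) → K)

/-- The polynomial ring `R[X*_0, …, X*_{k-1}]` in `k` copies of the dual indeterminates
`X* = (X*_0, …, X*_n)`: the `s`-th coordinate of the `i`-th copy is `X (i, s)`. -/
abbrev DualPoly (R : Type*) [CommSemiring R] (k n : ℕ) := MvPolynomial (Fin k × Fin (n + 1)) R

section Geometry

variable {K : Type*} [Field K] {n : ℕ}

/-- Zariski closed subsets of projective space: common zeros of homogeneous polynomials. (By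
homogeneity, vanishing at a point does not depend on the representative.) -/
def IsAlgebraicSet (W : Set (PSpace K n)) : Prop :=
  ∃ S : Set (MvPolynomial (Fin (n + 1)) K),
    (∀ f ∈ S, ∃ d, f.IsHomogeneous d) ∧ W = {p | ∀ f ∈ S, eval p.rep f = 0}

/-- `W ∩ V(lam) ≠ ∅`, where row `i` of `lam` holds the coefficients of the `i`-th linear form. -/
def MeetsForms {k : ℕ} (W : Set (PSpace K n)) (lam : Matrix (Fin k) (Fin (n + 1)) K) : Prop :=
  ∃ p ∈ W, ∀ i, ∑ s, lam i s * p.rep s = 0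

/-- `c` is a Chow form for `W`, in dimension `k - 1`: `c` vanishes at a family of `k` linear forms
if and only if these have a common zero on `W`. -/
def IsChowFormFor {k : ℕ} (W : Set (PSpace K n)) (c : DualPoly K k n) : Prop :=
  ∀ lam : Matrix (Fin k) (Fin (n + 1)) K,
    eval (fun p => lam p.1 p.2) c = 0 ↔ MeetsForms W lam

/-- The image of `W` under `[x] ↦ [lam x]` (points where `lam x = 0` contribute nothing). -/
def projImage {m : ℕ} (lam : Matrix (Fin (m + 1)) (Fin (n + 1)) K) (W : Set (PSpace K n)) :
    Set (PSpace K m) :=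
  {q | ∃ p ∈ W, ∃ h : lam.mulVec p.rep ≠ 0, Projectivization.mk K (lam.mulVec p.rep) h = q}

end Geometry

/-- The degree of `c` as a polynomial in the group of indeterminates `X*_i`. -/
def groupDegree {R : Type*} [CommSemiring R] {k n : ℕ} (i : Fin k) (c : DualPoly R k n) : ℕ :=
  c.support.sup fun a => ∑ s, a (i, s)

section Sharp

variable {K : Type*} [Field K] {m n : ℕ}

/-- The polynomial ring `K[X*_{≤ m}, Y]`, where `Y = (Y_i : i ≤ m)`. -/
abbrev SharpPoly (K : Type*) [Field K] (m n : ℕ) :=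
  MvPolynomial ((Fin (m + 1) × Fin (n + 1)) ⊕ Fin (m + 1)) K

/-- The rational function `g(X*_i / Y_i - X*_m / Y_m : i < m) · ∏_{i ≤ m} Y_i ^ d`. -/
def sharpFrac (g : DualPoly K m n) (d : ℕ) : FractionRing (SharpPoly K m n) :=
  let x : Fin (m + 1) → Fin (n + 1) → FractionRing (SharpPoly K m n) :=
    fun i s => algebraMap (SharpPoly K m n) _ (X (Sum.inl (i, s)))
  let y : Fin (m + 1) → FractionRing (SharpPoly K m n) :=
    fun i => algebraMap (SharpPoly K m n) _ (X (Sum.inr i))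
  aeval (fun p : Fin m × Fin (n + 1) =>
      x p.1.castSucc p.2 / y p.1.castSucc - x (Fin.last m) p.2 / y (Fin.last m)) g
    * ∏ i, y i ^ d

/-- `g^♯`: the polynomial equal to the rational function `sharpFrac g d` (if the latter is a
polynomial, as is the case when `g` is alternating and homogeneous of degree `d`). -/
def sharp (g : DualPoly K m n) (d : ℕ) : SharpPoly K m n :=
  Function.invFun (algebraMap (SharpPoly K m n) (FractionRing (SharpPoly K m n))) (sharpFrac g d)

/-- `P_lam(Y) = c^♯(lam, Y)`, for linear forms `lam` with coefficients in a `K`-algebra `R`. -/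
def projForm {R : Type*} [CommRing R] [Algebra K R] (c : DualPoly K m n) (d : ℕ)
    (lam : Matrix (Fin (m + 1)) (Fin (n + 1)) R) : MvPolynomial (Fin (m + 1)) R :=
  aeval (Sum.elim (fun p => C (lam p.1 p.2)) X) (sharp c d)

end Sharp

section Wedge

variable {A : Type*} [CommRing A] [IsDomain A] {n : ℕ}

/-- An algebraic closure of the field of fractions of a domain. -/
abbrev FracClosure (A : Type*) [CommRing A] [IsDomain A] := AlgebraicClosure (FractionRing A)

/-- `g ∈ A[X*]_D` splits as `y ∏_{i < D} (X* · x_i)` over the algebraic closure of `Frac A`. -/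
def SplitsAs (D : ℕ) (g : MvPolynomial (Fin (n + 1)) A) (y : FracClosure A)
    (x : Fin D → Fin (n + 1) → FracClosure A) : Prop :=
  map (algebraMap A (FracClosure A)) g = C y * ∏ i, ∑ s, C (x i s) * X s

/-- `a = f ∧ g`, for `f ∈ A[X]_d` and `g ∈ A[X*]_D`: if `g` splits as `y ∏_{i < D} (X* · x_i)`,
then `f ∧ g = y ^ d ∏_{i < D} f(x_i)`. The degrees `d` and `D` are explicit as they matter when `f`
or `g` vanishes (with `0 ^ 0 = 1`); for `f` homogeneous of degree `d` the value does not depend on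
the splitting. -/
def IsWedge (d D : ℕ) (f g : MvPolynomial (Fin (n + 1)) A) (a : A) : Prop :=
  ∃ (y : FracClosure A) (x : Fin D → Fin (n + 1) → FracClosure A),
    SplitsAs D g y x ∧ algebraMap A (FracClosure A) a = y ^ d * ∏ i, aeval (x i) f

open Classical in
/-- The element `f ∧ g` of `A`. -/
def wedge (d D : ℕ) (f g : MvPolynomial (Fin (n + 1)) A) : A :=
  if h : ∃ a, IsWedge d D f g a then h.choose else 0

end Wedge

section IterWedge

variable {R : Type*} [CommRing R] [IsDomain R] {n : ℕ}

/-- View a polynomial in `X*_0, …, X*_k` as one in `X*_k` over `R[X*_0, …, X*_{k-1}]`. -/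
def lastGroup {k : ℕ} (c : DualPoly R (k + 1) n) :
    MvPolynomial (Fin (n + 1)) (DualPoly R k n) :=
  aeval (fun p : Fin (k + 1) × Fin (n + 1) =>
    Fin.lastCases (motive := fun _ => MvPolynomial (Fin (n + 1)) (DualPoly R k n))
      (X p.2) (fun i => C (X (i, p.2))) p.1) c

/-- `f ∧ c ∈ R[X*_0, …, X*_{k-1}]`, the wedge being taken with respect to `X*_k`, for `f ∈ R[X]_d`
and `c ∈ R[X*_0, …, X*_k]` of degree `D` in `X*_k`. -/
def wedgeLast {k : ℕ} (d D : ℕ) (f : MvPolynomial (Fin (n + 1)) R) (c : DualPoly R (k + 1) n) :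
    DualPoly R k n :=
  wedge d D (map C f) (lastGroup c)

/-- The iterated wedge `f_0 ∧ (f_1 ∧ … (f_{k-1} ∧ c) …) ∈ R`, for `c` of degree `D` in each `X*_i`
and `f_i` of degree `d_i`. The degree of `f_{k-1} ∧ c` in each remaining `X*_i` is
`d_{k-1} * D`. -/
def iterWedge : (k : ℕ) → (d : Fin k → ℕ) → (D : ℕ) → (f : Fin k → MvPolynomial (Fin (n + 1)) R) →
    DualPoly R k n → R
  | 0, _, _, _, c => constantCoeff c
  | k + 1, d, D, f, c =>
      iterWedge k (fun i => d i.castSucc) (d (Fin.last k) * D) (fun i => f i.castSucc)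
        (wedgeLast (d (Fin.last k)) D (f (Fin.last k)) c)

/-- Every wedge occurring in `iterWedge` exists and is well defined. -/
def IterWedgeDefined : (k : ℕ) → (d : Fin k → ℕ) → (D : ℕ) →
    (f : Fin k → MvPolynomial (Fin (n + 1)) R) → DualPoly R k n → Prop
  | 0, _, _, _, _ => True
  | k + 1, d, D, f, c =>
      (∃! a : DualPoly R k n,
        IsWedge (d (Fin.last k)) D (map C (f (Fin.last k))) (lastGroup c) a) ∧
      IterWedgeDefined k (fun i => d i.castSucc) (d (Fin.last k) * D) (fun i => f i.castSucc)
        (wedgeLast (d (Fin.last k)) D (f (Fin.last k)) c)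

/-- The normalised Chow form of the whole projective space of dimension `m`: the determinant. -/
def detForm (R : Type*) [CommRing R] (m : ℕ) : DualPoly R (m + 1) m :=
  (Matrix.mvPolynomialX (Fin (m + 1)) (Fin (m + 1)) R).det

/-- `f ∧ P = f_0 ∧ … ∧ f_{m-1} ∧ P`, for homogeneous polynomials `f_i` of degree `d_i` and `P` of
degree `D` on the projective space of dimension `m`, that is, the iterated wedge of
`(f_0, …, f_{m-1}, P)` with the determinant. -/
def formWedge {m : ℕ} (d : Fin m → ℕ) (D : ℕ) (f : Fin m → MvPolynomial (Fin (m + 1)) R)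
    (P : MvPolynomial (Fin (m + 1)) R) : R :=
  iterWedge (m + 1) (Fin.snoc d D : Fin (m + 1) → ℕ) 1
    (Fin.snoc f P : Fin (m + 1) → MvPolynomial (Fin (m + 1)) R) (detForm R m)

/-- Every wedge occurring in `formWedge` exists and is well defined. -/
def FormWedgeDefined {m : ℕ} (d : Fin m → ℕ) (D : ℕ) (f : Fin m → MvPolynomial (Fin (m + 1)) R)
    (P : MvPolynomial (Fin (m + 1)) R) : Prop :=
  IterWedgeDefined (m + 1) (Fin.snoc d D : Fin (m + 1) → ℕ) 1
    (Fin.snoc f P : Fin (m + 1) → MvPolynomial (Fin (m + 1)) R) (detForm R m)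

end IterWedge

/-- `f ∘ lam`: substitute the linear forms `lam` for the indeterminates of `f`. -/
def compForms {R : Type*} [CommRing R] {m n : ℕ} (f : MvPolynomial (Fin (m + 1)) R)
    (lam : Matrix (Fin (m + 1)) (Fin (n + 1)) R) : MvPolynomial (Fin (n + 1)) R :=
  aeval (fun i => ∑ s, C (lam i s) * X s) f

section Generic

variable (K : Type*) [Field K]

/-- The multi-exponents of the monomials of degree `d` in `m + 1` indeterminates. -/
abbrev Expo (m d : ℕ) := {a : Fin (m + 1) →₀ ℕ // a ∈ Finset.finsuppAntidiag Finset.univ d}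

/-- `K[lam]`, where `lam` consists of `m + 1` indeterminate linear forms in `n + 1` variables. -/
abbrev LamRing (m n : ℕ) := MvPolynomial (Fin (m + 1) × Fin (n + 1)) K

/-- The indeterminate linear forms, over `K[lam]`. -/
def genericLam (m n : ℕ) : Matrix (Fin (m + 1)) (Fin (n + 1)) (LamRing K m n) :=
  fun i s => X (i, s)

/-- `K[lam, f]`, where `lam` is as above and `f` consists of `m` indeterminate homogeneous
polynomials, of respective degrees `d_i`, in `m + 1` variables. -/
abbrev LamFRing (m n : ℕ) (d : Fin m → ℕ) :=
  MvPolynomial ((Fin (m + 1) × Fin (n + 1)) ⊕ (Σ i : Fin m, Expo m (d i))) K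

/-- The indeterminate linear forms, over `K[lam, f]`. -/
def genericLam' (m n : ℕ) (d : Fin m → ℕ) :
    Matrix (Fin (m + 1)) (Fin (n + 1)) (LamFRing K m n d) :=
  fun i s => X (Sum.inl (i, s))

/-- The indeterminate homogeneous polynomials `f_i = ∑_{|a| = d_i} T_{i,a} Y^a`. -/
def genericF (m n : ℕ) (d : Fin m → ℕ) (i : Fin m) :
    MvPolynomial (Fin (m + 1)) (LamFRing K m n d) :=
  ∑ a : Expo m (d i), monomial a.1 (X (Sum.inr ⟨i, a⟩))

end Generic

end ChowProj

end

/-! Two mechanisms carry the proof: a theory of wedges that is stable under arbitrary ring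
homomorphisms, and the identity `c^♯(λ, cross Y) = c(Yλ)`, where `cross Y` is the vector of signed
maximal minors of a `ν × (ν+1)` matrix `Y`.

Wedges. The value `y^d ∏ f(x_i)` is independent of the splitting by unique factorization
(`splitting_value_unique`). It is compatible with every homomorphism to an algebraically closed
field (`HasWedge.specialize`): Gauss's lemma makes a splitting integral over a dominating valuation
ring, where it can be reduced, and the Nullstellensatz carries the reduced splitting to the target
field. Over an integrally closed domain a form that splits has its wedge in the ring
(`HasWedge.exists_of_isIntegrallyClosed`): Galois invariance and a purely inseparable argument put
the value into the fraction field, and valuation rings show that it is integral. Splitting itself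
can be tested on specializations (`HasWedge.of_specializations`). Hence iterated wedges exist for
generic forms over a polynomial ring, and all others are specializations of these.

Chow forms. The zero set of `c` is invariant under invertible row operations, which over an
algebraically closed field forces `c(gμ) = det(g)^D c(μ)`. By the Nullstellensatz, `c` as a
polynomial in any one row splits into linear forms given by points of `W`. These two properties,
`ChowLike`, pass from `(c, Z)` to `(f ∧ c, Z ∩ V(f))` by `ChowLike.wedge`; this keeps the iteration
going.

Projection. Equivariance shows that `c^♯` is a polynomial (`algebraMap_sharp`) and gives the
identity above (`DetEquivariant.sharpEval_cross`). A nonzero `z` is, up to a scalar, `cross Y` for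
some `Y` with kernel spanned by `z`, so `P_λ(z) = 0` exactly when `λx` lies in `Kz` for some `x` in
`W`. Moreover `P_λ ∧ det` is `P_λ(cross Y) = c(Yλ)`, and wedging commutes with the substitution of
`Yλ` for the rows of `c`; this is the projection formula.

Irreducibility. `c(Yλ)` is irreducible for indeterminate `Y` and `λ`, because a factor without zeros
on enough lines is constant (`genericProduct_irreducible`). A factorization of `P_λ` would factor
`c(Yλ)`. Finally, wedging an irreducible form with a generic form of positive degree gives an
irreducible polynomial (`irreducible_of_map_eq_prod_genericValue`), and this is iterated. -/

noncomputable section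

namespace ChowProj

/-! ### Linear forms as primes of a polynomial ring -/

section LinForm

variable {A B : Type*} [CommRing A] [CommRing B] {n : ℕ}

/-- The linear form `∑ s, x_s X_s`. -/
def linForm (x : Fin (n + 1) → A) : MvPolynomial (Fin (n + 1)) A := ∑ s, C (x s) * X s

@[simp] lemma eval₂_linForm (φ : A →+* B) (x : Fin (n + 1) → A) (v : Fin (n + 1) → B) :
    eval₂ φ v (linForm x) = ∑ s, φ (x s) * v s := by
  simp [linForm, eval₂_sum, eval₂_mul]

@[simp] lemma eval_linForm (x v : Fin (n + 1) → A) : eval v (linForm x) = ∑ s, x s * v s := by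
  simp [linForm]

@[simp] lemma map_linForm (φ : A →+* B) (x : Fin (n + 1) → A) :
    map φ (linForm x) = linForm (fun s => φ (x s)) := by
  simp [linForm]

@[simp] lemma coeff_linForm (x : Fin (n + 1) → A) (s : Fin (n + 1)) :
    coeff (Finsupp.single s 1) (linForm x) = x s := by
  simp [linForm, coeff_sum, coeff_C_mul, coeff_X, Finsupp.single_left_inj]

lemma linForm_injective : Function.Injective (linForm (A := A) (n := n)) := fun x y h => by
  ext s; rw [← coeff_linForm x, h, coeff_linForm]

lemma linForm_zero : linForm (0 : Fin (n + 1) → A) = 0 := by simp [linForm]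

lemma linForm_eq_zero {x : Fin (n + 1) → A} : linForm x = 0 ↔ x = 0 := by
  rw [← linForm_zero, linForm_injective.eq_iff]

lemma linForm_smul (u : A) (x : Fin (n + 1) → A) : linForm (u • x) = C u * linForm x := by
  simp [linForm, Finset.mul_sum, mul_assoc]

lemma linForm_isHomogeneous (x : Fin (n + 1) → A) : (linForm x).IsHomogeneous 1 := by
  refine IsHomogeneous.sum _ _ _ fun s _ => ?_
  simpa using (isHomogeneous_C (Fin (n + 1)) (x s)).mul (isHomogeneous_X A s)

lemma prod_linForm_isHomogeneous {ι : Type*} (t : Finset ι) (x : ι → Fin (n + 1) → A) :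
    (∏ i ∈ t, linForm (x i)).IsHomogeneous t.card := by
  simpa using IsHomogeneous.prod t (fun i => linForm (x i)) (fun _ => 1)
    (fun i _ => linForm_isHomogeneous (x i))

lemma linForm_prime {F : Type*} [Field F] {x : Fin (n + 1) → F} (hx : x ≠ 0) :
    Prime (linForm x) := by
  have h0 : linForm x ≠ 0 := by rwa [Ne, linForm_eq_zero]
  refine (irreducible_of_totalDegree_eq_one ((linForm_isHomogeneous x).totalDegree h0) ?_).prime
  intro c hc
  obtain ⟨s, hs⟩ : ∃ s, x s ≠ 0 := by
    by_contra! h; exact hx (funext h)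
  refine isUnit_iff_ne_zero.2 fun hc0 => hs ?_
  have := hc (Finsupp.single s 1)
  rwa [coeff_linForm, hc0, zero_dvd_iff] at this

lemma linForm_associated {F : Type*} [Field F] {x y : Fin (n + 1) → F}
    (h : Associated (linForm x) (linForm y)) : ∃ u : F, u ≠ 0 ∧ y = u • x := by
  obtain ⟨u, hu⟩ := h
  obtain ⟨r, hr, hr'⟩ := isUnit_iff_eq_C_of_isReduced.1 u.isUnit
  refine ⟨r, hr.ne_zero, linForm_injective ?_⟩
  rw [← hu, hr', linForm_smul, mul_comm]

lemma linForm_associated_smul {F : Type*} [Field F] {x : Fin (n + 1) → F} {u : F} (hu : u ≠ 0) :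
    Associated (linForm x) (linForm (u • x)) := by
  rw [linForm_smul]
  exact (associated_isUnit_mul_left_iff ((isUnit_iff_ne_zero.2 hu).map C)).2 (Associated.refl _) |>.symm

lemma _root_.MvPolynomial.IsHomogeneous.eval₂_smul {σ : Type*} {d : ℕ} {f : MvPolynomial σ A}
    (hf : f.IsHomogeneous d) (φ : A →+* B) (u : B) (x : σ → B) :
    eval₂ φ (u • x) f = u ^ d * eval₂ φ x f := by
  rw [eval₂_eq, eval₂_eq, Finset.mul_sum]
  refine Finset.sum_congr rfl fun a ha => ?_
  rw [hf.degree_eq_sum_deg_support ha]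
  simp only [Pi.smul_apply, smul_eq_mul, mul_pow, Finset.prod_mul_distrib,
    Finset.prod_pow_eq_pow_sum]
  ring

end LinForm

/-! ### Wedges over an arbitrary extension; independence of the splitting -/

section HasWedge

variable {A B B' : Type*} [CommRing A] [CommRing B] [CommRing B'] {n : ℕ}

/-- `a = f ∧ g`, computed from a splitting of `g` over `B`. -/
def HasWedge (φ : A →+* B) (d D : ℕ) (f g : MvPolynomial (Fin (n + 1)) A) (a : A) : Prop :=
  ∃ (y : B) (x : Fin D → Fin (n + 1) → B),
    map φ g = C y * ∏ i, linForm (x i) ∧ φ a = y ^ d * ∏ i, eval₂ φ (x i) f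

lemma isWedge_iff [IsDomain A] {d D : ℕ} {f g : MvPolynomial (Fin (n + 1)) A} {a : A} :
    IsWedge d D f g a ↔ HasWedge (algebraMap A (FracClosure A)) d D f g a := Iff.rfl

lemma HasWedge.comp {φ : A →+* B} {d D : ℕ} {f g : MvPolynomial (Fin (n + 1)) A} {a : A}
    (h : HasWedge φ d D f g a) (ψ : B →+* B') : HasWedge (ψ.comp φ) d D f g a := by
  obtain ⟨y, x, h1, h2⟩ := h
  refine ⟨ψ y, fun i s => ψ (x i s), ?_, ?_⟩
  · rw [← map_map, h1]; simp [map_prod]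
  · rw [RingHom.comp_apply, h2]
    simp only [map_mul, map_pow, map_prod, eval₂_comp_left]
    rfl

lemma hasWedge_map {A' : Type*} [CommRing A'] (θ : A →+* A') {φ : A' →+* B} {d D : ℕ}
    {f g : MvPolynomial (Fin (n + 1)) A} {a : A} :
    HasWedge φ d D (map θ f) (map θ g) (θ a) ↔ HasWedge (φ.comp θ) d D f g a := by
  simp only [HasWedge, map_map, eval₂_map, RingHom.comp_apply]

lemma HasWedge.eval₂_smul_prod {ι : Type*} (t : Finset ι) {φ : A →+* B} {d : ℕ}
    {f : MvPolynomial (Fin (n + 1)) A} (hf : f.IsHomogeneous d) (u : ι → B)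
    (x : ι → Fin (n + 1) → B) :
    ∏ i ∈ t, eval₂ φ (u i • x i) f = (∏ i ∈ t, u i) ^ d * ∏ i ∈ t, eval₂ φ (x i) f := by
  simp only [hf.eval₂_smul, Finset.prod_mul_distrib, Finset.prod_pow]

/-- For linear forms over a field, proportional factorizations give the same value. -/
lemma rel_linForm_prod {F : Type*} [Field F] {φ : A →+* F} {d : ℕ}
    {f : MvPolynomial (Fin (n + 1)) A} (hf : f.IsHomogeneous d)
    {s t : Multiset (Fin (n + 1) → F)}
    (h : Multiset.Rel (fun x y => Associated (linForm x) (linForm y)) s t) :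
    ∃ u : F, u ≠ 0 ∧ (t.map linForm).prod = C u * (s.map linForm).prod ∧
      (t.map fun x => eval₂ φ x f).prod = u ^ d * (s.map fun x => eval₂ φ x f).prod := by
  induction h with
  | zero => exact ⟨1, by simp⟩
  | @cons a b as bs hab _ ih =>
    obtain ⟨u, hu, h1, h2⟩ := ih
    obtain ⟨w, hw, rfl⟩ := linForm_associated hab
    refine ⟨w * u, mul_ne_zero hw hu, ?_, ?_⟩
    · simp only [Multiset.map_cons, Multiset.prod_cons, h1, linForm_smul, map_mul]; ring
    · simp only [Multiset.map_cons, Multiset.prod_cons, h2, hf.eval₂_smul]; ring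

lemma multiset_prod_fin {M : Type*} [CommMonoid M] {α : Type*} {D : ℕ} (x : Fin D → α)
    (g : α → M) : ((Finset.univ.val.map x).map g).prod = ∏ i, g (x i) := by
  rw [Multiset.map_map]; rfl

/-- Covers the case where unique factorization says nothing. For `d > 0` a vanishing factor kills
the value; for `d = 0` the form `f` is a constant and each of the `D` factors contributes it. -/
lemma eval₂_prod_eq_zero_or {F : Type*} [Field F] {φ : A →+* F} {d D : ℕ}
    {f : MvPolynomial (Fin (n + 1)) A} (hf : f.IsHomogeneous d) {y : F}
    {x : Fin D → Fin (n + 1) → F} (h : C y * ∏ i, linForm (x i) = 0) :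
    y ^ d * ∏ i, eval₂ φ (x i) f = 0 ^ d * φ (constantCoeff f) ^ D := by
  rcases Nat.eq_zero_or_pos d with rfl | hd
  · have : f = C (constantCoeff f) := by
      have := (totalDegree_eq_zero_iff_eq_C).1 ((totalDegree_zero_iff_isHomogeneous _).2 hf)
      simpa [constantCoeff_eq] using this
    rw [this]; simp
  · rw [zero_pow hd.ne', zero_mul]
    rcases mul_eq_zero.1 h with h | h
    · rw [C_eq_zero] at h
      rw [h, zero_pow hd.ne', zero_mul]
    · obtain ⟨i, _, hi⟩ := Finset.prod_eq_zero_iff.1 h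
      rw [linForm_eq_zero] at hi
      refine mul_eq_zero_of_right _ (Finset.prod_eq_zero (Finset.mem_univ i) ?_)
      have := hf.eval₂_smul φ 0 (x i)
      rw [zero_smul, zero_pow hd.ne', zero_mul] at this
      rw [hi, this]

/-- The value does not depend on the splitting. -/
theorem splitting_value_unique {F : Type*} [Field F] {φ : A →+* F} {d D : ℕ}
    {f : MvPolynomial (Fin (n + 1)) A} (hf : f.IsHomogeneous d) {y y' : F}
    {x x' : Fin D → Fin (n + 1) → F}
    (h : C y * ∏ i, linForm (x i) = C y' * ∏ i, linForm (x' i)) :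
    y ^ d * ∏ i, eval₂ φ (x i) f = y' ^ d * ∏ i, eval₂ φ (x' i) f := by
  by_cases h0 : C y * ∏ i, linForm (x i) = 0
  · rw [eval₂_prod_eq_zero_or hf h0, eval₂_prod_eq_zero_or hf (h ▸ h0)]
  have h0' := h ▸ h0
  have hx : ∀ i, x i ≠ 0 := fun i hi => h0 <| by
    rw [Finset.prod_eq_zero (Finset.mem_univ i) (by rw [hi, linForm_zero]), mul_zero]
  have hx' : ∀ i, x' i ≠ 0 := fun i hi => h0' <| by
    rw [Finset.prod_eq_zero (Finset.mem_univ i) (by rw [hi, linForm_zero]), mul_zero]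
  have hy : y ≠ 0 := fun hy => h0 (by simp [hy])
  have hy' : y' ≠ 0 := fun hy => h0' (by simp [hy])
  -- The factors are primes of a factorial ring, so the two families agree up to order and scalars;
  -- the scalars are absorbed by `y` on one side and, by homogeneity of `f`, by `y ^ d` on the
  -- other.
  have hrel : Multiset.Rel Associated ((Finset.univ.val.map x).map linForm)
      ((Finset.univ.val.map x').map linForm) := by
    refine UniqueFactorizationMonoid.factors_unique ?_ ?_ ?_
    · simp only [Multiset.mem_map, Finset.mem_val, Finset.mem_univ, true_and]
      rintro _ ⟨_, ⟨i, rfl⟩, rfl⟩; exact (linForm_prime (hx i)).irreducible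
    · simp only [Multiset.mem_map, Finset.mem_val, Finset.mem_univ, true_and]
      rintro _ ⟨_, ⟨i, rfl⟩, rfl⟩; exact (linForm_prime (hx' i)).irreducible
    · rw [multiset_prod_fin, multiset_prod_fin]
      have e1 : Associated (∏ i, linForm (x i)) (C y * ∏ i, linForm (x i)) :=
        ((associated_isUnit_mul_left_iff ((isUnit_iff_ne_zero.2 hy).map C)).2 (.refl _)).symm
      have e2 : Associated (C y' * ∏ i, linForm (x' i)) (∏ i, linForm (x' i)) :=
        ((associated_isUnit_mul_left_iff ((isUnit_iff_ne_zero.2 hy').map C)).2 (.refl _))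
      rw [h] at e1
      exact e1.trans e2
  rw [Multiset.rel_map] at hrel
  obtain ⟨u, hu, h1, h2⟩ := rel_linForm_prod (φ := φ) hf hrel
  rw [multiset_prod_fin, multiset_prod_fin] at h1 h2
  have hyu : y = y' * u := by
    rw [h1, ← mul_assoc, ← C_mul] at h
    have hne : (∏ i, linForm (x i)) ≠ 0 := right_ne_zero_of_mul h0
    exact C_injective _ _ (mul_right_cancel₀ hne h)
  rw [h2, hyu]; ring

/-- The wedge is unique. -/
theorem HasWedge.unique {F : Type*} [Field F] {φ : A →+* F} (hφ : Function.Injective φ) {d D : ℕ}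
    {f g : MvPolynomial (Fin (n + 1)) A} (hf : f.IsHomogeneous d) {a a' : A}
    (h : HasWedge φ d D f g a) (h' : HasWedge φ d D f g a') : a = a' := by
  obtain ⟨y, x, h1, h2⟩ := h
  obtain ⟨y', x', h1', h2'⟩ := h'
  apply hφ
  rw [h2, h2', splitting_value_unique hf (h1.symm.trans h1')]

end HasWedge

/-! ### Splittings as solutions of polynomial equations -/

section Descent

variable {A F : Type*} [CommRing A] [CommRing F] {n : ℕ}

/-- The equations saying that a point `(y, x)` is a splitting of `g` at which `f` has value `a`. -/
def wedgeIdeal (φ : A →+* F) (d D : ℕ) (f g : MvPolynomial (Fin (n + 1)) A) (a : A) :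
    Ideal (MvPolynomial (Option (Fin D × Fin (n + 1))) F) :=
  Ideal.span (Set.range (fun m => coeff m (map (C.comp φ) g -
      C (X none) * ∏ i : Fin D, linForm fun s => (X (some (i, s)) : MvPolynomial (Option (Fin D × Fin (n + 1))) F))) ∪
    {C (φ a) - X none ^ d * ∏ i : Fin D, eval₂ (C.comp φ) (fun s => X (some (i, s))) f})

lemma wedgeIdeal_le_ker {B : Type*} [CommRing B] (φ : A →+* F) (β : F →+* B) {d D : ℕ}
    {f g : MvPolynomial (Fin (n + 1)) A} {a : A} (v : Option (Fin D × Fin (n + 1)) → B) :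
    wedgeIdeal φ d D f g a ≤ RingHom.ker (eval₂Hom β v) ↔
      map (β.comp φ) g = C (v none) * ∏ i, linForm (fun s => v (some (i, s))) ∧
      β (φ a) = v none ^ d * ∏ i, eval₂ (β.comp φ) (fun s => v (some (i, s))) f := by
  have hC : (eval₂Hom β v).comp (C.comp φ) = β.comp φ := by ext; simp
  have h1 : map (eval₂Hom β v) (map (C.comp φ) g -
      C (X none) * ∏ i : Fin D,
        linForm fun s => (X (some (i, s)) : MvPolynomial (Option (Fin D × Fin (n + 1))) F)) =
      map (β.comp φ) g - C (v none) * ∏ i, linForm (fun s => v (some (i, s))) := by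
    rw [map_sub, map_map, hC]; simp
  have h2 : eval₂Hom β v
      (C (φ a) - X none ^ d * ∏ i : Fin D, eval₂ (C.comp φ) (fun s => X (some (i, s))) f) =
      β (φ a) - v none ^ d * ∏ i, eval₂ (β.comp φ) (fun s => v (some (i, s))) f := by
    rw [map_sub, map_mul, map_prod]
    simp only [eval₂_comp_left, hC]
    simp [Function.comp_def]
  rw [wedgeIdeal, Ideal.span_le, Set.union_subset_iff, Set.range_subset_iff,
    Set.singleton_subset_iff]
  simp only [SetLike.mem_coe, RingHom.mem_ker, h2, sub_eq_zero (b := v none ^ d * _)]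
  refine and_congr ?_ Iff.rfl
  rw [← sub_eq_zero (a := map _ g), ← h1, MvPolynomial.ext_iff]
  simp only [coeff_map, coeff_zero]

lemma hasWedge_iff_exists_ker {B : Type*} [CommRing B] (φ : A →+* F) (β : F →+* B) {d D : ℕ}
    {f g : MvPolynomial (Fin (n + 1)) A} {a : A} :
    HasWedge (β.comp φ) d D f g a ↔
      ∃ v, wedgeIdeal φ d D f g a ≤ RingHom.ker (eval₂Hom β v) := by
  simp only [wedgeIdeal_le_ker]
  constructor
  · rintro ⟨y, x, h1, h2⟩
    exact ⟨fun o => o.elim y (fun p => x p.1 p.2), h1, h2⟩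
  · rintro ⟨v, h1, h2⟩
    exact ⟨_, _, h1, h2⟩

/-- Nullstellensatz: the equations for a splitting have coefficients in the field `F`, and a
solution in some nonzero `F`-algebra shows that their ideal is proper. So they have a solution in
every algebraically closed extension. -/
theorem HasWedge.descend {F : Type*} [Field F] {φ : A →+* F} {B : Type*} [CommRing B] [Nontrivial B]
    {β : F →+* B} {d D : ℕ} {f g : MvPolynomial (Fin (n + 1)) A} {a : A}
    (h : HasWedge (β.comp φ) d D f g a) {Ω : Type*} [Field Ω] [IsAlgClosed Ω] (ω : F →+* Ω) :
    HasWedge (ω.comp φ) d D f g a := by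
  obtain ⟨v, hv⟩ := (hasWedge_iff_exists_ker φ β).1 h
  obtain ⟨M, hM, hIM⟩ := Ideal.exists_le_maximal _ (ne_top_of_le_ne_top (RingHom.ker_ne_top _) hv)
  let := ω.toAlgebra
  obtain ⟨x, rfl⟩ := eq_vanishingIdeal_singleton_of_isMaximal Ω hM
  refine (hasWedge_iff_exists_ker φ ω).2 ⟨x, hIM.trans fun p hp => ?_⟩
  rw [mem_vanishingIdeal_singleton_iff] at hp
  exact hp

end Descent

/-! ### Valuation rings and specialization of wedges -/

section Valuation

variable {A : Type*} [CommRing A] {n : ℕ}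

/-- A splitting over a field can be scaled to be integral for a valuation ring, with primitive
linear forms. -/
lemma exists_integral_splitting {Ω : Type*} [Field Ω] (V : ValuationSubring Ω) {D : ℕ}
    {g : MvPolynomial (Fin (n + 1)) V} (hg : g ≠ 0) {y : Ω} {x : Fin D → Fin (n + 1) → Ω}
    (h : map V.subtype g = C y * ∏ i, linForm (x i)) :
    ∃ (y' : V) (x' : Fin D → Fin (n + 1) → V), g = C y' * ∏ i, linForm (x' i) := by
  have hinj : Function.Injective (map V.subtype : MvPolynomial (Fin (n + 1)) V →+* _) :=
    map_injective _ Subtype.val_injective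
  have h0 : C y * ∏ i, linForm (x i) ≠ 0 := by
    rw [← h]; exact fun h => hg (hinj (by rw [h, map_zero]))
  have hx : ∀ i, ∃ (u : Ω) (z : Fin (n + 1) → V), u ≠ 0 ∧ (∃ s, z s = 1) ∧
      x i = u • fun s => (z s : Ω) := by
    intro i
    have hxi : x i ≠ 0 := fun hi => h0 <| by
      rw [Finset.prod_eq_zero (Finset.mem_univ i) (by rw [hi, linForm_zero]), mul_zero]
    -- Dividing by a coordinate of largest valuation makes all coordinates integral and one of them
    -- `1`.
    obtain ⟨s, -, hs⟩ := Finset.exists_max_image Finset.univ (fun s => V.valuation (x i s))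
      ⟨0, Finset.mem_univ _⟩
    have hs0 : x i s ≠ 0 := by
      intro h0
      refine hxi (funext fun t => ?_)
      have := hs t (Finset.mem_univ _)
      rw [h0, map_zero, le_zero_iff, map_eq_zero] at this
      exact this
    have hmem : ∀ t, x i t / x i s ∈ V := by
      intro t
      rw [← V.valuation_le_one_iff, map_div₀]
      exact div_le_one_of_le₀ (hs t (Finset.mem_univ _)) zero_le
    refine ⟨x i s, fun t => ⟨x i t / x i s, hmem t⟩, hs0, ⟨s, ?_⟩, ?_⟩
    · ext; simp [div_self hs0]
    · ext t; simp [mul_div_cancel₀ _ hs0]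
  choose u z hu hz hxz using hx
  have hfac : map V.subtype g = C (y * ∏ i, u i) * map V.subtype (∏ i, linForm (z i)) := by
    rw [h, map_prod, C_mul, map_prod, mul_assoc, ← Finset.prod_mul_distrib]
    simp only [map_linForm, hxz, linForm_smul]
    rfl
  -- Gauss's lemma: the product of primitive forms has a nonzero reduction, hence a unit
  -- coefficient. Comparing that coefficient with the one of `g` shows that the scalar in front is
  -- integral.
  have hres : map (IsLocalRing.residue V) (∏ i, linForm (z i)) ≠ 0 := by
    rw [map_prod]
    refine Finset.prod_ne_zero_iff.2 fun i _ => ?_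
    rw [map_linForm, Ne, linForm_eq_zero]
    obtain ⟨s, hs⟩ := hz i
    intro h
    have := congr_fun h s
    simp [hs] at this
  obtain ⟨m, hm⟩ := ne_zero_iff.1 hres
  rw [coeff_map, Ne, IsLocalRing.residue_eq_zero_iff, IsLocalRing.mem_maximalIdeal, mem_nonunits_iff,
    not_not] at hm
  obtain ⟨w, hw⟩ := hm
  have hcoeff := congr_arg (coeff m) hfac
  rw [coeff_C_mul, coeff_map, coeff_map, ← hw] at hcoeff
  have hy1 : y * ∏ i, u i = V.subtype (coeff m g * (w⁻¹ : Vˣ)) := by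
    rw [map_mul, hcoeff, mul_assoc, ← map_mul, Units.mul_inv, map_one, mul_one]
  refine ⟨coeff m g * (w⁻¹ : Vˣ), z, hinj ?_⟩
  rw [hfac, hy1, map_mul (map V.subtype), map_C]

lemma hasWedge_zero {A B : Type*} [CommRing A] [CommRing B] (φ : A →+* B) {d : ℕ} (D : ℕ)
    {f : MvPolynomial (Fin (n + 1)) A} (hf : f.IsHomogeneous d) :
    HasWedge φ d D f 0 (0 ^ d * constantCoeff f ^ D) := by
  refine ⟨0, 0, by simp, ?_⟩
  rcases Nat.eq_zero_or_pos d with rfl | hd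
  · have : f = C (constantCoeff f) := by
      have := (totalDegree_eq_zero_iff_eq_C).1 ((totalDegree_zero_iff_isHomogeneous _).2 hf)
      simpa [constantCoeff_eq] using this
    rw [this]; simp
  · simp [hd.ne']

/-- The wedge over a field takes values in every valuation ring containing the coefficients. -/
lemma HasWedge.of_valuationSubring {Ω : Type*} [Field Ω] {V : ValuationSubring Ω} {φ : A →+* V}
    {d D : ℕ} {f g : MvPolynomial (Fin (n + 1)) A} (hf : f.IsHomogeneous d) (hg : map φ g ≠ 0)
    {y : Ω} {x : Fin D → Fin (n + 1) → Ω}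
    (h : map (V.subtype.comp φ) g = C y * ∏ i, linForm (x i)) :
    ∃ (y' : V) (x' : Fin D → Fin (n + 1) → V), map φ g = C y' * ∏ i, linForm (x' i) ∧
      y ^ d * ∏ i, eval₂ (V.subtype.comp φ) (x i) f =
        V.subtype (y' ^ d * ∏ i, eval₂ φ (x' i) f) := by
  rw [← map_map] at h
  obtain ⟨y', x', h'⟩ := exists_integral_splitting V hg h
  refine ⟨y', x', h', ?_⟩
  have key : C y * ∏ i, linForm (x i) =
      C (V.subtype y') * ∏ i, linForm (fun s => V.subtype (x' i s)) := by
    rw [← h, h']; simp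
  rw [splitting_value_unique hf key]
  simp only [map_mul, map_pow, map_prod, eval₂_comp_left]
  rfl

/-- Puts fields receiving `A` with the same kernel over one common field, as `HasWedge.descend`
requires. -/
lemma exists_fractionRing_lift {E : Type*} [Field E] (p : Ideal A) [p.IsPrime] (τ : A →+* E)
    (hτ : ∀ a, τ a = 0 ↔ a ∈ p) : ∃ τ' : FractionRing (A ⧸ p) →+* E,
      τ'.comp ((algebraMap (A ⧸ p) (FractionRing (A ⧸ p))).comp (Ideal.Quotient.mk p)) = τ := by
  have hinj : Function.Injective (Ideal.Quotient.lift p τ fun a ha => (hτ a).2 ha) := by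
    rw [injective_iff_map_eq_zero]
    intro q
    obtain ⟨a, rfl⟩ := Ideal.Quotient.mk_surjective q
    rw [Ideal.Quotient.lift_mk, Ideal.Quotient.eq_zero_iff_mem]
    exact (hτ a).1
  refine ⟨IsFractionRing.lift hinj, ?_⟩
  ext a
  simp

/-- Specialization: a wedge computed over a field containing `A` has, under any homomorphism to an
algebraically closed field, the expected image. -/
theorem HasWedge.specialize {Ω Ω' : Type*} [Field Ω] [Field Ω'] [IsAlgClosed Ω'] {φ : A →+* Ω}
    (hφ : Function.Injective φ) (ψ : A →+* Ω') {d D : ℕ} {f g : MvPolynomial (Fin (n + 1)) A}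
    (hf : f.IsHomogeneous d) {a : A} (h : HasWedge φ d D f g a) : HasWedge ψ d D f g a := by
  by_cases hg : g = 0
  · subst hg
    rw [h.unique hφ hf (hasWedge_zero φ D hf)]
    exact hasWedge_zero ψ D hf
  have : IsDomain A := hφ.isDomain φ
  -- A valuation ring `V` of `Ω` dominating the localization of `A` at `p` has the property that `A`
  -- maps to its residue field with kernel exactly `p`, the same kernel as for `ψ`.
  let p := RingHom.ker ψ
  have hp : p.IsPrime := RingHom.ker_isPrime ψ
  let L := Localization.AtPrime p
  let φ' : L →+* Ω := IsLocalization.lift (M := p.primeCompl) (g := φ) fun y =>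
    isUnit_iff_ne_zero.2 fun h0 => y.2 <| by
      have : (y : A) = 0 := hφ (by rw [h0, map_zero])
      rw [this]; exact p.zero_mem
  obtain ⟨V, hV, hloc⟩ := IsLocalRing.exists_factor_valuationRing φ'
  let θ : A →+* V := (φ'.codRestrict V.toSubring hV).comp (algebraMap A L)
  have hθ : V.subtype.comp θ = φ := by
    ext a
    exact IsLocalization.lift_eq _ a
  let ρ : A →+* IsLocalRing.ResidueField V := (IsLocalRing.residue V).comp θ
  have hρ : ∀ a, ρ a = 0 ↔ a ∈ p := by
    intro a
    rw [RingHom.comp_apply, IsLocalRing.residue_eq_zero_iff, IsLocalRing.mem_maximalIdeal,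
      mem_nonunits_iff, not_iff_comm]
    rw [← Ideal.mem_primeCompl_iff, ← IsLocalization.AtPrime.isUnit_to_map_iff L p a]
    exact ⟨fun h => h.map (φ'.codRestrict V.toSubring hV), fun h => hloc.map_nonunit _ h⟩
  obtain ⟨y, x, h1, h2⟩ := h
  rw [← hθ] at h1 h2
  have hg' : map θ g ≠ 0 := fun h0 => hg <| by
    refine map_injective φ hφ ?_
    rw [← hθ, ← map_map, h0, map_zero, map_zero]
  obtain ⟨y', x', h1', h2'⟩ := HasWedge.of_valuationSubring hf hg' h1
  -- The wedge equation now holds in `V`, so it can be reduced to the residue field and then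
  -- descended along the fraction field of `A ⧸ p` to `Ω'`.
  have hW : HasWedge θ d D f g a := ⟨y', x', h1', Subtype.val_injective (h2.trans h2')⟩
  obtain ⟨ρ', hρ'⟩ := exists_fractionRing_lift p ρ hρ
  obtain ⟨ψ', hψ'⟩ := exists_fractionRing_lift p ψ fun _ => Iff.rfl
  have := hW.comp (IsLocalRing.residue V)
  change HasWedge ρ d D f g a at this
  rw [← hρ'] at this
  rw [← hψ']
  exact this.descend ψ'

end Valuation

/-! ### Rationality of the wedge over purely inseparable extensions -/

section PurelyInseparable

variable {E Ω : Type*} [Field E] [Field Ω] [Algebra E Ω] {n : ℕ}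

/-- There are finitely many coefficients, and Frobenius is additive: one large power of `q` moves
all of them into `E`. -/
lemma exists_map_eq_pow [IsPurelyInseparable E Ω] (q : ℕ) [ExpChar E q] {σ : Type*}
    (r : MvPolynomial σ Ω) :
    ∃ (N : ℕ) (R : MvPolynomial σ E), map (algebraMap E Ω) R = r ^ q ^ N := by
  have hq : ExpChar Ω q := expChar_of_injective_algebraMap (algebraMap E Ω).injective q
  have hq' : ExpChar (MvPolynomial σ Ω) q :=
    expChar_of_injective_ringHom (C_injective σ Ω) q
  have mono : ∀ {r : MvPolynomial σ Ω} {N : ℕ},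
      (∃ R : MvPolynomial σ E, map (algebraMap E Ω) R = r ^ q ^ N) → ∀ M, N ≤ M →
      ∃ R : MvPolynomial σ E, map (algebraMap E Ω) R = r ^ q ^ M := by
    rintro r N ⟨R, hR⟩ M hM
    exact ⟨R ^ q ^ (M - N), by rw [map_pow, hR, ← pow_mul, ← pow_add, Nat.add_sub_cancel' hM]⟩
  induction r using MvPolynomial.induction_on with
  | C a =>
    obtain ⟨N, b, hb⟩ := IsPurelyInseparable.pow_mem E q a
    exact ⟨N, C b, by rw [map_C, hb, C_pow]⟩
  | add r₁ r₂ h₁ h₂ =>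
    obtain ⟨N₁, h₁⟩ := h₁
    obtain ⟨N₂, h₂⟩ := h₂
    obtain ⟨R₁, h₁⟩ := mono h₁ (max N₁ N₂) (le_max_left _ _)
    obtain ⟨R₂, h₂⟩ := mono h₂ (max N₁ N₂) (le_max_right _ _)
    exact ⟨_, R₁ + R₂, by rw [map_add, h₁, h₂, add_pow_expChar_pow]⟩
  | mul_X r s h =>
    obtain ⟨N, R, h⟩ := h
    exact ⟨N, R * X s ^ q ^ N, by simp [h, mul_pow]⟩

lemma linForm_pow_expChar (q : ℕ) [ExpChar Ω q] (k : ℕ) (l : Fin (n + 1) → Ω) :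
    linForm l ^ q ^ k = ∑ s, C (l s ^ q ^ k) * X s ^ q ^ k := by
  have hq' : ExpChar (MvPolynomial (Fin (n + 1)) Ω) q :=
    expChar_of_injective_ringHom (C_injective _ Ω) q
  have := map_sum (iterateFrobenius (MvPolynomial (Fin (n + 1)) Ω) q k)
    (fun s => C (l s) * X s) Finset.univ
  simp only [iterateFrobenius_def, mul_pow, ← C_pow] at this
  exact this

lemma coeff_linForm_pow_expChar (q : ℕ) [ExpChar Ω q] (k : ℕ) (l : Fin (n + 1) → Ω)
    (s : Fin (n + 1)) :
    coeff (Finsupp.single s (q ^ k)) (linForm l ^ q ^ k) = l s ^ q ^ k := by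
  have : q ^ k ≠ 0 := pow_ne_zero _ (expChar_pos Ω q).ne'
  rw [linForm_pow_expChar, coeff_sum, Finset.sum_eq_single s]
  · rw [coeff_C_mul, coeff_X_pow, if_pos rfl, mul_one]
  · intro b _ hb
    rw [coeff_C_mul, coeff_X_pow, if_neg (by simpa [Finsupp.single_left_inj this] using hb),
      mul_zero]
  · simp

lemma eval₂_pow_mem_range (q : ℕ) [ExpChar E q] (k : ℕ) {l : Fin (n + 1) → Ω}
    (hl : ∀ s, l s ^ q ^ k ∈ (algebraMap E Ω).range) (f : MvPolynomial (Fin (n + 1)) E) :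
    eval₂ (algebraMap E Ω) l f ^ q ^ k ∈ (algebraMap E Ω).range := by
  have hq : ExpChar Ω q := expChar_of_injective_algebraMap (algebraMap E Ω).injective q
  induction f using MvPolynomial.induction_on with
  | C a => exact ⟨a ^ q ^ k, by simp⟩
  | add f₁ f₂ h₁ h₂ =>
    rw [eval₂_add, add_pow_expChar_pow]
    exact add_mem h₁ h₂
  | mul_X f s h =>
    rw [eval₂_mul, eval₂_X, mul_pow]
    exact mul_mem h (hl s)

lemma linForm_eq_smul_of_dvd_pow {x l : Fin (n + 1) → Ω} (hx : x ≠ 0) (hl : l ≠ 0) {N : ℕ}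
    (h : linForm x ∣ linForm l ^ N) : ∃ w : Ω, w ≠ 0 ∧ x = w • l := by
  have h1 := (linForm_prime hx).dvd_of_dvd_pow h
  exact linForm_associated
    ((linForm_prime hx).irreducible.associated_of_dvd (linForm_prime hl).irreducible h1).symm

/-- An irreducible polynomial that splits over a purely inseparable extension has rational
values. -/
lemma irreducible_splitting_value_mem [IsPurelyInseparable E Ω] {d : ℕ}
    {f : MvPolynomial (Fin (n + 1)) E} (hf : f.IsHomogeneous d) {ι : Type*} {t : Finset ι} {b : Ω}
    {x : ι → Fin (n + 1) → Ω} (hx : ∀ i ∈ t, x i ≠ 0) {g : MvPolynomial (Fin (n + 1)) E}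
    (hg : Irreducible g) (h : map (algebraMap E Ω) g = C b * ∏ i ∈ t, linForm (x i)) :
    b ^ d * ∏ i ∈ t, eval₂ (algebraMap E Ω) (x i) f ∈ (algebraMap E Ω).range := by
  obtain ⟨q, hqE⟩ := ExpChar.exists E
  have hq : ExpChar Ω q := expChar_of_injective_algebraMap (algebraMap E Ω).injective q
  have hinj : Function.Injective (map (algebraMap E Ω) :
      MvPolynomial (Fin (n + 1)) E →+* MvPolynomial (Fin (n + 1)) Ω) :=
    map_injective _ (algebraMap E Ω).injective
  have hg0 : map (algebraMap E Ω) g ≠ 0 := fun h0 => hg.ne_zero (hinj (by rw [h0, map_zero]))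
  have hb : b ≠ 0 := by rintro rfl; simp [h] at hg0
  obtain ⟨i₀, hi₀⟩ : t.Nonempty := by
    rw [Finset.nonempty_iff_ne_empty]
    rintro rfl
    rw [Finset.prod_empty, mul_one] at h
    have h1 : g = C (coeff 0 g) := by
      ext m
      rw [coeff_C]
      split_ifs with hm
      · rw [hm]
      · have := congr_arg (coeff m) h
        rw [coeff_map, coeff_C, if_neg hm] at this
        exact (algebraMap E Ω).injective (by rw [this, map_zero])
    refine hg.not_isUnit ?_
    rw [h1]
    refine (isUnit_iff_ne_zero.2 fun h0 => hg.ne_zero ?_).map C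
    rw [h1, h0, C_0]
  obtain ⟨s₀, hs₀⟩ : ∃ s, x i₀ s ≠ 0 := by
    by_contra! h; exact hx i₀ hi₀ (funext h)
  set l : Fin (n + 1) → Ω := (x i₀ s₀)⁻¹ • x i₀ with hl
  have hls : l s₀ = 1 := by simp [hl, hs₀]
  have hl0 : l ≠ 0 := fun h0 => by simp [h0] at hls
  have hldvd : linForm l ∣ map (algebraMap E Ω) g := by
    rw [h, hl]
    refine Dvd.dvd.mul_left ?_ _
    exact ((linForm_associated_smul (inv_ne_zero hs₀)).symm.dvd).trans
      (Finset.dvd_prod_of_mem (fun i => linForm (x i)) hi₀)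
  obtain ⟨r, hr⟩ := hldvd
  -- A power of the factor `l` is defined over `E` and divides a power of the irreducible `g`, so it
  -- is associated to a power of `g`. Hence all linear factors of `g` are proportional to `l`.
  obtain ⟨N, L, hL⟩ := exists_map_eq_pow (E := E) q (linForm l)
  obtain ⟨M, R, hR⟩ := exists_map_eq_pow (E := E) q r
  have hLdvd : L ∣ g ^ (q ^ N * q ^ M) := by
    refine ⟨L ^ (q ^ M - 1) * R ^ q ^ N, hinj ?_⟩
    have hM : q ^ M = 1 + (q ^ M - 1) := by
      have : 0 < q ^ M := pow_pos (expChar_pos Ω q) _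
      omega
    rw [← mul_assoc, mul_comm L, ← pow_succ, Nat.sub_add_cancel (by omega)]
    simp only [map_mul, map_pow, hL, hR, hr, mul_pow]
    ring
  obtain ⟨m, -, hm⟩ := (dvd_prime_pow hg.prime _).1 hLdvd
  have hassoc : Associated (linForm l ^ q ^ N) (map (algebraMap E Ω) g ^ m) := by
    rw [← hL, ← map_pow]; exact hm.map _
  have hqN : q ^ N ≠ 0 := pow_ne_zero _ (expChar_pos Ω q).ne'
  have hm0 : m ≠ 0 := by
    rintro rfl
    rw [pow_zero, associated_one_iff_isUnit, isUnit_pow_iff hqN] at hassoc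
    exact (linForm_prime hl0).not_isUnit hassoc
  have hxl : ∀ i ∈ t, ∃ w : Ω, w ≠ 0 ∧ x i = w • l := fun i hi => by
    refine linForm_eq_smul_of_dvd_pow (N := q ^ N) (hx i hi) hl0 ?_
    refine Dvd.dvd.trans ?_ hassoc.symm.dvd
    refine Dvd.dvd.trans ?_ (dvd_pow_self _ hm0)
    rw [h]
    exact Dvd.dvd.mul_left (Finset.dvd_prod_of_mem (fun i => linForm (x i)) hi) _
  choose! w hw hxw using hxl
  have hprod : map (algebraMap E Ω) g = C (b * ∏ i ∈ t, w i) * linForm l ^ t.card := by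
    rw [h, C_mul, map_prod, mul_assoc, ← Finset.prod_const, ← Finset.prod_mul_distrib]
    exact congr_arg _ (Finset.prod_congr rfl fun i hi => by rw [hxw i hi, linForm_smul])
  set c := b * ∏ i ∈ t, w i with hc
  have hc0 : c ≠ 0 := mul_ne_zero hb (Finset.prod_ne_zero_iff.2 hw)
  -- The number of factors of `g` divides a power of `q`, so it is itself a power of `q`.
  have hcard : q ^ N = t.card * m := by
    rw [hprod, mul_pow, ← C_pow, ← pow_mul] at hassoc
    have h2 := hassoc.trans (associated_isUnit_mul_left_iff
      ((isUnit_iff_ne_zero.2 (pow_ne_zero m hc0)).map C) |>.2 (Associated.refl _))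
    exact le_antisymm
      ((pow_dvd_pow_iff (linForm_prime hl0).ne_zero (linForm_prime hl0).not_isUnit).1 h2.dvd)
      ((pow_dvd_pow_iff (linForm_prime hl0).ne_zero (linForm_prime hl0).not_isUnit).1 h2.symm.dvd)
  obtain ⟨k, hk⟩ : ∃ k, t.card = q ^ k := by
    rcases hqE with _ | hqp
    · simp only [one_pow] at hcard ⊢
      exact ⟨0, Nat.eq_one_of_mul_eq_one_right hcard.symm⟩
    · obtain ⟨k, -, hk⟩ := (Nat.dvd_prime_pow hqp).1 (Dvd.intro _ hcard.symm)
      exact ⟨k, hk⟩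
  -- Here `g = c · l ^ (q ^ k)` has no mixed monomials, and its coefficients are read off directly.
  -- The normalization `l s₀ = 1` then isolates `c`.
  have hcoeff : ∀ s, c * l s ^ q ^ k ∈ (algebraMap E Ω).range := fun s => by
    refine ⟨coeff (Finsupp.single s (q ^ k)) g, ?_⟩
    rw [← coeff_map, hprod, hk, coeff_C_mul, coeff_linForm_pow_expChar]
  have hcE : c ∈ (algebraMap E Ω).range := by simpa [hls] using hcoeff s₀
  have hlE : ∀ s, l s ^ q ^ k ∈ (algebraMap E Ω).range := fun s => by
    obtain ⟨c', hc'⟩ := hcE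
    obtain ⟨e, he⟩ := hcoeff s
    refine ⟨e / c', ?_⟩
    rw [map_div₀, he, hc', mul_div_cancel_left₀ _ hc0]
  have hval : b ^ d * ∏ i ∈ t, eval₂ (algebraMap E Ω) (x i) f =
      c ^ d * eval₂ (algebraMap E Ω) l f ^ q ^ k := by
    rw [← hk, ← Finset.prod_const, hc, mul_pow, mul_assoc, ← HasWedge.eval₂_smul_prod t hf w]
    exact congr_arg _ (Finset.prod_congr rfl fun i hi => by rw [hxw i hi])
  rw [hval]
  exact mul_mem (pow_mem hcE d) (eval₂_pow_mem_range q k hlE f)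

/-- Induction on the irreducible factors of `g` over `E`: the linear factors are distributed among
them, and the value is multiplicative. Finsets index the factors so that the induction can pass to
subfamilies. -/
lemma splitting_value_mem_of_isPurelyInseparable [IsPurelyInseparable E Ω] {d : ℕ}
    {f : MvPolynomial (Fin (n + 1)) E} (hf : f.IsHomogeneous d) {ι : Type*} [DecidableEq ι]
    {x : ι → Fin (n + 1) → Ω} {g : MvPolynomial (Fin (n + 1)) E} :
    g ≠ 0 → ∀ (t : Finset ι) (b : Ω), (∀ i ∈ t, x i ≠ 0) →
      map (algebraMap E Ω) g = C b * ∏ i ∈ t, linForm (x i) →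
      b ^ d * ∏ i ∈ t, eval₂ (algebraMap E Ω) (x i) f ∈ (algebraMap E Ω).range := by
  induction g using WfDvdMonoid.induction_on_irreducible with
  | zero => exact fun h => absurd rfl h
  | unit u hu =>
    intro _ t b hx h
    have ht : t = ∅ := by
      by_contra hne
      obtain ⟨i, hi⟩ := Finset.nonempty_iff_ne_empty.2 hne
      refine (linForm_prime (hx i hi)).not_isUnit (isUnit_of_dvd_unit ?_ (hu.map (map (algebraMap E Ω))))
      rw [h]
      exact Dvd.dvd.mul_left (Finset.dvd_prod_of_mem (fun i => linForm (x i)) hi) _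
    subst ht
    simp only [Finset.prod_empty, mul_one] at h ⊢
    refine pow_mem (show b ∈ (algebraMap E Ω).range from ⟨coeff 0 u, ?_⟩) d
    rw [← coeff_map, h, coeff_C, if_pos rfl]
  | mul a i ha hi ih =>
    intro _ s y hx h
    rw [map_mul] at h
    obtain ⟨t, u, b, c, hs, htu, hbc, h1, h2⟩ :=
      mul_eq_mul_prime_prod (fun j hj => linForm_prime (hx j hj)) h
    have hinj : Function.Injective (map (algebraMap E Ω) :
        MvPolynomial (Fin (n + 1)) E →+* MvPolynomial (Fin (n + 1)) Ω) :=
      map_injective _ (algebraMap E Ω).injective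
    have hy : IsUnit (C y : MvPolynomial (Fin (n + 1)) Ω) := by
      refine (isUnit_iff_ne_zero.2 fun hy => ?_).map C
      rw [hy, C_0, zero_mul, ← map_mul] at h
      exact mul_ne_zero hi.ne_zero ha (hinj (by rw [h, map_zero]))
    rw [hbc, IsUnit.mul_iff, isUnit_iff_eq_C_of_isReduced, isUnit_iff_eq_C_of_isReduced] at hy
    obtain ⟨⟨b', -, rfl⟩, ⟨c', -, rfl⟩⟩ := hy
    rw [← C_mul] at hbc
    rw [C_injective _ _ hbc, ← hs, Finset.prod_union htu]
    have ht : ∀ j ∈ t, x j ≠ 0 := fun j hj => hx j (hs ▸ Finset.mem_union_left _ hj)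
    have hu : ∀ j ∈ u, x j ≠ 0 := fun j hj => hx j (hs ▸ Finset.mem_union_right _ hj)
    have e1 := irreducible_splitting_value_mem hf ht hi h1
    have e2 := ih ha u c' hu h2
    have := mul_mem e1 e2
    rwa [mul_mul_mul_comm, ← mul_pow] at this

end PurelyInseparable

/-! ### Existence of wedges over integrally closed domains -/

section Existence

variable {n : ℕ}

/-- Over a field, the wedge lies in the field itself. -/
lemma splitting_value_mem_field {F Ω : Type*} [Field F] [Field Ω] [Algebra F Ω] [IsAlgClosure F Ω]
    {d D : ℕ} {f g : MvPolynomial (Fin (n + 1)) F} (hf : f.IsHomogeneous d) (hg : g ≠ 0) {y : Ω}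
    {x : Fin D → Fin (n + 1) → Ω} (h : map (algebraMap F Ω) g = C y * ∏ i, linForm (x i)) :
    y ^ d * ∏ i, eval₂ (algebraMap F Ω) (x i) f ∈ (algebraMap F Ω).range := by
  have hn : Normal F Ω := IsAlgClosure.normal F Ω
  have h0 : C y * ∏ i, linForm (x i) ≠ 0 := by
    rw [← h]
    exact fun h0 => hg (map_injective _ (algebraMap F Ω).injective (by rw [h0, map_zero]))
  have hx : ∀ i, x i ≠ 0 := fun i hi => h0 <| by
    rw [Finset.prod_eq_zero (Finset.mem_univ i) (by rw [hi, linForm_zero]), mul_zero]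
  set v := y ^ d * ∏ i, eval₂ (algebraMap F Ω) (x i) f with hv
  -- The extension `Ω / E` is purely inseparable and `E / F` is Galois, so `v` lies in `E` and only
  -- Galois invariance is left.
  let E := separableClosure F Ω
  have hvE : v ∈ (algebraMap E Ω).range := by
    have hcomp : algebraMap F Ω = (algebraMap E Ω).comp (algebraMap F E) :=
      IsScalarTower.algebraMap_eq F E Ω
    have hgE : map (algebraMap F E) g ≠ 0 := fun h0 =>
      hg (map_injective _ (algebraMap F E).injective (by rw [h0, map_zero]))
    have := splitting_value_mem_of_isPurelyInseparable (E := E) (Ω := Ω) (x := x)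
      (hf.map (algebraMap F E)) hgE Finset.univ y (fun i _ => hx i)
      (by rw [map_map, ← hcomp, h])
    simpa only [eval₂_map, ← hcomp] using this
  -- An automorphism carries a splitting of `g` to another splitting of `g`, which has the same
  -- value.
  have hfix : ∀ σ : Ω ≃ₐ[F] Ω, σ v = v := by
    intro σ
    have hσ : (σ : Ω →+* Ω).comp (algebraMap F Ω) = algebraMap F Ω := by ext a; simp
    have key : C y * ∏ i, linForm (x i) = C (σ y) * ∏ i, linForm (fun s => σ (x i s)) := by
      rw [← h]
      have := congr_arg (map (σ : Ω →+* Ω)) h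
      rw [map_map, hσ] at this
      rw [this]
      simp
    conv_rhs => rw [hv, splitting_value_unique hf key]
    rw [hv, map_mul, map_pow, map_prod]
    congr 1
    refine Finset.prod_congr rfl fun i _ => ?_
    have := eval₂_comp_left (σ : Ω →+* Ω) (algebraMap F Ω) (x i) f
    rw [hσ] at this
    exact this
  obtain ⟨e, he⟩ := hvE
  have hE : e ∈ Set.range (algebraMap F E) := by
    rw [InfiniteGalois.mem_range_algebraMap_iff_fixed]
    intro τ
    apply (algebraMap E Ω).injective
    rw [← AlgEquiv.liftNormal_commutes τ Ω e, he, hfix]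
  obtain ⟨a, rfl⟩ := hE
  exact ⟨a, he⟩

/-- Over an integrally closed domain, the wedge exists as soon as the form splits. -/
theorem HasWedge.exists_of_isIntegrallyClosed {A : Type*} [CommRing A] [IsDomain A]
    [IsIntegrallyClosed A] {d D : ℕ} {f g : MvPolynomial (Fin (n + 1)) A} (hf : f.IsHomogeneous d)
    (h : HasWedge (algebraMap A (FracClosure A)) 0 D 1 g 1) :
    ∃ a, IsWedge d D f g a := by
  by_cases hg : g = 0
  · subst hg
    exact ⟨_, hasWedge_zero _ D hf⟩
  -- With `d = 0` and `f = 1` the equation for the value is trivial, so the hypothesis says only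
  -- that `g` splits.
  obtain ⟨y, x, h1, -⟩ := h
  let F := FractionRing A
  let Ω := FracClosure A
  have hcomp : algebraMap A Ω = (algebraMap F Ω).comp (algebraMap A F) :=
    IsScalarTower.algebraMap_eq A F Ω
  have hgF : map (algebraMap A F) g ≠ 0 := fun h0 =>
    hg (map_injective _ (IsFractionRing.injective A F) (by rw [h0, map_zero]))
  obtain ⟨v, hv⟩ := splitting_value_mem_field (Ω := Ω) (hf.map (algebraMap A F)) hgF
    (by rw [map_map, ← hcomp]; exact h1)
  simp only [eval₂_map, ← hcomp] at hv
  have hint : IsIntegral A v := by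
    rw [← isIntegral_algebraMap_iff (algebraMap F Ω).injective (R := A)]
    -- If `v` were not integral, some valuation ring of `Ω` containing the integral closure of `A`
    -- would miss it. But the value lies in every valuation ring over which `g` is defined.
    by_contra hnot
    let R : Subring Ω := (integralClosure A Ω).toSubring
    have : IsIntegrallyClosedIn R Ω :=
      inferInstanceAs (IsIntegrallyClosedIn (integralClosure A Ω) Ω)
    obtain ⟨V, hRV, hvV⟩ := Subring.exists_le_valuationSubring_of_isIntegrallyClosedIn
      (R := R) (x := algebraMap F Ω v) hnot
    let φ : A →+* V := (algebraMap A Ω).codRestrict V.toSubring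
      fun a => hRV ((integralClosure A Ω).algebraMap_mem a)
    have hφ : V.subtype.comp φ = algebraMap A Ω := rfl
    have hgV : map φ g ≠ 0 := fun h0 => hgF <| by
      refine map_injective _ (algebraMap F Ω).injective ?_
      rw [map_map, ← hcomp, ← hφ, ← map_map, h0, map_zero, map_zero]
    obtain ⟨y', x', -, h'⟩ := HasWedge.of_valuationSubring hf hgV (by rw [hφ]; exact h1)
    refine hvV ?_
    rw [hv]
    rw [hφ] at h'
    rw [h']
    exact (y' ^ d * ∏ i, eval₂ φ (x' i) f).2
  obtain ⟨a, rfl⟩ := IsIntegrallyClosed.isIntegral_iff.1 hint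
  exact ⟨a, y, x, h1, by rw [hcomp, RingHom.comp_apply, hv]; rfl⟩

/-- A form splits generically if it splits at sufficiently many specializations. -/
theorem HasWedge.of_specializations {A K : Type*} [CommRing A] [IsDomain A] [Field K] {D : ℕ}
    {g : MvPolynomial (Fin (n + 1)) A}
    (h : ∀ s : A, s ≠ 0 → ∃ χ : A →+* K, χ s ≠ 0 ∧ HasWedge χ 0 D 1 g 1) :
    HasWedge (algebraMap A (FracClosure A)) 0 D 1 g 1 := by
  let I := wedgeIdeal (RingHom.id A) 0 D 1 g 1
  -- The ideal of the splitting equations contains no nonzero constant `s`: a split specialization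
  -- at which `s` survives gives a point of the ideal.
  have hI : ∀ s : A, s ≠ 0 → C s ∉ I := by
    intro s hs hsI
    obtain ⟨χ, hχ, hW⟩ := h s hs
    obtain ⟨v, hv⟩ := (hasWedge_iff_exists_ker (RingHom.id A) χ).1 hW
    have := hv hsI
    rw [RingHom.mem_ker, coe_eval₂Hom, eval₂_C] at this
    exact hχ this
  have hdisj : Disjoint (I : Set (MvPolynomial (Option (Fin D × Fin (n + 1))) A))
      ((nonZeroDivisors A).map (C : A →+* MvPolynomial (Option (Fin D × Fin (n + 1))) A)) := by
    rw [Set.disjoint_left]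
    rintro _ hx ⟨s, hs, rfl⟩
    exact hI s (nonZeroDivisors.ne_zero hs) hx
  -- The quotient by `q` is a domain that contains `A` and over which `g` splits; specialization
  -- from its fraction field brings the splitting back to the closure of `Frac A`.
  obtain ⟨q, hq, hIq, hqdisj⟩ := Ideal.exists_le_prime_disjoint I _ hdisj
  let B := MvPolynomial (Option (Fin D × Fin (n + 1))) A ⧸ q
  let β : A →+* B := (Ideal.Quotient.mk q).comp C
  have hβ : Function.Injective β := by
    rw [injective_iff_map_eq_zero]
    intro s hs
    by_contra hs0
    exact Set.disjoint_left.1 hqdisj (Ideal.Quotient.eq_zero_iff_mem.1 hs)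
      ⟨s, mem_nonZeroDivisors_of_ne_zero hs0, rfl⟩
  have hW : HasWedge (β.comp (RingHom.id A)) 0 D 1 g 1 := by
    refine (hasWedge_iff_exists_ker _ _).2 ⟨fun o => Ideal.Quotient.mk q (X o), hIq.trans ?_⟩
    have : eval₂Hom β (fun o => Ideal.Quotient.mk q (X o)) = Ideal.Quotient.mk q := by
      ext <;> simp [β]
    rw [this, Ideal.mk_ker]
  have hinj : Function.Injective ((algebraMap B (FractionRing B)).comp (β.comp (RingHom.id A))) :=
    (IsFractionRing.injective B (FractionRing B)).comp hβ
  exact (hW.comp (algebraMap B (FractionRing B))).specialize hinj _ (isHomogeneous_one _ _)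

end Existence

/-! ### Polynomials over infinite and algebraically closed fields -/

lemma exists_eval_ne_zero {σ K : Type*} [Field K] [Infinite K] {p : MvPolynomial σ K}
    (hp : p ≠ 0) : ∃ v, eval v p ≠ 0 := by
  by_contra! h
  exact hp (MvPolynomial.funext fun v => by rw [h, map_zero])

lemma nat_eq_of_forall_pow_eq {K : Type*} [Field K] [Infinite K] {a b : ℕ}
    (h : ∀ s : K, s ^ a = s ^ b) : a = b := by
  have : (Polynomial.X : Polynomial K) ^ a = Polynomial.X ^ b :=
    Polynomial.funext fun s => by simpa using h s
  simpa using congr_arg Polynomial.natDegree this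

lemma polynomial_eq_C_mul_X_pow {K : Type*} [Field K] [IsAlgClosed K] {p : Polynomial K}
    (h : ∀ s, p.eval s = 0 → s = 0) (hp : p ≠ 0) :
    p = Polynomial.C p.leadingCoeff * Polynomial.X ^ p.natDegree := by
  have hr : p.roots = Multiset.replicate p.natDegree 0 := by
    rw [Multiset.eq_replicate]
    refine ⟨IsAlgClosed.card_roots_eq_natDegree, fun s hs => h s ?_⟩
    exact (Polynomial.mem_roots hp).1 hs
  have := (IsAlgClosed.splits p).eq_prod_roots
  rw [hr] at this
  simpa using this

/-! ### From an invariant zero set to determinant equivariance -/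

section Invariance

variable {K : Type*} [Field K] {k n : ℕ}

/-- The value of `c` at a family of linear forms. -/
def evalRows (c : DualPoly K k n) (mu : Matrix (Fin k) (Fin (n + 1)) K) : K :=
  eval (fun p => mu p.1 p.2) c

lemma transvection_mul_eq_update {i j : Fin k} (t : K) (mu : Matrix (Fin k) (Fin (n + 1)) K) :
    Matrix.transvection i j t * mu = mu.updateRow i (mu i + t • mu j) := by
  ext a b
  by_cases h : a = i
  · subst h; simp
  · simp [h]

lemma diagonal_mul_eq_update (i : Fin k) (t : K) (mu : Matrix (Fin k) (Fin (n + 1)) K) :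
    Matrix.diagonal (Function.update 1 i t) * mu = mu.updateRow i (t • mu i) := by
  ext a b
  by_cases h : a = i
  · subst h; simp [Matrix.diagonal_mul]
  · simp [Matrix.diagonal_mul, h]

/-- The degree of a monomial in the `i`-th group of indeterminates. -/
abbrev rowDegree (i : Fin k) (a : Fin k × Fin (n + 1) →₀ ℕ) : ℕ := ∑ s, a (i, s)

lemma evalRows_update_smul {i : Fin k} {m : ℕ} {c : DualPoly K k n}
    (h : ∀ a ∈ c.support, rowDegree i a = m) (t : K) (mu : Matrix (Fin k) (Fin (n + 1)) K) :
    evalRows c (mu.updateRow i (t • mu i)) = t ^ m * evalRows c mu := by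
  simp only [evalRows, eval_eq', Finset.mul_sum]
  refine Finset.sum_congr rfl fun a ha => ?_
  have : ∀ p : Fin k × Fin (n + 1), (mu.updateRow i (t • mu i)) p.1 p.2 ^ a p =
      (if p.1 = i then t ^ a p else 1) * mu p.1 p.2 ^ a p := by
    rintro ⟨b, s⟩
    by_cases hb : b = i
    · subst hb; simp [mul_pow]
    · simp [hb]
  simp only [this, Finset.prod_mul_distrib]
  rw [← h a ha, Fintype.prod_prod_type, Finset.prod_eq_single i]
  · simp [Finset.prod_pow_eq_pow_sum]; ring
  · intro b _ hb; simp [hb]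
  · simp

lemma evalRows_diagonal {D : ℕ} {c : DualPoly K k n}
    (h : ∀ i, ∀ a ∈ c.support, rowDegree i a = D) (t : Fin k → K)
    (mu : Matrix (Fin k) (Fin (n + 1)) K) :
    evalRows c (Matrix.diagonal t * mu) = (∏ i, t i) ^ D * evalRows c mu := by
  simp only [evalRows, eval_eq', Finset.mul_sum]
  refine Finset.sum_congr rfl fun a ha => ?_
  simp only [Matrix.diagonal_mul, mul_pow, Finset.prod_mul_distrib]
  have : ∏ p : Fin k × Fin (n + 1), t p.1 ^ a p = (∏ i, t i) ^ D := by
    rw [Fintype.prod_prod_type, ← Finset.prod_pow]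
    refine Finset.prod_congr rfl fun i _ => ?_
    rw [← h i a ha]
    exact Finset.prod_pow_eq_pow_sum Finset.univ (fun y => a (i, y)) (t i)
  rw [this]; ring

/-- The vanishing of `c` is invariant under row operations. -/
def ZeroInvariant (c : DualPoly K k n) : Prop :=
  ∀ (g : Matrix (Fin k) (Fin k) K), g.det ≠ 0 → ∀ mu, evalRows c mu = 0 → evalRows c (g * mu) = 0

lemma ZeroInvariant.iff {c : DualPoly K k n} (h : ZeroInvariant c) {g : Matrix (Fin k) (Fin k) K}
    (hg : g.det ≠ 0) (mu) : evalRows c (g * mu) = 0 ↔ evalRows c mu = 0 := by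
  refine ⟨fun h0 => ?_, h g hg mu⟩
  have hu : IsUnit g.det := isUnit_iff_ne_zero.2 hg
  have := h g⁻¹ (by rw [Matrix.det_nonsing_inv]; simpa using hg) _ h0
  rwa [← Matrix.mul_assoc, Matrix.nonsing_inv_mul _ hu, Matrix.one_mul] at this

/-- Equivariance of degree `D` under the general linear group. -/
def DetEquivariant (D : ℕ) (c : DualPoly K k n) : Prop :=
  ∀ (g : Matrix (Fin k) (Fin k) K) (mu : Matrix (Fin k) (Fin (n + 1)) K),
    evalRows c (g * mu) = g.det ^ D * evalRows c mu

/-- If the value at `mu` is nonzero, it stays nonzero along the whole line in `t`. A polynomial in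
`t` without roots is constant over an algebraically closed field. -/
lemma ZeroInvariant.transvection [IsAlgClosed K] {c : DualPoly K k n} (h : ZeroInvariant c)
    {i j : Fin k} (hij : i ≠ j) (t : K) (mu : Matrix (Fin k) (Fin (n + 1)) K) :
    evalRows c (Matrix.transvection i j t * mu) = evalRows c mu := by
  have hdet : ∀ s : K, (Matrix.transvection i j s).det ≠ 0 := fun s => by
    rw [Matrix.det_transvection_of_ne _ _ hij]; exact one_ne_zero
  by_cases h0 : evalRows c mu = 0
  · rw [h0, (h.iff (hdet t) mu).2 h0]
  let P : Polynomial K := aeval (fun p : Fin k × Fin (n + 1) =>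
    Polynomial.C (mu p.1 p.2) + if p.1 = i then Polynomial.X * Polynomial.C (mu j p.2) else 0) c
  have hP : ∀ s, P.eval s = evalRows c (Matrix.transvection i j s * mu) := by
    intro s
    change Polynomial.evalRingHom s (aeval _ c) = eval _ c
    rw [aeval_def, ← coe_eval₂Hom, ← RingHom.comp_apply, ← eval₂_id, ← coe_eval₂Hom]
    congr 1
    ext p
    · simp
    · rcases p with ⟨a, b⟩
      by_cases ha : a = i
      · subst ha; simp; ring
      · simp [ha]
  have hroot : ∀ s, P.eval s ≠ 0 := fun s => by
    rw [hP, Ne, h.iff (hdet s) mu]; exact h0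
  have hdeg : P.degree = 0 := by
    by_contra hd
    obtain ⟨s, hs⟩ := IsAlgClosed.exists_root P hd
    exact hroot s hs
  have hconst := Polynomial.eq_C_of_degree_eq_zero hdeg
  have := hP 0
  rw [Matrix.transvection_zero, Matrix.one_mul] at this
  rw [← hP, ← this, hconst]
  simp

/-- Scaling row `i` by `s` gives a polynomial in `s` whose only possible root is `0`, hence a
monomial. At a point where the components of both degrees are nonzero, these degrees must coincide.
-/
lemma ZeroInvariant.exists_rowDegree [IsAlgClosed K] {c : DualPoly K k n} (h : ZeroInvariant c)
    (hc : c ≠ 0) (i : Fin k) : ∀ a ∈ c.support, ∀ b ∈ c.support, rowDegree i a = rowDegree i b := by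
  classical
  intro a ha b hb
  let comp : ℕ → DualPoly K k n := fun m =>
    ∑ a ∈ c.support with rowDegree i a = m, monomial a (coeff a c)
  have hcomp : ∀ a ∈ c.support, comp (rowDegree i a) ≠ 0 := by
    intro a ha h0
    have := congr_arg (coeff a) h0
    simp only [comp, coeff_sum, coeff_monomial, coeff_zero, Finset.sum_ite_eq',
      Finset.mem_filter, ha, and_self, if_true] at this
    exact (mem_support_iff.1 ha) this
  obtain ⟨v, hv⟩ := exists_eval_ne_zero
    (mul_ne_zero (mul_ne_zero (hcomp a ha) (hcomp b hb)) hc)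
  simp only [map_mul, mul_ne_zero_iff] at hv
  let mu : Matrix (Fin k) (Fin (n + 1)) K := Matrix.of fun i s => v (i, s)
  let P : Polynomial K := ∑ a ∈ c.support,
    Polynomial.C (coeff a c * ∏ p, v p ^ a p) * Polynomial.X ^ rowDegree i a
  have hP : ∀ s, P.eval s = evalRows c (mu.updateRow i (s • mu i)) := by
    intro s
    simp only [evalRows, P, eval_eq', Polynomial.eval_finsetSum]
    refine Finset.sum_congr rfl fun a ha => ?_
    have : ∀ p : Fin k × Fin (n + 1), (mu.updateRow i (s • mu i)) p.1 p.2 ^ a p =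
        (if p.1 = i then s ^ a p else 1) * v p ^ a p := by
      rintro ⟨b, t⟩
      by_cases hb : b = i
      · subst hb; simp [mul_pow, mu]
      · simp [hb, mu]
    simp only [this, Finset.prod_mul_distrib]
    have h2 : ∏ p : Fin k × Fin (n + 1), (if p.1 = i then s ^ a p else 1) = s ^ rowDegree i a := by
      rw [Fintype.prod_prod_type, Finset.prod_eq_single i]
      · simp [Finset.prod_pow_eq_pow_sum]
      · intro b _ hb; simp [hb]
      · simp
    rw [h2]
    simp [Polynomial.eval_prod]
    ring
  have hcoeff : ∀ m, P.coeff m = eval v (comp m) := by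
    intro m
    simp only [P, comp, Polynomial.finsetSum_coeff, Polynomial.coeff_C_mul_X_pow, map_sum,
      Finset.sum_filter, eq_comm (a := m)]
    refine Finset.sum_congr rfl fun a _ => ?_
    split_ifs <;> simp [eval_monomial, Finsupp.prod_pow]
  have hroot : ∀ s, P.eval s = 0 → s = 0 := by
    intro s hs
    by_contra hs0
    rw [hP, ← diagonal_mul_eq_update, h.iff] at hs
    · exact hv.2 hs
    · rw [Matrix.det_diagonal, Finset.prod_update_of_mem (Finset.mem_univ i)]
      simpa using hs0
  have hPa : P.coeff (rowDegree i a) ≠ 0 := by rw [hcoeff]; exact hv.1.1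
  have hPb : P.coeff (rowDegree i b) ≠ 0 := by rw [hcoeff]; exact hv.1.2
  have hP0 : P ≠ 0 := fun h0 => hPa (by rw [h0, Polynomial.coeff_zero])
  rw [polynomial_eq_C_mul_X_pow hroot hP0, Polynomial.coeff_C_mul_X_pow] at hPa hPb
  simp only [ne_eq, ite_eq_right_iff, not_forall] at hPa hPb
  rw [hPa.1, hPb.1]

/-- Three transvections turn the rows `(s μ_i, μ_j)` into `(μ_j, -s μ_i)`. So a scalar in row `i`
has the same effect as the scalar in row `j`, up to a factor independent of `s`, which is removed by
comparison with `s = 1`. -/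
lemma ZeroInvariant.rowDegree_eq [IsAlgClosed K] {c : DualPoly K k n} (h : ZeroInvariant c)
    (hc : c ≠ 0) (i j : Fin k) : ∀ a ∈ c.support, rowDegree i a = rowDegree j a := by
  intro a ha
  rcases eq_or_ne i j with rfl | hij
  · rfl
  obtain ⟨v, hv⟩ := exists_eval_ne_zero hc
  let mu : Matrix (Fin k) (Fin (n + 1)) K := Matrix.of fun i s => v (i, s)
  have hmu : evalRows c mu ≠ 0 := hv
  have hi := evalRows_update_smul (c := c) (i := i) (m := rowDegree i a)
    (fun b hb => h.exists_rowDegree hc i b hb a ha)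
  have hj := evalRows_update_smul (c := c) (i := j) (m := rowDegree j a)
    (fun b hb => h.exists_rowDegree hc j b hb a ha)
  have htr : ∀ {i j : Fin k}, i ≠ j → ∀ (t : K) (mu : Matrix (Fin k) (Fin (n + 1)) K),
      evalRows c (mu.updateRow i (mu i + t • mu j)) = evalRows c mu := by
    intro i j hij t mu
    rw [← transvection_mul_eq_update, h.transvection hij]
  let M : (Fin (n + 1) → K) → (Fin (n + 1) → K) → Matrix (Fin k) (Fin (n + 1)) K :=
    fun a b => (mu.updateRow i a).updateRow j b
  have hMi : ∀ a b, M a b i = a := fun a b => by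
    ext s; simp only [M, Matrix.updateRow_ne hij, Matrix.updateRow_self]
  have hMj : ∀ a b, M a b j = b := fun a b => by
    ext s; simp only [M, Matrix.updateRow_self]
  have hui : ∀ a b a', (M a b).updateRow i a' = M a' b := fun a b a' => by
    ext l s
    simp only [M, Matrix.updateRow_apply]
    split_ifs <;> simp_all
  have huj : ∀ a b b', (M a b).updateRow j b' = M a b' := fun a b b' => by
    ext l s
    simp only [M, Matrix.updateRow_apply]
    split_ifs <;> simp_all
  have hM0 : M (mu i) (mu j) = mu := by
    ext l s
    simp only [M, Matrix.updateRow_apply]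
    split_ifs <;> simp_all
  have key : ∀ s : K, s ^ rowDegree i a * evalRows c mu =
      (-s) ^ rowDegree j a * evalRows c (M (mu j) (mu i)) := by
    intro s
    have e1 := hi s (M (mu i) (mu j))
    rw [hMi, hui, hM0] at e1
    have e2 := htr hij 1 (M (s • mu i) (mu j))
    rw [hMi, hMj, hui, one_smul] at e2
    have e3 := htr hij.symm (-1) (M (s • mu i + mu j) (mu j))
    rw [hMi, hMj, huj] at e3
    have e4 := htr hij 1 (M (s • mu i + mu j) (mu j + (-1 : K) • (s • mu i + mu j)))
    rw [hMi, hMj, hui, one_smul] at e4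
    have e5 := hj (-s) (M (mu j) (mu i))
    rw [hMj, huj] at e5
    have h1 : s • mu i + mu j + (mu j + (-1 : K) • (s • mu i + mu j)) = mu j := by
      module
    have h2 : mu j + (-1 : K) • (s • mu i + mu j) = (-s) • mu i := by module
    rw [h1, h2] at e4
    rw [h2] at e3
    rw [← e1, ← e2, ← e3, ← e4, e5]
  apply nat_eq_of_forall_pow_eq (K := K)
  intro s
  have k1 := key 1
  have k2 := key s
  rw [one_pow, one_mul] at k1
  rw [neg_pow s, mul_right_comm, ← k1, mul_comm] at k2
  exact mul_left_cancel₀ hmu k2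

/-- A polynomial whose zero set is invariant under invertible row operations is multiplied by a power
of the determinant under row operations. -/
theorem ZeroInvariant.detEquivariant [IsAlgClosed K] {c : DualPoly K k n} (h : ZeroInvariant c)
    (hc : c ≠ 0) (i : Fin k) :
    (∀ j, ∀ a ∈ c.support, rowDegree j a = groupDegree i c) ∧
      DetEquivariant (groupDegree i c) c := by
  have hdeg : ∀ j, ∀ a ∈ c.support, rowDegree j a = groupDegree i c := by
    intro j a ha
    rw [h.rowDegree_eq hc j i a ha]
    refine le_antisymm (Finset.le_sup (f := fun a => ∑ s, a (i, s)) ha) (Finset.sup_le ?_)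
    intro b hb
    exact (h.exists_rowDegree hc i b hb a ha).le
  refine ⟨hdeg, fun g => ?_⟩
  refine Matrix.diagonal_transvection_induction
    (fun g => ∀ mu : Matrix (Fin k) (Fin (n + 1)) K,
      evalRows c (g * mu) = g.det ^ groupDegree i c * evalRows c mu) g ?_ ?_ ?_
  -- Diagonal matrices may be singular here, and zero invariance says nothing about those; the
  -- common row degree handles them.
  · intro t _ mu
    rw [evalRows_diagonal hdeg, Matrix.det_diagonal]
  · intro t mu
    rw [Matrix.TransvectionStruct.toMatrix, h.transvection t.hij, Matrix.det_transvection_of_ne _ _ t.hij, one_pow, one_mul]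
  · intro a b ha hb mu
    rw [Matrix.mul_assoc, ha, hb, Matrix.det_mul, mul_pow, mul_assoc]

lemma map_aeval_rows {S T : Type*} [CommRing S] [Algebra K S] [CommRing T] [Algebra K T]
    (θ : S →ₐ[K] T) (c : DualPoly K k n) (mu : Matrix (Fin k) (Fin (n + 1)) S) :
    θ (aeval (fun p : Fin k × Fin (n + 1) => mu p.1 p.2) c) =
      aeval (fun p : Fin k × Fin (n + 1) => (mu.map θ) p.1 p.2) c := by
  rw [← AlgHom.comp_apply, comp_aeval]
  rfl

/-- Over an infinite field the identity of values is an identity of polynomials in indeterminate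
matrices, and so it specializes to any `K`-algebra. -/
theorem DetEquivariant.aeval_mul [Infinite K] {D : ℕ} {c : DualPoly K k n} (h : DetEquivariant D c)
    {S : Type*} [CommRing S] [Algebra K S] (g : Matrix (Fin k) (Fin k) S)
    (mu : Matrix (Fin k) (Fin (n + 1)) S) :
    MvPolynomial.aeval (fun p : Fin k × Fin (n + 1) => (g * mu) p.1 p.2) c =
      g.det ^ D * MvPolynomial.aeval (fun p : Fin k × Fin (n + 1) => mu p.1 p.2) c := by
  let U := MvPolynomial ((Fin k × Fin k) ⊕ (Fin k × Fin (n + 1))) K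
  let G : Matrix (Fin k) (Fin k) U := Matrix.of fun i j => X (.inl (i, j))
  let M : Matrix (Fin k) (Fin (n + 1)) U := Matrix.of fun i j => X (.inr (i, j))
  have key : aeval (fun p : Fin k × Fin (n + 1) => (G * M) p.1 p.2) c =
      G.det ^ D * aeval (fun p : Fin k × Fin (n + 1) => M p.1 p.2) c := by
    refine MvPolynomial.funext fun v => ?_
    have := h (G.map (aeval v)) (M.map (aeval v))
    rw [← coe_aeval_eq_eval, map_mul, map_pow, RingHom.coe_coe, map_aeval_rows, map_aeval_rows,
      AlgHom.map_det, Matrix.map_mul]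
    exact this
  have := congr_arg (aeval (Sum.elim (fun p : Fin k × Fin k => g p.1 p.2)
    (fun p : Fin k × Fin (n + 1) => mu p.1 p.2))) key
  have hG : G.map (aeval (R := K) (Sum.elim (fun p : Fin k × Fin k => g p.1 p.2)
      (fun p : Fin k × Fin (n + 1) => mu p.1 p.2))) = g := by
    ext; simp [G]
  have hM : M.map (aeval (R := K) (Sum.elim (fun p : Fin k × Fin k => g p.1 p.2)
      (fun p : Fin k × Fin (n + 1) => mu p.1 p.2))) = mu := by
    ext; simp [M]
  rwa [map_mul, map_pow, map_aeval_rows, map_aeval_rows, AlgHom.map_det, Matrix.map_mul, hM,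
    AlgHom.mapMatrix_apply, hG] at this

end Invariance

/-! ### Separating the last group of indeterminates -/

section Rows

variable {A B R : Type*} [CommRing A] [CommRing B] {k m n : ℕ}

/-- Append a row to a matrix. -/
def snocRow (mu : Matrix (Fin k) (Fin m) R) (xi : Fin m → R) : Matrix (Fin (k + 1)) (Fin m) R :=
  Matrix.of (Fin.snoc (α := fun _ => Fin m → R) mu xi)

@[simp] lemma snocRow_castSucc (mu : Matrix (Fin k) (Fin m) R) (xi : Fin m → R) (i : Fin k) :
    snocRow mu xi i.castSucc = mu i := by
  exact Fin.snoc_castSucc (α := fun _ => Fin m → R) _ _ i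

@[simp] lemma snocRow_last (mu : Matrix (Fin k) (Fin m) R) (xi : Fin m → R) :
    snocRow mu xi (Fin.last k) = xi := by
  exact Fin.snoc_last (α := fun _ => Fin m → R) _ _

/-- Evaluation of a polynomial in `k` groups of indeterminates at the rows of a matrix. -/
def rowHom (φ : A →+* B) (mu : Matrix (Fin k) (Fin (n + 1)) B) : DualPoly A k n →+* B :=
  eval₂Hom φ (fun p => mu p.1 p.2)

@[simp] lemma rowHom_C (φ : A →+* B) (mu : Matrix (Fin k) (Fin (n + 1)) B) (a : A) :
    rowHom φ mu (C a) = φ a := eval₂Hom_C _ _ _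

@[simp] lemma rowHom_X (φ : A →+* B) (mu : Matrix (Fin k) (Fin (n + 1)) B) (p) :
    rowHom φ mu (X p) = mu p.1 p.2 := eval₂Hom_X' _ _ _

lemma rowHom_comp_C (φ : A →+* B) (mu : Matrix (Fin k) (Fin (n + 1)) B) :
    (rowHom φ mu).comp C = φ := by ext; simp

@[simp] lemma lastGroup_C (a : A) : lastGroup (C a : DualPoly A (k + 1) n) = C (C a) := by
  simp [lastGroup, algebraMap_eq]

@[simp] lemma lastGroup_X_castSucc (i : Fin k) (s : Fin (n + 1)) :
    lastGroup (X (i.castSucc, s) : DualPoly A (k + 1) n) = C (X (i, s)) := by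
  simp [lastGroup]

@[simp] lemma lastGroup_X_last (s : Fin (n + 1)) :
    lastGroup (X (Fin.last k, s) : DualPoly A (k + 1) n) = X s := by
  simp [lastGroup]

/-- `lastGroup` as a ring homomorphism. -/
def lastGroupHom (A : Type*) [CommRing A] (k n : ℕ) :
    DualPoly A (k + 1) n →+* MvPolynomial (Fin (n + 1)) (DualPoly A k n) :=
  (aeval (fun p : Fin (k + 1) × Fin (n + 1) =>
    Fin.lastCases (motive := fun _ => MvPolynomial (Fin (n + 1)) (DualPoly A k n))
      (X p.2) (fun i => C (X (i, p.2))) p.1)).toRingHom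

lemma lastGroupHom_apply (c : DualPoly A (k + 1) n) : lastGroupHom A k n c = lastGroup c := rfl

lemma dualPoly_hom_ext {S : Type*} [CommRing S] {f g : DualPoly A (k + 1) n →+* S}
    (hC : ∀ a, f (C a) = g (C a)) (hX : ∀ i s, f (X (Fin.castSucc i, s)) = g (X (i.castSucc, s)))
    (hl : ∀ s, f (X (Fin.last k, s)) = g (X (Fin.last k, s))) : f = g := by
  refine MvPolynomial.ringHom_ext hC ?_
  rintro ⟨i, s⟩
  induction i using Fin.lastCases with
  | last => exact hl s
  | cast i => exact hX i s

lemma eval₂_lastGroup (φ : A →+* B) (mu : Matrix (Fin k) (Fin (n + 1)) B) (xi : Fin (n + 1) → B)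
    (c : DualPoly A (k + 1) n) :
    eval₂ (rowHom φ mu) xi (lastGroup c) = rowHom φ (snocRow mu xi) c := by
  have : (eval₂Hom (rowHom φ mu) xi).comp (lastGroupHom A k n) = rowHom φ (snocRow mu xi) := by
    apply dualPoly_hom_ext <;> intros <;> simp [lastGroupHom_apply]
  exact congr_arg (fun f => f c) this

end Rows

/-! ### Polynomials whose factors are linear forms given by points -/

section SplitAlong

variable {K : Type*} [Field K] {n : ℕ}

/-- Nullstellensatz for the principal prime ideal generated by `r`. -/
lemma dvd_of_zero_subset [IsAlgClosed K] {σ : Type*} [Finite σ] {r h : MvPolynomial σ K}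
    (hr : Prime r) (H : ∀ v, eval v r = 0 → eval v h = 0) : r ∣ h := by
  have hp : (Ideal.span {r}).IsPrime := (Ideal.span_singleton_prime hr.ne_zero).2 hr
  have := IsPrime.vanishingIdeal_zeroLocus (K := K) (Ideal.span {r})
  rw [← Ideal.mem_span_singleton, ← this, mem_vanishingIdeal_iff]
  intro v hv
  rw [mem_zeroLocus_iff] at hv
  exact H v (hv r (Ideal.mem_span_singleton_self r))

lemma eval_eq_zero_of_dvd {σ R : Type*} [CommRing R] {p q : MvPolynomial σ R} (h : p ∣ q)
    {v : σ → R} (hv : eval v p = 0) : eval v q = 0 := by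
  obtain ⟨r, rfl⟩ := h
  rw [map_mul, hv, zero_mul]

/-- The set `Z` may be infinite, but each of its linear forms is a factor of `q`, so up to scalars
only finitely many occur. The Nullstellensatz applies to `e` times their product. The extra `e`
allows for an exceptional locus, as needed in `ChowLike.wedge`. -/
lemma dvd_or_associated_of_zero_subset [IsAlgClosed K] {q r e : MvPolynomial (Fin (n + 1)) K}
    (hq : q ≠ 0) {Z : Set (Fin (n + 1) → K)} (hZ0 : ∀ p ∈ Z, p ≠ 0)
    (hZ : ∀ p ∈ Z, linForm p ∣ q) (hr : Irreducible r)
    (h : ∀ v, eval v r = 0 → eval v e = 0 ∨ ∃ p ∈ Z, ∑ s, p s * v s = 0) :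
    r ∣ e ∨ ∃ p ∈ Z, Associated r (linForm p) := by
  classical
  let S := (UniqueFactorizationMonoid.factors q).filter
    fun x => ∃ p ∈ Z, Associated x (linForm p)
  have hdvd : r ∣ e * S.prod := by
    refine dvd_of_zero_subset hr.prime fun v hv => ?_
    rw [map_mul, mul_eq_zero]
    refine (h v hv).imp_right ?_
    rintro ⟨p, hp, hpv⟩
    obtain ⟨x, hx, hpx⟩ := UniqueFactorizationMonoid.exists_mem_factors_of_dvd hq
      (linForm_prime (hZ0 p hp)).irreducible (hZ p hp)
    refine eval_eq_zero_of_dvd (p := linForm p) ?_ (by rw [eval_linForm, hpv])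
    exact hpx.dvd.trans (Multiset.dvd_prod (Multiset.mem_filter.2 ⟨hx, p, hp, hpx.symm⟩))
  refine (hr.prime.dvd_or_dvd hdvd).imp_right fun hS => ?_
  obtain ⟨x, hx, hrx⟩ := hr.prime.exists_mem_multiset_dvd hS
  obtain ⟨hxq, p, hp, hxp⟩ := Multiset.mem_filter.1 hx
  have hx' := UniqueFactorizationMonoid.irreducible_of_factor x hxq
  exact ⟨p, hp, (hr.associated_of_dvd hx' hrx).trans hxp⟩

/-- The irreducible factors of `q` are the linear forms defined by the points of `Z`. -/
def SplitAlong (q : MvPolynomial (Fin (n + 1)) K) (Z : Set (Fin (n + 1) → K)) : Prop :=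
  (∀ r, Irreducible r → r ∣ q → ∃ p ∈ Z, Associated r (linForm p)) ∧ ∀ p ∈ Z, linForm p ∣ q

lemma SplitAlong.of_zeros [IsAlgClosed K] {q : MvPolynomial (Fin (n + 1)) K} (hq : q ≠ 0)
    {Z : Set (Fin (n + 1) → K)} (hZ0 : ∀ p ∈ Z, p ≠ 0)
    (h : ∀ v, eval v q = 0 ↔ ∃ p ∈ Z, ∑ s, p s * v s = 0) : SplitAlong q Z := by
  have hZ : ∀ p ∈ Z, linForm p ∣ q := fun p hp =>
    dvd_of_zero_subset (linForm_prime (hZ0 p hp)) fun v hv =>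
      (h v).2 ⟨p, hp, by rwa [eval_linForm] at hv⟩
  refine ⟨fun r hr hrq => ?_, hZ⟩
  refine (dvd_or_associated_of_zero_subset (e := 1) hq hZ0 hZ hr fun v hv =>
    Or.inr ((h v).1 (eval_eq_zero_of_dvd hrq hv))).resolve_left ?_
  exact fun h1 => hr.not_isUnit (isUnit_of_dvd_one h1)

lemma SplitAlong.exists_splitting {q : MvPolynomial (Fin (n + 1)) K} (hq : q ≠ 0)
    {Z : Set (Fin (n + 1) → K)} (h : SplitAlong q Z) {D : ℕ} (hD : q.IsHomogeneous D) :
    ∃ (y : K) (x : Fin D → Fin (n + 1) → K), q = C y * ∏ i, linForm (x i) ∧ ∀ i, x i ∈ Z := by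
  classical
  have hfac : ∀ r ∈ UniqueFactorizationMonoid.factors q, ∃ p ∈ Z, Associated r (linForm p) :=
    fun r hr => h.1 r (UniqueFactorizationMonoid.irreducible_of_factor r hr)
      (UniqueFactorizationMonoid.dvd_of_mem_factors hr)
  have key : ∀ S : Multiset (MvPolynomial (Fin (n + 1)) K),
      (∀ r ∈ S, ∃ p ∈ Z, Associated r (linForm p)) →
      ∃ T : Multiset (Fin (n + 1) → K), (∀ p ∈ T, p ∈ Z) ∧
        Associated S.prod (T.map linForm).prod := by
    intro S
    induction S using Multiset.induction_on with
    | empty => exact fun _ => ⟨0, by simp⟩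
    | cons r S ih =>
      intro hS
      obtain ⟨T, hT, hST⟩ := ih fun r hr => hS r (Multiset.mem_cons_of_mem hr)
      obtain ⟨p, hp, hrp⟩ := hS r (Multiset.mem_cons_self r S)
      refine ⟨p ::ₘ T, ?_, ?_⟩
      · intro p' hp'
        rcases Multiset.mem_cons.1 hp' with rfl | hp'
        · exact hp
        · exact hT p' hp'
      · simpa using hrp.mul_mul hST
  obtain ⟨T, hT, hST⟩ := key _ hfac
  obtain ⟨w, hw⟩ := ((UniqueFactorizationMonoid.factors_prod hq).symm.trans hST).symm
  obtain ⟨y, hy, hyw⟩ := isUnit_iff_eq_C_of_isReduced.1 w.isUnit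
  have hTlist : (T.map linForm).prod = ∏ i : Fin T.toList.length, linForm (T.toList.get i) := by
    conv_lhs => rw [← T.coe_toList]
    rw [Multiset.map_coe, Multiset.prod_coe, ← List.prod_ofFn]
    congr 1
    exact (congr_arg (List.map linForm) (List.ofFn_get T.toList).symm).trans List.map_ofFn
  rw [hyw, hTlist, mul_comm] at hw
  have hhom : q.IsHomogeneous T.toList.length := by
    rw [← hw]
    have := (isHomogeneous_C (Fin (n + 1)) y).mul (prod_linForm_isHomogeneous Finset.univ
      (fun i : Fin T.toList.length => T.toList.get i))
    simpa using this
  obtain rfl := hD.inj_right hhom hq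
  exact ⟨y, fun i => T.toList.get i, hw.symm,
    fun i => hT _ (Multiset.mem_toList.1 (List.get_mem _ i))⟩

/-- Up to a nonzero scalar the wedge is the product of the values of `f` at points of `Z`, and every
point of `Z` occurs among these up to a scalar. -/
lemma SplitAlong.hasWedge_eq_zero_iff {q : MvPolynomial (Fin (n + 1)) K} (hq : q ≠ 0)
    {Z : Set (Fin (n + 1) → K)} (hZ0 : ∀ p ∈ Z, p ≠ 0) (h : SplitAlong q Z) {d D : ℕ}
    {f : MvPolynomial (Fin (n + 1)) K} (hf : f.IsHomogeneous d) {a : K}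
    (ha : HasWedge (RingHom.id K) d D f q a) : a = 0 ↔ ∃ p ∈ Z, eval p f = 0 := by
  obtain ⟨y, x, h1, h2⟩ := ha
  rw [map_id] at h1
  rw [RingHom.id_apply] at h2
  have hx : ∀ i, x i ≠ 0 := fun i hi => hq <| by
    rw [h1, Finset.prod_eq_zero (Finset.mem_univ i) (by rw [hi, linForm_zero]), mul_zero]
  have hy : y ≠ 0 := fun hy => hq (by rw [h1, hy]; simp)
  have hsm : ∀ (u : K) (p : Fin (n + 1) → K), eval p f = 0 → eval (u • p) f = 0 := by
    intro u p hp
    have := hf.eval₂_smul (RingHom.id K) u p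
    rw [eval₂_id, eval₂_id, hp, mul_zero] at this
    exact this
  rw [h2, mul_eq_zero, or_iff_right (pow_ne_zero d hy), Finset.prod_eq_zero_iff]
  simp only [Finset.mem_univ, true_and, eval₂_id]
  constructor
  · rintro ⟨i, hi⟩
    obtain ⟨p, hp, hip⟩ := h.1 _ (linForm_prime (hx i)).irreducible <| by
      rw [h1]
      exact Dvd.dvd.mul_left (Finset.dvd_prod_of_mem (fun i => linForm (x i)) (Finset.mem_univ i)) _
    obtain ⟨u, -, rfl⟩ := linForm_associated hip
    exact ⟨_, hp, hsm u _ hi⟩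
  · rintro ⟨p, hp, hpf⟩
    have hpq := h.2 p hp
    have hpp := linForm_prime (hZ0 p hp)
    rw [h1] at hpq
    rcases hpp.dvd_or_dvd hpq with h3 | h3
    · exact absurd (isUnit_of_dvd_unit h3 ((isUnit_iff_ne_zero.2 hy).map C)) hpp.not_isUnit
    · obtain ⟨i, -, hi⟩ := hpp.exists_mem_finset_dvd h3
      obtain ⟨u, -, hu⟩ := linForm_associated
        (hpp.irreducible.associated_of_dvd (linForm_prime (hx i)).irreducible hi)
      exact ⟨i, by rw [hu]; exact hsm u p hpf⟩

lemma isHomogeneous_of_eval_smul [Infinite K] {q : MvPolynomial (Fin (n + 1)) K} {D : ℕ}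
    (h : ∀ (t : K) v, eval (t • v) q = t ^ D * eval v q) : q.IsHomogeneous D := by
  intro a ha
  change Finsupp.weight (fun _ => 1) a = D
  rw [← Finsupp.degree_eq_weight_one]
  apply nat_eq_of_forall_pow_eq (K := K)
  intro t
  have : ∑ b ∈ q.support, monomial b (t ^ b.degree * coeff b q) = C (t ^ D) * q := by
    refine MvPolynomial.funext fun v => ?_
    rw [map_mul, eval_C, ← h, map_sum, eval_eq']
    refine Finset.sum_congr rfl fun b _ => ?_
    simp only [eval_monomial, Finsupp.prod_pow, Pi.smul_apply, smul_eq_mul, mul_pow,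
      Finset.prod_mul_distrib, Finset.prod_pow_eq_pow_sum, Finsupp.degree_eq_sum]
    ring
  have h2 := congr_arg (coeff a) this
  rw [coeff_sum, coeff_C_mul, Finset.sum_eq_single a, coeff_monomial, if_pos rfl] at h2
  · exact mul_right_cancel₀ ha h2
  · intro b _ hb; rw [coeff_monomial, if_neg hb]
  · intro h; exact absurd (mem_support_iff.2 ha) h

end SplitAlong

/-! ### Chow forms under wedging -/

section ChowLike

variable {K : Type*} [Field K] {k n : ℕ}

/-- The properties of the Chow form, of degree `D` in each group, of a set `Z` of vectors that are
used to form wedges. -/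
structure ChowLike (D : ℕ) (c : DualPoly K k n) (Z : Set (Fin (n + 1) → K)) : Prop where
  det : DetEquivariant D c
  split : ∀ (i : Fin k) (mu : Matrix (Fin k) (Fin (n + 1)) K) (q : MvPolynomial (Fin (n + 1)) K),
    (∀ xi, eval xi q = evalRows c (mu.updateRow i xi)) → q ≠ 0 →
    SplitAlong q {p | p ∈ Z ∧ ∀ j, j ≠ i → ∑ s, p s * mu j s = 0}

/-- The restriction of `c` to given values of all groups but the last. -/
def lastEval (mu : Matrix (Fin k) (Fin (n + 1)) K) (c : DualPoly K (k + 1) n) :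
    MvPolynomial (Fin (n + 1)) K :=
  map (rowHom (RingHom.id K) mu) (lastGroup c)

lemma rowHom_id (mu : Matrix (Fin k) (Fin (n + 1)) K) (c : DualPoly K k n) :
    rowHom (RingHom.id K) mu c = evalRows c mu := rfl

lemma eval_lastEval (mu : Matrix (Fin k) (Fin (n + 1)) K) (c : DualPoly K (k + 1) n)
    (xi : Fin (n + 1) → K) : eval xi (lastEval mu c) = evalRows c (snocRow mu xi) := by
  rw [lastEval, eval_map, eval₂_lastGroup, rowHom_id]

lemma updateRow_snocRow_last {R : Type*} (mu : Matrix (Fin k) (Fin (n + 1)) R)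
    (xi eta : Fin (n + 1) → R) :
    (snocRow mu xi).updateRow (Fin.last k) eta = snocRow mu eta := by
  ext i s
  induction i using Fin.lastCases with
  | last => simp
  | cast i => rw [Matrix.updateRow_ne (Fin.castSucc_lt_last i).ne]; simp

lemma updateRow_snocRow_castSucc {R : Type*} (mu : Matrix (Fin k) (Fin (n + 1)) R)
    (xi eta : Fin (n + 1) → R) (i : Fin k) :
    (snocRow mu xi).updateRow i.castSucc eta = snocRow (mu.updateRow i eta) xi := by
  ext j s
  induction j using Fin.lastCases with
  | last => rw [Matrix.updateRow_ne (Fin.castSucc_lt_last i).ne']; simp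
  | cast j =>
    simp only [Matrix.updateRow_apply, Fin.castSucc_inj, snocRow_castSucc]

/-- The polynomial in one group of indeterminates obtained by fixing all other groups. -/
def rowEval (i : Fin k) (mu : Matrix (Fin k) (Fin (n + 1)) K) (c : DualPoly K k n) :
    MvPolynomial (Fin (n + 1)) K :=
  aeval (fun p : Fin k × Fin (n + 1) => if p.1 = i then X p.2 else C (mu p.1 p.2)) c

lemma eval_rowEval (i : Fin k) (mu : Matrix (Fin k) (Fin (n + 1)) K) (c : DualPoly K k n)
    (xi : Fin (n + 1) → K) : eval xi (rowEval i mu c) = evalRows c (mu.updateRow i xi) := by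
  rw [rowEval, evalRows, ← coe_aeval_eq_eval, ← coe_aeval_eq_eval, RingHom.coe_coe, RingHom.coe_coe,
    ← AlgHom.comp_apply, comp_aeval]
  congr 2
  ext p
  rw [Matrix.updateRow_apply]
  split_ifs <;> simp

lemma DetEquivariant.isHomogeneous [Infinite K] {D : ℕ} {c : DualPoly K k n}
    (h : DetEquivariant D c) {i : Fin k} {mu : Matrix (Fin k) (Fin (n + 1)) K}
    {q : MvPolynomial (Fin (n + 1)) K}
    (hq : ∀ xi, eval xi q = evalRows c (mu.updateRow i xi)) : q.IsHomogeneous D := by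
  refine isHomogeneous_of_eval_smul fun t v => ?_
  have := h (Matrix.diagonal (Function.update 1 i t)) (mu.updateRow i v)
  rw [diagonal_mul_eq_update, Matrix.det_diagonal, Finset.prod_update_of_mem (Finset.mem_univ i)]
    at this
  rw [hq, hq]
  simpa [Matrix.updateRow_idem] using this

lemma ChowLike.lastEval_splitAlong {D : ℕ} {c : DualPoly K (k + 1) n} {Z : Set (Fin (n + 1) → K)}
    (h : ChowLike D c Z) (mu : Matrix (Fin k) (Fin (n + 1)) K) (h0 : lastEval mu c ≠ 0) :
    SplitAlong (lastEval mu c) {p | p ∈ Z ∧ ∀ j, ∑ s, p s * mu j s = 0} := by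
  have := h.split (Fin.last k) (snocRow mu 0) (lastEval mu c)
    (fun xi => by rw [eval_lastEval, updateRow_snocRow_last]) h0
  convert this using 4 with p
  constructor
  · intro H j hj
    induction j using Fin.lastCases with
    | last => exact absurd rfl hj
    | cast j => simpa using H j
  · intro H j
    simpa using H j.castSucc (Fin.castSucc_lt_last j).ne

lemma ChowLike.lastEval_splits [Infinite K] {D : ℕ} {c : DualPoly K (k + 1) n}
    {Z : Set (Fin (n + 1) → K)} (h : ChowLike D c Z) (mu : Matrix (Fin k) (Fin (n + 1)) K) :
    HasWedge (RingHom.id K) 0 D 1 (lastEval mu c) 1 := by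
  by_cases h0 : lastEval mu c = 0
  · rw [h0]
    simpa using hasWedge_zero (RingHom.id K) D (isHomogeneous_one (Fin (n + 1)) K)
  have hhom : (lastEval mu c).IsHomogeneous D := h.det.isHomogeneous (i := Fin.last k)
    (mu := snocRow mu 0) fun xi => by rw [eval_lastEval, updateRow_snocRow_last]
  obtain ⟨y, x, hx, -⟩ := (h.lastEval_splitAlong mu h0).exists_splitting h0 hhom
  exact ⟨y, x, by rw [map_id]; exact hx, by simp⟩

/-- Equivariance for the block diagonal matrix with blocks `g` and `1`. -/
lemma DetEquivariant.snocRow_mul {D : ℕ} {c : DualPoly K (k + 1) n} (h : DetEquivariant D c)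
    (g : Matrix (Fin k) (Fin k) K) (mu : Matrix (Fin k) (Fin (n + 1)) K) (xi : Fin (n + 1) → K) :
    evalRows c (snocRow (g * mu) xi) = g.det ^ D * evalRows c (snocRow mu xi) := by
  let g' : Matrix (Fin (k + 1)) (Fin (k + 1)) K :=
    snocRow (Matrix.of fun i => Fin.snoc (α := fun _ => K) (g i) 0) (Pi.single (Fin.last k) 1)
  have hdet : g'.det = g.det := by
    rw [Matrix.det_succ_row g' (Fin.last k), Finset.sum_eq_single (Fin.last k)]
    · have : g'.submatrix (Fin.last k).succAbove (Fin.last k).succAbove = g := by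
        ext i j
        simp [g']
      rw [this]
      simp [g', ← two_mul]
    · intro j _ hj
      simp [g', hj]
    · simp
  have hmul : g' * snocRow mu xi = snocRow (g * mu) xi := by
    ext i s
    rw [Matrix.mul_apply, Fin.sum_univ_castSucc]
    induction i using Fin.lastCases with
    | last => simp [g', (Fin.castSucc_lt_last _).ne]
    | cast i => simp [g', Matrix.mul_apply]
  rw [← hmul, h, hdet]

lemma HasWedge.eq_zero_of_degree_pos {d D : ℕ} {f : MvPolynomial (Fin (n + 1)) K}
    (hf : f.IsHomogeneous d) (hd : d ≠ 0) {a : K} (h : HasWedge (RingHom.id K) d D f 0 a) :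
    a = 0 := by
  rw [h.unique Function.injective_id hf (hasWedge_zero _ D hf), zero_pow hd, zero_mul]

lemma eq_C_of_forall_eval_eq [Infinite K] {σ : Type*} {r : MvPolynomial σ K} {a : K}
    (h : ∀ v, eval v r = a) : r = C a :=
  MvPolynomial.funext fun v => by rw [h, eval_C]

lemma Irreducible.not_forall_eval_eq [Infinite K] {σ : Type*} {r : MvPolynomial σ K}
    (hr : Irreducible r) (a : K) : ¬ ∀ v, eval v r = a := by
  intro h
  have := eq_C_of_forall_eval_eq h
  rcases eq_or_ne a 0 with rfl | ha
  · exact hr.ne_zero (by rw [this, C_0])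
  · exact hr.not_isUnit (by rw [this]; exact (isUnit_iff_ne_zero.2 ha).map C)

lemma isHomogeneous_zero_eq_C {σ R : Type*} [CommRing R] {f : MvPolynomial σ R}
    (hf : f.IsHomogeneous 0) : f = C (constantCoeff f) := by
  have := (totalDegree_eq_zero_iff_eq_C).1 ((totalDegree_zero_iff_isHomogeneous _).2 hf)
  simpa [constantCoeff_eq] using this

/-- A polynomial without zeros on a line is constant along it. -/
lemma eval_add_eq_of_ne_zero [IsAlgClosed K] {σ : Type*} {p : MvPolynomial σ K} {v w : σ → K}
    (h : ∀ t : K, eval (v + t • w) p ≠ 0) : eval (v + w) p = eval v p := by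
  let rho : Polynomial K := aeval (fun s => Polynomial.C (v s) + Polynomial.X *
    Polynomial.C (w s)) p
  have hrho : ∀ t, rho.eval t = eval (v + t • w) p := by
    intro t
    change Polynomial.evalRingHom t (aeval _ p) = eval _ p
    rw [aeval_def, ← coe_eval₂Hom, ← RingHom.comp_apply, ← eval₂_id, ← coe_eval₂Hom]
    congr 1
    ext s
    · simp
    · simp only [RingHom.comp_apply, coe_eval₂Hom, eval₂_X]
      simp
      exact mul_comm _ _
  have hdeg : rho.degree = 0 := by
    by_contra hd
    obtain ⟨s, hs⟩ := IsAlgClosed.exists_root rho hd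
    exact h s (by rw [← hrho]; exact hs)
  have hconst := Polynomial.eq_C_of_degree_eq_zero hdeg
  have h1 := hrho 1
  have h2 := hrho 0
  rw [one_smul] at h1
  rw [zero_smul, add_zero] at h2
  rw [← h1, ← h2, hconst, Polynomial.eval_C, Polynomial.eval_C]

/-- Translating a root: an irreducible polynomial cannot divide all `G(·, η)` when
`G(ξ + t η, η) = G(ξ, η)`. -/
lemma exists_not_dvd_of_shear_invariant [IsAlgClosed K] {r : MvPolynomial (Fin (n + 1)) K}
    (hr : Irreducible r) {G : (Fin (n + 1) → K) → (Fin (n + 1) → K) → K}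
    (hG : ∀ (t : K) xi eta, G (xi + t • eta) eta = G xi eta)
    {P : (Fin (n + 1) → K) → MvPolynomial (Fin (n + 1)) K} (hP : ∀ xi eta, eval xi (P eta) = G xi eta)
    {xi₀ : Fin (n + 1) → K} {Q : MvPolynomial (Fin (n + 1)) K} (hQ : Q ≠ 0)
    (hQG : ∀ eta, eval eta Q = G xi₀ eta) : ∃ eta, ¬ r ∣ P eta := by
  by_contra! hdvd
  -- Along `xi₀ + t • eta` the function `G(·, eta)` is a nonzero constant, so its supposed divisor
  -- `r` has no zero there and is constant too.
  have key : ∀ eta, G xi₀ eta ≠ 0 → eval (xi₀ + eta) r = eval xi₀ r := by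
    intro eta h0
    refine eval_add_eq_of_ne_zero fun t ht => h0 ?_
    rw [← hG t, ← hP, eval_eq_zero_of_dvd (hdvd eta) ht]
  -- The factor `Q` takes care of the directions where the argument fails; cancelling it makes `r`
  -- constant.
  have hprod : Q * (aeval (fun s => C (xi₀ s) + X s) r - C (eval xi₀ r)) = 0 := by
    refine MvPolynomial.funext fun eta => ?_
    have : eval eta (aeval (fun s => C (xi₀ s) + X s) r) = eval (xi₀ + eta) r := by
      rw [← coe_aeval_eq_eval, ← coe_aeval_eq_eval, RingHom.coe_coe, RingHom.coe_coe,
        ← AlgHom.comp_apply, comp_aeval]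
      congr 2
      ext s; simp
    rw [map_mul, map_sub, this, hQG, eval_C, map_zero, mul_eq_zero, sub_eq_zero]
    exact or_iff_not_imp_left.2 (key eta)
  have h0 := (mul_eq_zero.1 hprod).resolve_left hQ
  refine Irreducible.not_forall_eval_eq hr (eval xi₀ r) fun v => ?_
  have := congr_arg (eval (v - xi₀)) h0
  rw [map_sub, eval_C, map_zero, sub_eq_zero] at this
  rw [← this, ← coe_aeval_eq_eval, ← coe_aeval_eq_eval, RingHom.coe_coe, RingHom.coe_coe,
        ← AlgHom.comp_apply, comp_aeval]
  congr 2
  ext s; simp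

/-- The wedge of a Chow form of `Z` with `f` is a Chow form of `Z ∩ V(f)`. -/
theorem ChowLike.wedge [IsAlgClosed K] {D d : ℕ} {c : DualPoly K (k + 1) n}
    {Z : Set (Fin (n + 1) → K)} (h : ChowLike D c Z) (hZ0 : ∀ p ∈ Z, p ≠ 0)
    {f : MvPolynomial (Fin (n + 1)) K} (hf : f.IsHomogeneous d) (hf0 : f ≠ 0) {c' : DualPoly K k n}
    (hc' : ∀ mu, HasWedge (RingHom.id K) d D f (lastEval mu c) (evalRows c' mu)) :
    ChowLike (d * D) c' {p | p ∈ Z ∧ eval p f = 0} where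
  det := by
    intro g mu
    obtain ⟨y, x, h1, h2⟩ := hc' mu
    have hlast : lastEval (g * mu) c = C (g.det ^ D) * lastEval mu c :=
      MvPolynomial.funext fun xi => by
        rw [map_mul, eval_C, eval_lastEval, eval_lastEval, h.det.snocRow_mul]
    refine (hc' (g * mu)).unique Function.injective_id hf ⟨g.det ^ D * y, x, ?_, ?_⟩
    · rw [map_id] at h1 ⊢
      rw [hlast, h1, C_mul, mul_assoc]
    · rw [RingHom.id_apply] at h2 ⊢
      rw [h2]; ring
  split := by
    intro i mu q hq hq0
    have hW : ∀ xi, HasWedge (RingHom.id K) d D f (lastEval (mu.updateRow i xi) c) (eval xi q) :=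
      fun xi => by rw [hq]; exact hc' _
    have hzero : ∀ xi, lastEval (mu.updateRow i xi) c ≠ 0 →
        (eval xi q = 0 ↔ ∃ p ∈ {p | p ∈ {p | p ∈ Z ∧ eval p f = 0} ∧
          ∀ j, j ≠ i → ∑ s, p s * mu j s = 0}, ∑ s, p s * xi s = 0) := by
      intro xi h0
      rw [(h.lastEval_splitAlong _ h0).hasWedge_eq_zero_iff h0 (fun p hp => hZ0 p hp.1) hf (hW xi)]
      constructor
      · rintro ⟨p, ⟨hp, hmu⟩, hpf⟩
        refine ⟨p, ⟨⟨hp, hpf⟩, fun j hj => ?_⟩, ?_⟩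
        · simpa [Matrix.updateRow_ne hj] using hmu j
        · simpa using hmu i
      · rintro ⟨p, ⟨⟨hp, hpf⟩, hmu⟩, hpi⟩
        refine ⟨p, ⟨hp, fun j => ?_⟩, hpf⟩
        rcases eq_or_ne j i with rfl | hj
        · simpa using hpi
        · simpa [Matrix.updateRow_ne hj] using hmu j hj
    have hdvd : ∀ p ∈ {p | p ∈ {p | p ∈ Z ∧ eval p f = 0} ∧
        ∀ j, j ≠ i → ∑ s, p s * mu j s = 0}, linForm p ∣ q := by
      rintro p hp
      refine dvd_of_zero_subset (linForm_prime (hZ0 p hp.1.1)) fun xi hxi => ?_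
      rw [eval_linForm] at hxi
      by_cases h0 : lastEval (mu.updateRow i xi) c = 0
      -- A nonzero form of degree `0` has no zeros, so the existence of `p` forces positive degree;
      -- then the wedge with the zero form vanishes.
      · have hd : d ≠ 0 := by
          rintro rfl
          have hpf := hp.1.2
          rw [isHomogeneous_zero_eq_C hf, eval_C] at hpf
          exact hf0 (by rw [isHomogeneous_zero_eq_C hf, hpf, C_0])
        have := hW xi
        rw [h0] at this
        exact this.eq_zero_of_degree_pos hf hd
      · exact (hzero xi h0).2 ⟨p, hp, hxi⟩
    refine ⟨fun r hr hrq => ?_, hdvd⟩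
    rcases eq_or_ne d 0 with rfl | hd
    -- In degree `0` all values of `q` equal the same nonzero constant, so `q` has no irreducible
    -- factor.
    · exfalso
      have hfC := isHomogeneous_zero_eq_C hf
      have hf0' : constantCoeff f ≠ 0 := fun h => hf0 (by rw [hfC, h, C_0])
      refine hr.not_isUnit (isUnit_of_dvd_one (dvd_of_zero_subset hr.prime fun v hv => ?_))
      have hv' := eval_eq_zero_of_dvd hrq hv
      obtain ⟨y, x, -, h2⟩ := hW v
      rw [hv', hfC] at h2
      simp at h2
      exact absurd h2.symm (pow_ne_zero D hf0')
    · by_contra hcon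
      -- A factor `r` not given by a point must vanish only where the whole form in the last row
      -- vanishes, so it divides `c(·, eta)` for every value `eta` of the last row.
      have hall : ∀ eta, r ∣ rowEval i.castSucc (snocRow mu eta) c := by
        intro eta
        refine (dvd_or_associated_of_zero_subset hq0 (fun p hp => hZ0 p hp.1.1) hdvd hr
          fun xi hxi => ?_).resolve_right hcon
        by_cases h0 : lastEval (mu.updateRow i xi) c = 0
        · left
          rw [eval_rowEval, updateRow_snocRow_castSucc, ← eval_lastEval, h0, map_zero]
        · exact Or.inr ((hzero xi h0).1 (eval_eq_zero_of_dvd hrq hxi))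
      obtain ⟨xi₀, hxi₀⟩ := exists_eval_ne_zero hq0
      have hQ : lastEval (mu.updateRow i xi₀) c ≠ 0 := fun h0 => hxi₀ <| by
        have := hW xi₀
        rw [h0] at this
        exact this.eq_zero_of_degree_pos hf hd
      -- The contradiction: adding a multiple of the last row to row `i` does not change `c`, which
      -- excludes such a common divisor.
      obtain ⟨eta, heta⟩ := exists_not_dvd_of_shear_invariant hr
        (G := fun xi eta => evalRows c (snocRow (mu.updateRow i xi) eta))
        (P := fun eta => rowEval i.castSucc (snocRow mu eta) c) (xi₀ := xi₀) (Q := _)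
        (fun t xi eta => by
          have := h.det (Matrix.transvection i.castSucc (Fin.last k) t)
            (snocRow (mu.updateRow i xi) eta)
          rw [Matrix.det_transvection_of_ne _ _ (Fin.castSucc_lt_last i).ne, one_pow, one_mul,
            transvection_mul_eq_update, updateRow_snocRow_castSucc, Matrix.updateRow_idem] at this
          simpa using this)
        (fun xi eta => by rw [eval_rowEval, updateRow_snocRow_castSucc]) hQ
        (fun eta => eval_lastEval _ _ _)
      exact heta (hall eta)

end ChowLike

/-! ### The Chow form of a set of points -/

section ChowForm

variable {K : Type*} [Field K] {k n : ℕ} {W : Set (PSpace K n)} {c : DualPoly K k n}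

/-- The representatives of the points of `W`. -/
def repSet (W : Set (PSpace K n)) : Set (Fin (n + 1) → K) := {x | ∃ p ∈ W, x = p.rep}

lemma repSet_ne_zero : ∀ x ∈ repSet W, x ≠ 0 := by
  rintro _ ⟨p, -, rfl⟩; exact p.rep_nonzero

lemma meetsForms_iff {lam : Matrix (Fin k) (Fin (n + 1)) K} :
    MeetsForms W lam ↔ ∃ x ∈ repSet W, lam.mulVec x = 0 := by
  constructor
  · rintro ⟨p, hp, h⟩
    exact ⟨_, ⟨p, hp, rfl⟩, funext h⟩
  · rintro ⟨_, ⟨p, hp, rfl⟩, h⟩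
    exact ⟨p, hp, fun i => congr_fun h i⟩

lemma IsChowFormFor.evalRows_eq_zero_iff (hc : IsChowFormFor W c)
    (lam : Matrix (Fin k) (Fin (n + 1)) K) :
    evalRows c lam = 0 ↔ ∃ x ∈ repSet W, lam.mulVec x = 0 := by
  rw [← meetsForms_iff, ← hc lam, evalRows]

lemma IsChowFormFor.zeroInvariant (hc : IsChowFormFor W c) : ZeroInvariant c := by
  intro g _ mu h
  rw [hc.evalRows_eq_zero_iff] at h ⊢
  obtain ⟨x, hx, h⟩ := h
  exact ⟨x, hx, by rw [← Matrix.mulVec_mulVec, h, Matrix.mulVec_zero]⟩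

/-- A nonzero Chow form is determinant-equivariant, and splits along the set it belongs to. -/
theorem IsChowFormFor.chowLike [IsAlgClosed K] (hc : IsChowFormFor W c) (hc0 : c ≠ 0) (i : Fin k) :
    ChowLike (groupDegree i c) c (repSet W) where
  det := (hc.zeroInvariant.detEquivariant hc0 i).2
  split := by
    intro i mu q hq hq0
    refine SplitAlong.of_zeros hq0 (fun p hp => repSet_ne_zero p hp.1) fun xi => ?_
    rw [hq, hc.evalRows_eq_zero_iff]
    constructor
    · rintro ⟨x, hx, h⟩
      refine ⟨x, ⟨hx, fun j hj => ?_⟩, ?_⟩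
      · have := congr_fun h j
        simpa [Matrix.mulVec, dotProduct, Matrix.updateRow_ne hj, mul_comm] using this
      · have := congr_fun h i
        simpa [Matrix.mulVec, dotProduct, mul_comm] using this
    · rintro ⟨x, ⟨hx, hj⟩, hi⟩
      refine ⟨x, hx, funext fun j => ?_⟩
      rcases eq_or_ne j i with rfl | hji
      · simpa [Matrix.mulVec, dotProduct, mul_comm] using hi
      · simpa [Matrix.mulVec, dotProduct, Matrix.updateRow_ne hji, mul_comm] using hj j hji

end ChowForm

/-! ### The chosen wedge -/

section WedgeLemmas

variable {A : Type*} [CommRing A] [IsDomain A] {n d D : ℕ} {f g : MvPolynomial (Fin (n + 1)) A}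

lemma algebraMap_fracClosure_injective : Function.Injective (algebraMap A (FracClosure A)) := by
  rw [IsScalarTower.algebraMap_eq A (FractionRing A) (FracClosure A)]
  exact (algebraMap (FractionRing A) (FracClosure A)).injective.comp (IsFractionRing.injective A _)

lemma IsWedge.unique (hf : f.IsHomogeneous d) {a b : A} (ha : IsWedge d D f g a)
    (hb : IsWedge d D f g b) : a = b :=
  HasWedge.unique algebraMap_fracClosure_injective hf ha hb

lemma isWedge_wedge (h : ∃ a, IsWedge d D f g a) : IsWedge d D f g (wedge d D f g) := by
  rw [wedge, dif_pos h]
  exact h.choose_spec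

lemma IsWedge.existsUnique (hf : f.IsHomogeneous d) {a : A} (ha : IsWedge d D f g a) :
    ∃! a, IsWedge d D f g a := ⟨a, ha, fun _ hb => hb.unique hf ha⟩

lemma IsWedge.wedge_eq (hf : f.IsHomogeneous d) {a : A} (ha : IsWedge d D f g a) :
    wedge d D f g = a := (isWedge_wedge ⟨a, ha⟩).unique hf ha

end WedgeLemmas

/-! ### Iterated wedges over polynomial rings -/

section Generic

variable {K : Type*} [Field K] {τ : Type*} {k n : ℕ}

lemma rowHom_comp_map {A B S : Type*} [CommRing A] [CommRing B] [CommRing S] (φ : B →+* S) (θ : A →+* B)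
    (mu : Matrix (Fin k) (Fin (n + 1)) S) : (rowHom φ mu).comp (map θ) = rowHom (φ.comp θ) mu := by
  apply MvPolynomial.ringHom_ext <;> intros <;> simp

lemma lastGroup_map {A B : Type*} [CommRing A] [CommRing B] (θ : A →+* B)
    (c : DualPoly A (k + 1) n) : lastGroup (map θ c) = map (map θ) (lastGroup c) := by
  have : (lastGroupHom B k n).comp (map θ) = (map (map θ)).comp (lastGroupHom A k n) := by
    apply dualPoly_hom_ext <;> intros <;> simp [lastGroupHom_apply]
  exact congr_arg (fun f => f c) this

lemma lastEval_map {A : Type*} [CommRing A] (φ : A →+* K) (mu : Matrix (Fin k) (Fin (n + 1)) K)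
    (c : DualPoly A (k + 1) n) : lastEval mu (map φ c) = map (rowHom φ mu) (lastGroup c) := by
  rw [lastEval, lastGroup_map, map_map, rowHom_comp_map, RingHom.id_comp]

lemma exists_rowHom_ne_zero [Infinite K] {δ : MvPolynomial τ K} (hδ : δ ≠ 0)
    {s : DualPoly (MvPolynomial τ K) k n} (hs : s ≠ 0) :
    ∃ (t : τ → K) (mu : Matrix (Fin k) (Fin (n + 1)) K), eval t δ ≠ 0 ∧
      rowHom (eval t) mu s ≠ 0 := by
  obtain ⟨a, ha⟩ := ne_zero_iff.1 hs
  obtain ⟨t, ht⟩ := exists_eval_ne_zero (mul_ne_zero hδ ha)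
  rw [map_mul] at ht
  have h0 : map (eval t) s ≠ 0 := ne_zero_iff.2 ⟨a, by
    rw [coeff_map]; exact right_ne_zero_of_mul ht⟩
  obtain ⟨v, hv⟩ := exists_eval_ne_zero h0
  refine ⟨t, fun i j => v (i, j), left_ne_zero_of_mul ht, ?_⟩
  have := rowHom_comp_map (RingHom.id K) (eval t) (Matrix.of fun i j => v (i, j))
  rw [RingHom.id_comp] at this
  exact fun h => hv ((congr_arg (fun f => f s) this).trans h)

/-- Wedges exist for families which are generically good. -/
theorem iterWedgeDefined_of_generic [IsAlgClosed K] (k : ℕ) (d : Fin k → ℕ) (D : ℕ)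
    (F : Fin k → MvPolynomial (Fin (n + 1)) (MvPolynomial τ K)) (hF : ∀ i, (F i).IsHomogeneous (d i))
    (c : DualPoly (MvPolynomial τ K) k n) {δ : MvPolynomial τ K} (hδ : δ ≠ 0)
    (hFδ : ∀ t, eval t δ ≠ 0 → ∀ i, map (eval t) (F i) ≠ 0)
    (hcδ : ∀ t, eval t δ ≠ 0 → ∃ Z : Set (Fin (n + 1) → K), (∀ p ∈ Z, p ≠ 0) ∧
      ChowLike D (map (eval t) c) Z) :
    IterWedgeDefined k d D F c := by
  induction k generalizing D with
  | zero => trivial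
  | succ k ih =>
    have : Infinite K := IsAlgClosed.instInfinite
    have hhom : (map C (F (Fin.last k)) :
        MvPolynomial (Fin (n + 1)) (DualPoly (MvPolynomial τ K) k n)).IsHomogeneous
        (d (Fin.last k)) := (hF _).map C
    -- Every `K`-point outside the zero set of `δ` yields a split form. Such points avoid any given
    -- nonzero polynomial `s`, so the form splits generically.
    have hsplit := HasWedge.of_specializations (g := lastGroup c) (D := D) (K := K)
      fun s hs => by
        obtain ⟨t, mu, ht, hmu⟩ := exists_rowHom_ne_zero hδ hs
        obtain ⟨Z, -, hZ⟩ := hcδ t ht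
        refine ⟨_, hmu, ?_⟩
        have := hZ.lastEval_splits mu
        rw [lastEval_map] at this
        rw [← RingHom.id_comp (rowHom _ _), ← hasWedge_map]
        simpa using this
    obtain ⟨a, ha⟩ := HasWedge.exists_of_isIntegrallyClosed hhom hsplit
    refine ⟨ha.existsUnique hhom, ih _ _ _ (fun i => hF _) _ (fun t ht i => hFδ t ht _) ?_⟩
    intro t ht
    obtain ⟨Z, hZ0, hZ⟩ := hcδ t ht
    refine ⟨_, fun p hp => hZ0 p hp.1, hZ.wedge hZ0 ((hF (Fin.last k)).map (eval t))
      (hFδ t ht _) fun mu => ?_⟩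
    rw [wedgeLast, ha.wedge_eq hhom]
    -- The generic wedge specializes to the wedge over `K`; this is what `ChowLike.wedge` needs to
    -- supply the induction hypothesis.
    have := HasWedge.specialize algebraMap_fracClosure_injective (rowHom (eval t) mu) hhom ha
    rw [← RingHom.id_comp (rowHom _ _), ← hasWedge_map, map_map, rowHom_comp_C] at this
    rw [lastEval_map, ← rowHom_id, ← RingHom.comp_apply, rowHom_comp_map]
    exact this

end Generic

/-! ### Wedges and substitution of linear forms -/

section Substitution

variable {R R' : Type*} [CommRing R] [CommRing R'] {k m n : ℕ}

/-- The homomorphism substituting `Y_i Λ` for the group `X_i`, and mapping coefficients by `θ`. -/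
def substRows (θ : R →+* R') (Λ : Matrix (Fin (m + 1)) (Fin (n + 1)) R') (k : ℕ) :
    DualPoly R k n →+* DualPoly R' k m :=
  rowHom (C.comp θ) (fun i s => ∑ j, X (i, j) * C (Λ j s))

@[simp] lemma substRows_C (θ : R →+* R') (Λ : Matrix (Fin (m + 1)) (Fin (n + 1)) R') (a : R) :
    substRows θ Λ k (C a) = C (θ a) := rowHom_C _ _ _

@[simp] lemma substRows_X (θ : R →+* R') (Λ : Matrix (Fin (m + 1)) (Fin (n + 1)) R')
    (p : Fin k × Fin (n + 1)) : substRows θ Λ k (X p) = ∑ j, X (p.1, j) * C (Λ j p.2) :=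
  rowHom_X _ _ _

lemma substRows_map {R₀ : Type*} [CommRing R₀] (φ : R₀ →+* R) (θ : R →+* R')
    (Λ : Matrix (Fin (m + 1)) (Fin (n + 1)) R') (c : DualPoly R₀ k n) :
    substRows θ Λ k (map φ c) = substRows (θ.comp φ) Λ k c := by
  have : (substRows θ Λ k).comp (map φ) = substRows (n := n) (θ.comp φ) Λ k := by
    apply MvPolynomial.ringHom_ext <;> intros <;> simp
  exact congr_arg (fun f => f c) this

lemma lastGroup_substRows (θ : R →+* R') (Λ : Matrix (Fin (m + 1)) (Fin (n + 1)) R')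
    (c : DualPoly R (k + 1) n) :
    lastGroup (substRows θ Λ (k + 1) c) =
      eval₂ (C.comp (substRows θ Λ k)) (fun s => ∑ j, X j * C (C (Λ j s))) (lastGroup c) := by
  have : (lastGroupHom R' k m).comp (substRows θ Λ (k + 1)) =
      (eval₂Hom (C.comp (substRows θ Λ k)) (fun s => ∑ j, X j * C (C (Λ j s)))).comp
        (lastGroupHom R k n) := by
    apply dualPoly_hom_ext <;> intros <;>
      simp only [RingHom.comp_apply, substRows_C, substRows_X, map_sum, map_mul, lastGroupHom_apply,
        lastGroup_C, lastGroup_X_castSucc, lastGroup_X_last, coe_eval₂Hom, eval₂_C, eval₂_X]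
  exact congr_arg (fun f => f c) this

lemma compForms_isHomogeneous {f : MvPolynomial (Fin (m + 1)) R} {d : ℕ} (hf : f.IsHomogeneous d)
    (Λ : Matrix (Fin (m + 1)) (Fin (n + 1)) R) : (compForms f Λ).IsHomogeneous d := by
  have := hf.aeval (fun i => linForm (Λ i)) fun i => linForm_isHomogeneous (Λ i)
  rwa [one_mul] at this

/-- Putting `Y Λ` for the last row turns a factor given by `x` into the factor given by `Λ x`, and
`f'(Λ x) = f(x)`. The substitution need not be injective, so the splitting has to be specialized
first. -/
lemma IsWedge.of_substRows [IsDomain R] [IsDomain R'] {θ : R →+* R'}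
    {Λ : Matrix (Fin (m + 1)) (Fin (n + 1)) R'} {d D : ℕ} {f : MvPolynomial (Fin (n + 1)) R}
    {f' : MvPolynomial (Fin (m + 1)) R'} (hf : f.IsHomogeneous d)
    (hff' : compForms f' Λ = map θ f) {c : DualPoly R (k + 1) n} {a : DualPoly R k n}
    (h : IsWedge d D (map C f) (lastGroup c) a) :
    IsWedge d D (map C f') (lastGroup (substRows θ Λ (k + 1) c)) (substRows θ Λ k a) := by
  let Ω := FracClosure (DualPoly R' k m)
  let α : DualPoly R' k m →+* Ω := algebraMap _ _
  obtain ⟨y, x, h1, h2⟩ : HasWedge (α.comp (substRows θ Λ k)) d D (map C f) (lastGroup c) a :=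
    HasWedge.specialize algebraMap_fracClosure_injective _ (hf.map C) h
  refine ⟨y, fun i j => ∑ s, α (C (Λ j s)) * x i s, ?_, ?_⟩
  · have e1 : map α (lastGroup (substRows θ Λ (k + 1) c)) =
        eval₂ C (fun s => ∑ j, X j * C (α (C (Λ j s))))
          (map (α.comp (substRows θ Λ k)) (lastGroup c)) := by
      rw [lastGroup_substRows, eval₂_comp_left, eval₂_map]
      congr 1
      · ext <;> simp
      · ext1 s; simp
    refine e1.trans ?_
    rw [h1, ← coe_eval₂Hom, map_mul, map_prod]
    simp only [coe_eval₂Hom, eval₂_C, eval₂_linForm]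
    congr 1
    refine Finset.prod_congr rfl fun i _ => ?_
    simp only [Finset.mul_sum, map_sum, Finset.sum_mul]
    rw [Finset.sum_comm]
    refine Finset.sum_congr rfl fun j _ => Finset.sum_congr rfl fun s _ => ?_
    rw [C_mul]; ring
  · change (α.comp (substRows θ Λ k)) a = _
    rw [h2]
    congr 1
    refine Finset.prod_congr rfl fun i _ => ?_
    have hC : (α.comp (substRows θ Λ k)).comp C = (α.comp C).comp θ := by
      ext; simp
    rw [eval₂_map, hC, ← eval₂_map, ← hff', compForms, aeval_def,
      ← coe_eval₂Hom (α.comp C), eval₂_comp_left]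
    change _ = eval₂ α _ (map C f')
    rw [eval₂_map]
    congr 1
    · ext; simp
    · ext1 j; simp

/-- Iterated wedges are compatible with substituting linear forms. -/
theorem iterWedge_substRows [IsDomain R] [IsDomain R'] {θ : R →+* R'}
    {Λ : Matrix (Fin (m + 1)) (Fin (n + 1)) R'} (d : Fin k → ℕ) (D : ℕ)
    {f : Fin k → MvPolynomial (Fin (n + 1)) R} {f' : Fin k → MvPolynomial (Fin (m + 1)) R'}
    (hf : ∀ i, (f i).IsHomogeneous (d i)) (hf' : ∀ i, (f' i).IsHomogeneous (d i))
    (hff' : ∀ i, compForms (f' i) Λ = map θ (f i)) {c : DualPoly R k n}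
    (h : IterWedgeDefined k d D f c) :
    IterWedgeDefined k d D f' (substRows θ Λ k c) ∧
      iterWedge k d D f' (substRows θ Λ k c) = θ (iterWedge k d D f c) := by
  induction k generalizing D with
  | zero =>
    refine ⟨trivial, ?_⟩
    obtain ⟨a, rfl⟩ := C_surjective (Fin 0 × Fin (n + 1)) c
    simp [iterWedge]
  | succ k ih =>
    have hw := IsWedge.of_substRows (hf _) (hff' _) (isWedge_wedge h.1.exists)
    have hw' := hw.wedge_eq ((hf' _).map C)
    obtain ⟨h1, h2⟩ := ih (fun i => d i.castSucc) (d (Fin.last k) * D) (fun i => hf _)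
      (fun i => hf' _) (fun i => hff' _) h.2
    rw [IterWedgeDefined, iterWedge, iterWedge, wedgeLast, hw']
    exact ⟨⟨hw.existsUnique ((hf' _).map C), h1⟩, h2⟩

lemma substRows_one (θ : R →+* R') (c : DualPoly R k n) :
    substRows θ (1 : Matrix (Fin (n + 1)) (Fin (n + 1)) R') k c = map θ c := by
  have : substRows θ (1 : Matrix (Fin (n + 1)) (Fin (n + 1)) R') k = map θ := by
    apply MvPolynomial.ringHom_ext
    · intro; simp
    · rintro ⟨i, s⟩
      simp [Matrix.one_apply, apply_ite]
  rw [this]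

lemma compForms_one (f : MvPolynomial (Fin (n + 1)) R) : compForms f 1 = f := by
  simp [compForms, Matrix.one_apply, apply_ite]

/-- Iterated wedges are compatible with homomorphisms. -/
theorem iterWedge_map [IsDomain R] [IsDomain R'] (θ : R →+* R') (d : Fin k → ℕ) (D : ℕ)
    {f : Fin k → MvPolynomial (Fin (n + 1)) R} (hf : ∀ i, (f i).IsHomogeneous (d i))
    {c : DualPoly R k n} (h : IterWedgeDefined k d D f c) :
    IterWedgeDefined k d D (fun i => map θ (f i)) (map θ c) ∧
      iterWedge k d D (fun i => map θ (f i)) (map θ c) = θ (iterWedge k d D f c) := by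
  have := iterWedge_substRows (θ := θ) (Λ := 1) d D hf (fun i => (hf i).map θ)
    (fun i => compForms_one _) h
  rwa [substRows_one] at this

end Substitution

/-! ### Existence of iterated wedges over any domain -/

section Defined

variable {K : Type*} [Field K] [IsAlgClosed K] {k n : ℕ}

/-- The generic form of degree `d`, with coefficients `v`. -/
def formOfCoeffs {R : Type*} [CommRing R] (m d : ℕ) (v : Expo m d → R) :
    MvPolynomial (Fin (m + 1)) R := ∑ a, monomial a.1 (v a)

lemma formOfCoeffs_isHomogeneous {R : Type*} [CommRing R] (m d : ℕ) (v : Expo m d → R) :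
    (formOfCoeffs m d v).IsHomogeneous d := by
  refine IsHomogeneous.sum _ _ _ fun a _ => isHomogeneous_monomial _ ?_
  rw [Finsupp.degree_eq_sum]
  exact (Finset.mem_finsuppAntidiag.1 a.2).1

lemma map_formOfCoeffs {R S : Type*} [CommRing R] [CommRing S] (θ : R →+* S) (m d : ℕ)
    (v : Expo m d → R) : map θ (formOfCoeffs m d v) = formOfCoeffs m d (fun a => θ (v a)) := by
  simp [formOfCoeffs]

lemma coeff_formOfCoeffs {R : Type*} [CommRing R] {m d : ℕ} (v : Expo m d → R) (a : Expo m d) :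
    coeff a.1 (formOfCoeffs m d v) = v a := by
  classical
  simp [formOfCoeffs, coeff_sum, coeff_monomial]

lemma formOfCoeffs_coeff {R : Type*} [CommRing R] {m d : ℕ} {f : MvPolynomial (Fin (m + 1)) R}
    (hf : f.IsHomogeneous d) : formOfCoeffs m d (fun a => coeff a.1 f) = f := by
  classical
  ext b
  by_cases hb : b.degree = d
  · exact coeff_formOfCoeffs (fun a : Expo m d => coeff a.1 f) ⟨b, by
      rw [Finset.mem_finsuppAntidiag, ← Finsupp.degree_eq_sum]; simp [hb]⟩
  · rw [hf.coeff_eq_zero hb, (formOfCoeffs_isHomogeneous m d _).coeff_eq_zero hb]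

instance (m d : ℕ) : Nonempty (Expo m d) :=
  ⟨⟨Finsupp.single 0 d, by rw [Finset.mem_finsuppAntidiag, ← Finsupp.degree_eq_sum]; simp⟩⟩

/-- Iterated wedges with a Chow form exist over any domain. -/
theorem ChowLike.iterWedgeDefined {D : ℕ} {c : DualPoly K k n} {Z : Set (Fin (n + 1) → K)}
    (h : ChowLike D c Z) (hZ : ∀ p ∈ Z, p ≠ 0) {R : Type*} [CommRing R] [IsDomain R] [Algebra K R]
    {d : Fin k → ℕ} {f : Fin k → MvPolynomial (Fin (n + 1)) R}
    (hf : ∀ i, (f i).IsHomogeneous (d i)) :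
    IterWedgeDefined k d D f (map (algebraMap K R) c) := by
  let τ := Σ i : Fin k, Expo n (d i)
  let F : Fin k → MvPolynomial (Fin (n + 1)) (MvPolynomial τ K) := fun i =>
    formOfCoeffs n (d i) fun a => X ⟨i, a⟩
  let θ : MvPolynomial τ K →+* R := eval₂Hom (algebraMap K R) fun p => coeff p.2.1 (f p.1)
  -- One coefficient of each generic form: where `δ` does not vanish, no form specializes to zero.
  let δ : MvPolynomial τ K := ∏ i, X ⟨i, Classical.arbitrary _⟩
  have hδ : δ ≠ 0 := Finset.prod_ne_zero_iff.2 fun i _ => X_ne_zero _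
  have hF : ∀ i, (F i).IsHomogeneous (d i) := fun i => formOfCoeffs_isHomogeneous _ _ _
  have hdef : IterWedgeDefined k d D F (map C c) := by
    refine iterWedgeDefined_of_generic k d D F hF _ hδ ?_ ?_
    · intro t ht i h0
      rw [map_prod, Finset.prod_ne_zero_iff] at ht
      apply ht i (Finset.mem_univ i)
      have := congr_arg (coeff (Classical.arbitrary (Expo n (d i))).1) h0
      rw [map_formOfCoeffs, coeff_formOfCoeffs] at this
      exact this
    · intro t _
      refine ⟨Z, hZ, ?_⟩
      rw [map_map]
      convert h
      have : (eval t).comp (C : K →+* MvPolynomial τ K) = RingHom.id K := by ext; simp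
      rw [this, map_id]
  -- The given `f` may have zero entries: specialization of the generic wedge makes no use of `δ`.
  have := (iterWedge_map θ d D hF hdef).1
  convert this using 1
  · ext1 i
    rw [map_formOfCoeffs]
    simp only [θ, eval₂Hom_X']
    rw [formOfCoeffs_coeff (hf i)]
  · rw [map_map]
    congr 1
    refine RingHom.ext fun x => ?_
    simp [θ]

end Defined

/-! ### Polynomiality and homogeneity of `c^♯` -/

section Sharp

variable {K : Type*} [Field K] {k m n : ℕ} {D : ℕ}

/-- The value of `c` at the rows of a matrix over a `K`-algebra. -/
def aevalRows {S : Type*} [CommRing S] [Algebra K S] (c : DualPoly K k n)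
    (mu : Matrix (Fin k) (Fin (n + 1)) S) : S := aeval (fun p => mu p.1 p.2) c

variable {S T : Type*} [CommRing S] [Algebra K S] [CommRing T] [Algebra K T]

lemma map_aevalRows (θ : S →ₐ[K] T) (c : DualPoly K k n) (mu : Matrix (Fin k) (Fin (n + 1)) S) :
    θ (aevalRows c mu) = aevalRows c (mu.map θ) := map_aeval_rows θ c mu

lemma aevalRows_self (c : DualPoly K k n) (mu : Matrix (Fin k) (Fin (n + 1)) K) :
    aevalRows c mu = evalRows c mu := by
  rw [aevalRows, evalRows, ← coe_aeval_eq_eval]; rfl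

lemma DetEquivariant.aevalRows_mul [Infinite K] {c : DualPoly K k n} (h : DetEquivariant D c)
    (g : Matrix (Fin k) (Fin k) S) (mu : Matrix (Fin k) (Fin (n + 1)) S) :
    aevalRows c (g * mu) = g.det ^ D * aevalRows c mu := h.aeval_mul g mu

lemma DetEquivariant.aevalRows_smul [Infinite K] {c : DualPoly K k n} (h : DetEquivariant D c)
    (t : S) (mu : Matrix (Fin k) (Fin (n + 1)) S) :
    aevalRows c (t • mu) = t ^ (k * D) * aevalRows c mu := by
  rw [Matrix.smul_eq_diagonal_mul, h.aevalRows_mul, Matrix.det_diagonal]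
  simp [pow_mul]

/-- The rows `y_p x_i - y_i x_p`, where `p` is the last index. -/
def pivotRows (x : Matrix (Fin (m + 1)) (Fin (n + 1)) S) (y : Fin (m + 1) → S) :
    Matrix (Fin m) (Fin (n + 1)) S :=
  Matrix.of fun i s => y (Fin.last m) * x i.castSucc s - y i.castSucc * x (Fin.last m) s

lemma pivotRows_smul (x : Matrix (Fin (m + 1)) (Fin (n + 1)) S) (y : Fin (m + 1) → S) (t : S) :
    pivotRows x (t • y) = t • pivotRows x y := by
  ext i s
  simp [pivotRows]
  ring

/-- Change of pivot. Row operations of determinant `y_0 ^ m` turn the rows with last pivot into rows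
with pivot `0`, all but the first multiplied by the last coordinate of `y`. Equivariance converts
this into powers. -/
lemma DetEquivariant.pivot [Infinite K] {c : DualPoly K (m + 1) n} (h : DetEquivariant D c)
    (x : Matrix (Fin (m + 2)) (Fin (n + 1)) S) (y : Fin (m + 2) → S) :
    ∃ q : S, y 0 ^ (m * D) * aevalRows c (pivotRows x y) = y (Fin.last (m + 1)) ^ (m * D) * q := by
  let N := pivotRows x y
  let M0 : Matrix (Fin (m + 1)) (Fin (n + 1)) S :=
    Matrix.of (Fin.cons (N 0) fun i s => y 0 * x i.succ.castSucc s - y i.succ.castSucc * x 0 s)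
  let g : Matrix (Fin (m + 1)) (Fin (m + 1)) S :=
    Matrix.of (Fin.cons (Pi.single 0 1) fun i =>
      Fin.cons (-y i.succ.castSucc) (Pi.single i (y 0)))
  let e : Matrix (Fin (m + 1)) (Fin (m + 1)) S :=
    Matrix.diagonal (Fin.cons 1 fun _ => y (Fin.last (m + 1)))
  have hg : g.det = y 0 ^ m := by
    rw [Matrix.det_of_isLowerTriangular]
    · simp [g, Fin.prod_univ_succ]
    · intro i j hij
      have hij' : i < j := hij
      induction i using Fin.cases with
      | zero => simp [g, hij'.ne']
      | succ i =>
        induction j using Fin.cases with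
        | zero => exact absurd hij' (Fin.not_lt_zero _)
        | succ j => simp [g, (Fin.succ_lt_succ_iff.1 hij').ne']
  have he : e.det = y (Fin.last (m + 1)) ^ m := by
    simp [e, Matrix.det_diagonal, Fin.prod_univ_succ]
  have hge : g * N = e * M0 := by
    ext i s
    rw [Matrix.diagonal_mul, Matrix.mul_apply, Fin.sum_univ_succ]
    refine Fin.cases ?_ (fun i => ?_) i
    · simp [g, M0]
    · simp [g, M0, N, pivotRows, Pi.single_apply]
      ring
  refine ⟨aevalRows c M0, ?_⟩
  rw [pow_mul, pow_mul, ← hg, ← he, ← h.aevalRows_mul, ← h.aevalRows_mul, hge]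

lemma mul_sub_mul_eq_mul_div_sub_div {F : Type*} [Field F] {a b p q : F} (hp : p ≠ 0) (hq : q ≠ 0) :
    q * a - p * b = q * p * (a / p - b / q) := by
  field_simp

/-- The rational function defining `c^♯` is a polynomial. -/
theorem algebraMap_sharp [Infinite K] {c : DualPoly K (m + 1) n} (h : DetEquivariant D c) :
    algebraMap (SharpPoly K (m + 1) n) (FractionRing (SharpPoly K (m + 1) n)) (sharp c D) =
      sharpFrac c D ∧
    X (Sum.inr (Fin.last (m + 1))) ^ (m * D) * sharp c D =
      aevalRows c (pivotRows (Matrix.of fun i s => X (Sum.inl (i, s))) fun i => X (Sum.inr i)) := by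
  let P := SharpPoly K (m + 1) n
  let Q := FractionRing P
  let α : P →ₐ[K] Q := IsScalarTower.toAlgHom K P Q
  have hα : Function.Injective α := IsFractionRing.injective P Q
  let x : Matrix (Fin (m + 2)) (Fin (n + 1)) P := Matrix.of fun i s => X (Sum.inl (i, s))
  let y : Fin (m + 2) → P := fun i => X (Sum.inr i)
  have hy : ∀ i, α (y i) ≠ 0 := fun i h0 => X_ne_zero (R := K) (Sum.inr i) (hα (by rw [map_zero]; exact h0))
  obtain ⟨q, hq⟩ := h.pivot x y
  -- The last coordinate is a prime that does not divide `y_0`, so its power divides the other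
  -- factor.
  obtain ⟨w, hw⟩ : y (Fin.last (m + 1)) ^ (m * D) ∣ aevalRows c (pivotRows x y) := by
    refine X_prime.pow_dvd_of_dvd_mul_left _ (fun hd => ?_) ⟨q, hq⟩
    have := (X_prime (R := K)).dvd_of_dvd_pow hd
    rw [X_dvd_X] at this
    simp [Fin.ext_iff] at this
  -- Clearing denominators in the `m + 1` rows costs the `D`-th powers of `y_i` and, each time, of
  -- the last coordinate; one of the latter belongs to the product in `sharpFrac`, which leaves `m *
  -- D`.
  have hfrac : α (y (Fin.last (m + 1))) ^ (m * D) * sharpFrac c D =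
      α (aevalRows c (pivotRows x y)) := by
    let M : Matrix (Fin (m + 1)) (Fin (n + 1)) Q := Matrix.of fun i s =>
      α (x i.castSucc s) / α (y i.castSucc) - α (x (Fin.last (m + 1)) s) / α (y (Fin.last (m + 1)))
    have h1 : sharpFrac c D = aevalRows c M * ∏ i, α (y i) ^ D := rfl
    have h2 : (pivotRows x y).map α = Matrix.diagonal (fun i : Fin (m + 1) => α (y (Fin.last (m + 1))) *
        α (y i.castSucc)) * M := by
      ext i s
      have h3 := hy i.castSucc
      have h4 := hy (Fin.last (m + 1))
      rw [Matrix.diagonal_mul]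
      simp only [pivotRows, M, Matrix.map_apply, Matrix.of_apply, map_sub, map_mul]
      exact mul_sub_mul_eq_mul_div_sub_div h3 h4
    rw [map_aevalRows, h2, h.aevalRows_mul, h1, Matrix.det_diagonal, Finset.prod_mul_distrib,
      Finset.prod_pow, Fin.prod_univ_castSucc, Finset.prod_const, Finset.card_univ,
      Fintype.card_fin]
    ring
  have hwf : α w = sharpFrac c D := by
    refine mul_left_cancel₀ (pow_ne_zero (m * D) (hy (Fin.last (m + 1)))) ?_
    rw [hfrac, hw, map_mul, map_pow]
  have h1 : algebraMap P Q (sharp c D) = sharpFrac c D := Function.invFun_eq ⟨w, hwf⟩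
  refine ⟨h1, ?_⟩
  rw [hα (h1.trans hwf.symm)]
  exact hw.symm

/-- The value of `c^♯` at `(x, y)`. -/
def sharpEval (c : DualPoly K m n) (D : ℕ) (x : Matrix (Fin (m + 1)) (Fin (n + 1)) S)
    (y : Fin (m + 1) → S) : S := aeval (Sum.elim (fun p => x p.1 p.2) y) (sharp c D)

lemma map_sharpEval (θ : S →ₐ[K] T) (c : DualPoly K m n) (x : Matrix (Fin (m + 1)) (Fin (n + 1)) S)
    (y : Fin (m + 1) → S) :
    θ (sharpEval c D x y) = sharpEval c D (x.map θ) (fun i => θ (y i)) := by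
  rw [sharpEval, sharpEval, ← AlgHom.comp_apply, comp_aeval]
  congr 2
  ext1 (p | i) <;> rfl

lemma eval_projForm (c : DualPoly K m n) (x : Matrix (Fin (m + 1)) (Fin (n + 1)) S)
    (y : Fin (m + 1) → S) : eval y (projForm c D x) = sharpEval c D x y := by
  change ((aeval (R := S) y).restrictScalars K) (projForm c D x) = _
  rw [projForm, sharpEval, ← AlgHom.comp_apply, comp_aeval]
  congr 2
  ext1 (p | i) <;> simp

lemma map_projForm (θ : S →ₐ[K] T) (c : DualPoly K m n)
    (x : Matrix (Fin (m + 1)) (Fin (n + 1)) S) :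
    map θ.toRingHom (projForm c D x) = projForm c D (x.map θ) := by
  rw [projForm, projForm]
  change mapAlgHom θ _ = _
  rw [← AlgHom.comp_apply, comp_aeval]
  congr 2
  ext1 (p | i) <;> simp

theorem DetEquivariant.sharpEval_pivot [Infinite K] {c : DualPoly K (m + 1) n}
    (h : DetEquivariant D c) (x : Matrix (Fin (m + 2)) (Fin (n + 1)) S) (y : Fin (m + 2) → S) :
    y (Fin.last (m + 1)) ^ (m * D) * sharpEval c D x y = aevalRows c (pivotRows x y) := by
  have := congr_arg (aeval (Sum.elim (fun p => x p.1 p.2) y)) (algebraMap_sharp h).2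
  rw [map_mul, map_pow, aeval_X, map_aevalRows] at this
  refine this.trans (congr_arg (aevalRows c) ?_)
  ext i s
  simp [pivotRows]

/-- Proved for indeterminates, where the last coordinate can be cancelled, then specialized to
points where it may vanish. -/
lemma DetEquivariant.sharpEval_smul [Infinite K] {c : DualPoly K (m + 1) n}
    (h : DetEquivariant D c) {F : Type*} [Field F] [Algebra K F] (x : Matrix (Fin (m + 2)) (Fin (n + 1)) F)
    (y : Fin (m + 2) → F) (t : F) :
    sharpEval c D x (t • y) = t ^ D * sharpEval c D x y := by
  let U := MvPolynomial (Option (Fin (m + 2) × Fin (n + 1) ⊕ Fin (m + 2))) K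
  let x' : Matrix (Fin (m + 2)) (Fin (n + 1)) U := Matrix.of fun i s => X (some (Sum.inl (i, s)))
  let y' : Fin (m + 2) → U := fun i => X (some (Sum.inr i))
  let t' : U := X none
  have aux : ∀ a b e : U, a ^ ((m + 1) * D) * (b ^ (m * D) * e) =
      (a * b) ^ (m * D) * (a ^ D * e) := fun a b e => by
    rw [mul_pow, add_mul, one_mul, pow_add, mul_assoc, mul_assoc, mul_left_comm (a ^ D)]
  have key : sharpEval c D x' (t' • y') = t' ^ D * sharpEval c D x' y' := by
    have h1 := h.sharpEval_pivot x' (t' • y')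
    rw [pivotRows_smul, h.aevalRows_smul, ← h.sharpEval_pivot x' y'] at h1
    refine mul_left_cancel₀ (pow_ne_zero (m * D)
      (mul_ne_zero (X_ne_zero none) (X_ne_zero (some (Sum.inr (Fin.last (m + 1))))))) (h1.trans ?_)
    exact aux _ _ _
  have := congr_arg (aeval (R := K) fun o => Option.elim o t (Sum.elim (fun p => x p.1 p.2) y)) key
  rw [map_mul, map_pow, map_sharpEval, map_sharpEval] at this
  have e1 : x'.map (aeval (R := K) fun o => Option.elim o t (Sum.elim (fun p => x p.1 p.2) y)) =
      x := by
    ext; simp [x']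
  simp only [Pi.smul_apply, smul_eq_mul, map_mul, e1, t', y', aeval_X, Option.elim_none,
    Option.elim_some, Sum.elim_inr] at this
  exact this

theorem projForm_isHomogeneous [Infinite K] {c : DualPoly K (m + 1) n} (h : DetEquivariant D c)
    (x : Matrix (Fin (m + 2)) (Fin (n + 1)) S) : (projForm c D x).IsHomogeneous D := by
  let F := FractionRing (LamRing K (m + 1) n)
  let α : LamRing K (m + 1) n →ₐ[K] F := IsScalarTower.toAlgHom K _ F
  have hF : Infinite F := Infinite.of_injective _ (algebraMap K F).injective
  have h1 : (projForm c D (genericLam K (m + 1) n)).IsHomogeneous D := by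
    refine IsHomogeneous.of_map (f := α.toRingHom) (IsFractionRing.injective _ F) ?_
    rw [map_projForm]
    refine isHomogeneous_of_eval_smul fun t v => ?_
    rw [eval_projForm, eval_projForm, h.sharpEval_smul]
  have h2 := h1.map (aeval (R := K) fun p : Fin (m + 2) × Fin (n + 1) => x p.1 p.2).toRingHom
  rw [map_projForm] at h2
  have h3 : (genericLam K (m + 1) n).map (aeval (R := K) fun p : Fin (m + 2) × Fin (n + 1) =>
      x p.1 p.2) = x := by
    ext i s
    simp [genericLam]
  rwa [h3] at h2

end Sharp

/-! ### Maximal minors and the identity for `c(Yλ)` -/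

section Cross

variable {R : Type*} [CommRing R] {m n : ℕ}

/-- The signed maximal minors of a matrix with one row less than columns. -/
def cross (Y : Matrix (Fin m) (Fin (m + 1)) R) (s : Fin (m + 1)) : R :=
  (-1) ^ (m + s : ℕ) * (Y.submatrix id s.succAbove).det

lemma det_snocRow (Y : Matrix (Fin m) (Fin (m + 1)) R) (v : Fin (m + 1) → R) :
    (snocRow Y v).det = ∑ s, cross Y s * v s := by
  rw [Matrix.det_succ_row _ (Fin.last m)]
  refine Finset.sum_congr rfl fun s _ => ?_
  have : (snocRow Y v).submatrix (Fin.last m).succAbove s.succAbove =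
      Y.submatrix id s.succAbove := by
    ext i j; simp
  rw [this, cross, snocRow_last, Fin.val_last]
  ring

lemma sum_cross_mul_row (Y : Matrix (Fin m) (Fin (m + 1)) R) (i : Fin m) :
    ∑ s, cross Y s * Y i s = 0 := by
  rw [← det_snocRow]
  exact Matrix.det_zero_of_row_eq (Fin.castSucc_lt_last i).ne (by simp)

lemma map_cross {R' : Type*} [CommRing R'] (θ : R →+* R') (Y : Matrix (Fin m) (Fin (m + 1)) R)
    (s : Fin (m + 1)) : θ (cross Y s) = cross (Y.map θ) s := by
  rw [cross, cross, map_mul, map_pow, map_neg, map_one, RingHom.map_det]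
  rfl

/-- Since `cross Y` is orthogonal to each row of `Y`, the terms subtracted in the pivot rows add up
to the missing contribution of the last column. -/
lemma submatrix_mul_pivotRows_cross (lam : Matrix (Fin (m + 1)) (Fin (n + 1)) R)
    (Y : Matrix (Fin m) (Fin (m + 1)) R) :
    Y.submatrix id Fin.castSucc * pivotRows lam (cross Y) = cross Y (Fin.last m) • (Y * lam) := by
  ext i s
  have h0 := sum_cross_mul_row Y i
  rw [Fin.sum_univ_castSucc] at h0
  simp only [Matrix.mul_apply, Matrix.smul_apply, smul_eq_mul, Matrix.submatrix_apply, id,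
    pivotRows, Matrix.of_apply]
  rw [Fin.sum_univ_castSucc (fun j => Y i j * lam j s)]
  have : ∑ j : Fin m, Y i j.castSucc * (cross Y (Fin.last m) * lam j.castSucc s -
      cross Y j.castSucc * lam (Fin.last m) s) =
      cross Y (Fin.last m) * ∑ j : Fin m, Y i j.castSucc * lam j.castSucc s -
      (∑ j : Fin m, cross Y j.castSucc * Y i j.castSucc) * lam (Fin.last m) s := by
    rw [Finset.mul_sum, Finset.sum_mul, ← Finset.sum_sub_distrib]
    exact Finset.sum_congr rfl fun j _ => by ring
  rw [this]
  linear_combination -(lam (Fin.last m) s) * h0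

variable {K : Type*} [Field K] {D : ℕ}

/-- Applying `c` to the previous matrix identity yields the same power of the last minor on both
sides. For indeterminate `Y` this minor is nonzero and cancels; the result specializes. -/
theorem DetEquivariant.sharpEval_cross [Infinite K] [Algebra K R] {c : DualPoly K (m + 1) n}
    (h : DetEquivariant D c) (lam : Matrix (Fin (m + 2)) (Fin (n + 1)) R)
    (Y : Matrix (Fin (m + 1)) (Fin (m + 2)) R) :
    sharpEval c D lam (cross Y) = aevalRows c (Y * lam) := by
  let U := MvPolynomial ((Fin (m + 2) × Fin (n + 1)) ⊕ (Fin (m + 1) × Fin (m + 2))) K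
  let lam' : Matrix (Fin (m + 2)) (Fin (n + 1)) U := Matrix.of fun i s => X (Sum.inl (i, s))
  let Y' : Matrix (Fin (m + 1)) (Fin (m + 2)) U := Matrix.of fun i s => X (Sum.inr (i, s))
  have hlast : cross Y' (Fin.last (m + 1)) = (Y'.submatrix id Fin.castSucc).det := by
    rw [cross, Fin.val_last, ← two_mul, pow_mul]
    simp [Fin.succAbove_last]
  have hne : cross Y' (Fin.last (m + 1)) ≠ 0 := by
    intro h0
    have := congr_arg (aeval (R := K) (Sum.elim (fun _ => (0 : K)) fun p : Fin (m + 1) × Fin (m + 2) =>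
      if p.2 = p.1.castSucc then 1 else 0)) h0
    rw [hlast, AlgHom.map_det, map_zero] at this
    have h1 : (AlgHom.mapMatrix (aeval (R := K) (Sum.elim (fun _ => (0 : K))
        fun p : Fin (m + 1) × Fin (m + 2) => if p.2 = p.1.castSucc then 1 else 0)))
        (Y'.submatrix id Fin.castSucc) = 1 := by
      ext i j
      simp [Y', Matrix.one_apply, eq_comm]
    rw [h1, Matrix.det_one] at this
    exact one_ne_zero this
  have key : sharpEval c D lam' (cross Y') = aevalRows c (Y' * lam') := by
    have hmul := submatrix_mul_pivotRows_cross lam' Y'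
    have h1 := h.aevalRows_mul (Y'.submatrix id Fin.castSucc) (pivotRows lam' (cross Y'))
    rw [hmul, h.aevalRows_smul, ← h.sharpEval_pivot, ← hlast, ← mul_assoc, ← pow_add] at h1
    rw [show (m + 1) * D = D + m * D by ring] at h1
    exact (mul_left_cancel₀ (pow_ne_zero _ hne) h1).symm
  have := congr_arg (aeval (Sum.elim (fun p : Fin (m + 2) × Fin (n + 1) => lam p.1 p.2)
    (fun p : Fin (m + 1) × Fin (m + 2) => Y p.1 p.2))) key
  rw [map_sharpEval, map_aevalRows, Matrix.map_mul] at this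
  convert this using 2
  · ext; simp [lam']
  · ext1 s
    refine Eq.trans ?_ (map_cross _ _ _).symm
    congr 1
    ext; simp [Y']
  · congr 1
    · ext; simp [Y']
    · ext; simp [lam']

end Cross

/-! ### Zeros of `P_λ` and the projection of `W` -/

section Projection

variable {K : Type*} [Field K] {k m n : ℕ} {D : ℕ}

/-- Every point is the intersection of hyperplanes. -/
lemma exists_cross_eq_smul {z : Fin (m + 1) → K} (hz : z ≠ 0) :
    ∃ (Y : Matrix (Fin m) (Fin (m + 1)) K) (u : K), u ≠ 0 ∧ cross Y = u • z ∧
      ∀ x, Y.mulVec x = 0 ↔ ∃ t : K, x = t • z := by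
  obtain ⟨j, hj⟩ : ∃ j, z j ≠ 0 := by
    by_contra! h; exact hz (funext h)
  -- The equations `z_j x_i = z_i x_j` for `i ≠ j`, where `z_j ≠ 0`; they cut out the line through
  -- `z`.
  let Y : Matrix (Fin m) (Fin (m + 1)) K := Matrix.of fun i =>
    Pi.single (j.succAbove i) (z j) - Pi.single j (z (j.succAbove i))
  have hY : ∀ i x, Y.mulVec x i = z j * x (j.succAbove i) - z (j.succAbove i) * x j := by
    intro i x
    rw [Matrix.mulVec]
    simp only [Y, Matrix.of_apply, sub_dotProduct, single_dotProduct]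
  have hker : ∀ x, Y.mulVec x = 0 ↔ ∃ t : K, x = t • z := by
    intro x
    constructor
    · intro h
      refine ⟨x j / z j, funext fun s => ?_⟩
      rw [Pi.smul_apply, smul_eq_mul, div_mul_eq_mul_div, eq_div_iff hj]
      rcases Fin.eq_self_or_eq_succAbove j s with rfl | ⟨i, rfl⟩
      · rfl
      · have := congr_fun h i
        rw [hY, Pi.zero_apply, sub_eq_zero] at this
        linear_combination this
    · rintro ⟨t, rfl⟩
      ext i
      rw [hY]
      simp only [Pi.smul_apply, smul_eq_mul, Pi.zero_apply]
      ring
  -- This determinant is `cross Y j`, so its nonvanishing excludes `u = 0`.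
  have hdet : (snocRow Y (Pi.single j 1)).det ≠ 0 := by
    intro h0
    obtain ⟨x, hx, h⟩ := Matrix.exists_mulVec_eq_zero_iff.2 h0
    obtain ⟨t, rfl⟩ := (hker x).1 (funext fun i => by
      have := congr_fun h i.castSucc
      rwa [Matrix.mulVec, snocRow_castSucc] at this)
    have := congr_fun h (Fin.last m)
    rw [Matrix.mulVec, snocRow_last, single_dotProduct, one_mul, Pi.zero_apply, Pi.smul_apply,
      smul_eq_mul, mul_eq_zero, or_iff_left hj] at this
    exact hx (by rw [this, zero_smul])
  rw [det_snocRow] at hdet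
  obtain ⟨u, hu⟩ := (hker (cross Y)).1 (funext fun i => by
    refine Eq.trans ?_ (sum_cross_mul_row Y i)
    simp only [Matrix.mulVec, dotProduct, mul_comm])
  refine ⟨Y, u, ?_, hu, hker⟩
  rintro rfl
  rw [zero_smul] at hu
  exact hdet (by simp [hu])

variable [IsAlgClosed K] {W : Set (PSpace K n)} {c : DualPoly K (m + 1) n}

/-- With `cross Y` proportional to `z`, the value at `z` is `c(Yλ)` up to a nonzero factor, and `Yλx
= 0` means that `λx` is a multiple of `z`. The multiple `0` accounts for common zeros of the forms
on `W`. -/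
theorem eval_projForm_eq_zero_iff (hW : ∀ lam : Matrix (Fin (m + 1)) (Fin (n + 1)) K,
      evalRows c lam = 0 ↔ ∃ x ∈ repSet W, lam.mulVec x = 0) (h : DetEquivariant D c)
    (lam : Matrix (Fin (m + 2)) (Fin (n + 1)) K)
    {z : Fin (m + 2) → K} (hz : z ≠ 0) :
    eval z (projForm c D lam) = 0 ↔ ∃ x ∈ repSet W, ∃ t : K, lam.mulVec x = t • z := by
  have : Infinite K := IsAlgClosed.instInfinite
  obtain ⟨Y, u, hu, hc, hker⟩ := exists_cross_eq_smul hz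
  have h1 := h.sharpEval_cross lam Y
  rw [hc, h.sharpEval_smul, aevalRows_self] at h1
  rw [eval_projForm]
  have h2 : sharpEval c D lam z = 0 ↔ evalRows c (Y * lam) = 0 := by
    rw [← h1, mul_eq_zero, or_iff_right (pow_ne_zero D hu)]
  rw [h2, hW]
  simp only [← Matrix.mulVec_mulVec, hker]

/-- The rows of a matrix may be taken in the span of linear forms without common zeros on `Z`. -/
lemma ChowLike.exists_rows_mem_span {c : DualPoly K k n} {Z : Set (Fin (n + 1) → K)}
    (h : ChowLike D c Z) (hc0 : c ≠ 0) (lam : Matrix (Fin (m + 1)) (Fin (n + 1)) K)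
    (hlam : ∀ x ∈ Z, lam.mulVec x ≠ 0) :
    ∃ Y : Matrix (Fin k) (Fin (m + 1)) K, evalRows c (Y * lam) ≠ 0 := by
  classical
  have : Infinite K := IsAlgClosed.instInfinite
  have key : ∀ s : Finset (Fin k), ∃ mu : Matrix (Fin k) (Fin (n + 1)) K, evalRows c mu ≠ 0 ∧
      ∀ i ∈ s, ∃ l, mu i = Matrix.vecMul l lam := by
    intro s
    induction s using Finset.induction_on with
    | empty =>
      obtain ⟨v, hv⟩ := exists_eval_ne_zero hc0
      exact ⟨Matrix.of fun i j => v (i, j), hv, by simp⟩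
    | insert i s hi ih =>
      obtain ⟨mu, hmu, hs⟩ := ih
      have hq0 : rowEval i mu c ≠ 0 := fun h0 => hmu <| by
        have := eval_rowEval i mu c (mu i)
        rwa [h0, map_zero, Matrix.updateRow_eq_self, eq_comm] at this
      obtain ⟨y, x, hx, hxZ⟩ := (h.split i mu _ (eval_rowEval i mu c) hq0).exists_splitting hq0
        (h.det.isHomogeneous (eval_rowEval i mu c))
      have hy : y ≠ 0 := by
        rintro rfl
        exact hq0 (by rw [hx, C_0, zero_mul])
      -- As a polynomial in row `i`, `c` is a product of linear forms given by finitely many points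
      -- of `Z`. None of these is killed by `lam`, so a general combination of the rows of `lam`
      -- misses them all.
      obtain ⟨l, hl⟩ := exists_eval_ne_zero (Finset.prod_ne_zero_iff.2 fun j (_ : j ∈ Finset.univ) =>
        (mt linForm_eq_zero.1 (hlam _ (hxZ j).1)))
      refine ⟨mu.updateRow i (Matrix.vecMul l lam), ?_, ?_⟩
      · rw [← eval_rowEval, hx, map_mul, eval_C, map_prod]
        refine mul_ne_zero hy ?_
        rw [map_prod] at hl
        refine ne_of_eq_of_ne (Finset.prod_congr rfl fun j _ => ?_) hl
        have := Matrix.dotProduct_mulVec l lam (x j)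
        rw [dotProduct_comm, dotProduct_comm (Matrix.vecMul _ _)] at this
        rw [eval_linForm, eval_linForm]
        exact this.symm
      · intro j hj
        rcases eq_or_ne j i with rfl | hji
        · exact ⟨l, Matrix.updateRow_self⟩
        · rw [Matrix.updateRow_ne hji]
          exact hs j ((Finset.mem_insert.1 hj).resolve_left hji)
  obtain ⟨mu, hmu, hs⟩ := key Finset.univ
  choose l hl using fun i => hs i (Finset.mem_univ i)
  refine ⟨Matrix.of l, ?_⟩
  convert hmu
  ext i s
  rw [hl i]
  rfl

/-- The form `P_lam` vanishes if and only if the linear forms have a common zero on `W`. -/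
theorem projForm_eq_zero_iff (hc : IsChowFormFor W c) (hc0 : c ≠ 0) (h : DetEquivariant D c)
    (hZ : ChowLike D c (repSet W)) (lam : Matrix (Fin (m + 2)) (Fin (n + 1)) K) :
    projForm c D lam = 0 ↔ MeetsForms W lam := by
  have : Infinite K := IsAlgClosed.instInfinite
  rw [meetsForms_iff]
  constructor
  · intro h0
    by_contra! hcon
    obtain ⟨Y, hY⟩ := hZ.exists_rows_mem_span hc0 lam hcon
    rw [← aevalRows_self, ← h.sharpEval_cross, ← eval_projForm, h0, map_zero] at hY
    exact hY rfl
  · rintro ⟨x, hx, hlam⟩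
    -- The factor `X 0` disposes of the origin, to which the criterion for zeros does not apply.
    have h1 : X 0 * projForm c D lam = 0 := by
      refine MvPolynomial.funext fun z => ?_
      rw [map_mul, map_zero, mul_eq_zero]
      rcases eq_or_ne z 0 with rfl | hz
      · left; simp
      · right
        exact (eval_projForm_eq_zero_iff hc.evalRows_eq_zero_iff h lam hz).2
          ⟨x, hx, 0, by rw [hlam, zero_smul]⟩
    exact (mul_eq_zero.1 h1).resolve_left (X_ne_zero 0)

/-- The zero set of `P_lam` is the projection of `W`, if the linear forms have no common zero on `W`. -/
theorem zeros_projForm (hc : IsChowFormFor W c) (h : DetEquivariant D c)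
    (lam : Matrix (Fin (m + 2)) (Fin (n + 1)) K) (hlam : ¬ MeetsForms W lam) :
    {q : PSpace K (m + 1) | eval q.rep (projForm c D lam) = 0} = projImage lam W := by
  rw [meetsForms_iff] at hlam
  push Not at hlam
  ext q
  simp only [Set.mem_ofPred_eq, projImage]
  rw [eval_projForm_eq_zero_iff hc.evalRows_eq_zero_iff h lam q.rep_nonzero]
  constructor
  · rintro ⟨_, ⟨p, hp, rfl⟩, t, ht⟩
    refine ⟨p, hp, hlam _ ⟨p, hp, rfl⟩, ?_⟩
    rw [← q.mk_rep]
    exact (Projectivization.mk_eq_mk_iff' _ _ _ _ _).2 ⟨t, ht.symm⟩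
  · rintro ⟨p, hp, h0, hq⟩
    refine ⟨p.rep, ⟨p, hp, rfl⟩, ?_⟩
    rw [← q.mk_rep] at hq
    obtain ⟨t, ht⟩ := (Projectivization.mk_eq_mk_iff' _ _ _ _ _).1 hq
    exact ⟨t, ht.symm⟩

end Projection

/-! ### The projection formula -/

section FormWedge

variable {K : Type*} [Field K] {m n : ℕ} {D : ℕ}

lemma lastGroup_detForm {R : Type*} [CommRing R] (m : ℕ) :
    lastGroup (detForm R m) =
      linForm (cross (Matrix.of fun i s => (X (i, s) : DualPoly R m m))) := by
  rw [← lastGroupHom_apply, detForm, RingHom.map_det]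
  have : (lastGroupHom R m m).mapMatrix (Matrix.mvPolynomialX (Fin (m + 1)) (Fin (m + 1)) R) =
      snocRow ((Matrix.of fun i s => (X (i, s) : DualPoly R m m)).map C) X := by
    ext i s : 2
    induction i using Fin.lastCases with
    | last => simp [lastGroupHom_apply]
    | cast i => simp [lastGroupHom_apply]
  rw [this, det_snocRow, linForm]
  simp only [map_cross]

theorem eval_cross_projForm [Infinite K] {c : DualPoly K (m + 1) n} (h : DetEquivariant D c)
    {R : Type*} [CommRing R] [Algebra K R] (lam : Matrix (Fin (m + 2)) (Fin (n + 1)) R) :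
    eval (cross (Matrix.of fun i s => (X (i, s) : DualPoly R (m + 1) (m + 1))))
        (map C (projForm c D lam)) =
      substRows (algebraMap K R) lam (m + 1) c := by
  have := map_projForm (D := D) (IsScalarTower.toAlgHom K R (DualPoly R (m + 1) (m + 1))) c lam
  change map C (projForm c D lam) = _ at this
  rw [this, eval_projForm, h.sharpEval_cross]
  rfl

/-- In its last row the determinant is the single linear form with coefficients `cross Y`, so the
wedge is `P_λ(cross Y)`, that is, `c(Yλ)`. -/
theorem isWedge_detForm [Infinite K] {c : DualPoly K (m + 1) n} (h : DetEquivariant D c)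
    {R : Type*} [CommRing R] [IsDomain R] [Algebra K R]
    (lam : Matrix (Fin (m + 2)) (Fin (n + 1)) R) :
    IsWedge D 1 (map C (projForm c D lam)) (lastGroup (detForm R (m + 1)))
      (substRows (RingHom.id R) lam (m + 1) (map (algebraMap K R) c)) := by
  let A := DualPoly R (m + 1) (m + 1)
  let Y : Matrix (Fin (m + 1)) (Fin (m + 2)) A := Matrix.of fun i s => X (i, s)
  refine ⟨1, fun _ s => algebraMap A (FracClosure A) (cross Y s), ?_, ?_⟩
  · rw [SplitsAs, lastGroup_detForm, map_linForm]
    simp only [C_1, one_mul, Finset.univ_unique, Finset.prod_singleton]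
    rfl
  · rw [substRows_map, RingHom.id_comp, ← eval_cross_projForm h, one_pow, one_mul,
      Fin.prod_univ_one]
    exact eval₂_comp (algebraMap A (FracClosure A)) (cross Y) _

/-- The projection formula `f ∧ P_lam = (f ∘ lam) ∧ c`. -/
theorem formWedge_projForm [IsAlgClosed K] {c : DualPoly K (m + 1) n} {Z : Set (Fin (n + 1) → K)}
    (h : ChowLike D c Z) (hZ : ∀ p ∈ Z, p ≠ 0)
    {R : Type*} [CommRing R] [IsDomain R] [Algebra K R]
    (lam : Matrix (Fin (m + 2)) (Fin (n + 1)) R) (d : Fin (m + 1) → ℕ)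
    (f : Fin (m + 1) → MvPolynomial (Fin (m + 2)) R) (hf : ∀ i, (f i).IsHomogeneous (d i)) :
    FormWedgeDefined d D f (projForm c D lam) ∧
      IterWedgeDefined (m + 1) d D (fun i => compForms (f i) lam) (map (algebraMap K R) c) ∧
      formWedge d D f (projForm c D lam) =
        iterWedge (m + 1) d D (fun i => compForms (f i) lam) (map (algebraMap K R) c) := by
  have : Infinite K := IsAlgClosed.instInfinite
  have hdef : IterWedgeDefined (m + 1) d D (fun i => compForms (f i) lam)
      (map (algebraMap K R) c) :=
    h.iterWedgeDefined hZ fun i => compForms_isHomogeneous (hf i) lam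
  have hw := isWedge_detForm h.det lam
  have hP : (map C (projForm c D lam) :
      MvPolynomial (Fin (m + 2)) (DualPoly R (m + 1) (m + 1))).IsHomogeneous D :=
    (projForm_isHomogeneous h.det lam).map C
  obtain ⟨h1, h2⟩ := iterWedge_substRows (θ := RingHom.id R) (Λ := lam) (f' := f) d D
    (fun i => compForms_isHomogeneous (hf i) lam) hf (fun i => (map_id _).symm) hdef
  refine ⟨?_, hdef, ?_⟩
  · rw [FormWedgeDefined, IterWedgeDefined]
    simp only [Fin.snoc_last, Fin.snoc_castSucc, wedgeLast]
    rw [hw.wedge_eq hP, mul_one]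
    exact ⟨hw.existsUnique hP, h1⟩
  · rw [formWedge, iterWedge]
    simp only [Fin.snoc_last, Fin.snoc_castSucc, wedgeLast]
    rw [hw.wedge_eq hP, mul_one]
    exact h2

end FormWedge

/-! ### Irreducibility of `c(Yλ)` -/

section Irreducible

variable {K : Type*} [Field K] {k n : ℕ} {D : ℕ}

variable (K k n) in
/-- The indeterminate matrix `Y`. -/
def genericLeft : Matrix (Fin k) (Fin (k + 1))
    (MvPolynomial ((Fin k × Fin (k + 1)) ⊕ (Fin (k + 1) × Fin (n + 1))) K) :=
  Matrix.of fun i j => X (Sum.inl (i, j))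

variable (K k n) in
/-- The indeterminate matrix `λ`. -/
def genericRight : Matrix (Fin (k + 1)) (Fin (n + 1))
    (MvPolynomial ((Fin k × Fin (k + 1)) ⊕ (Fin (k + 1) × Fin (n + 1))) K) :=
  Matrix.of fun i j => X (Sum.inr (i, j))

/-- The polynomial `c(Y λ)` in indeterminate matrices `Y` and `λ`. -/
def genericProduct (c : DualPoly K k n) :
    MvPolynomial ((Fin k × Fin (k + 1)) ⊕ (Fin (k + 1) × Fin (n + 1))) K :=
  aevalRows c (genericLeft K k n * genericRight K k n)

/-- The point of the space of pairs of matrices defined by `Y` and `lam`. -/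
def pairPoint {R : Type*} (Y : Matrix (Fin k) (Fin (k + 1)) R)
    (lam : Matrix (Fin (k + 1)) (Fin (n + 1)) R) :
    (Fin k × Fin (k + 1)) ⊕ (Fin (k + 1) × Fin (n + 1)) → R :=
  Sum.elim (fun p => Y p.1 p.2) fun p => lam p.1 p.2

lemma exists_pairPoint {R : Type*} (v : (Fin k × Fin (k + 1)) ⊕ (Fin (k + 1) × Fin (n + 1)) → R) :
    ∃ Y lam, v = pairPoint Y lam :=
  ⟨Matrix.of fun i j => v (Sum.inl (i, j)), Matrix.of fun i j => v (Sum.inr (i, j)), by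
    ext (p | p) <;> rfl⟩

lemma aeval_genericProduct {S : Type*} [CommRing S] [Algebra K S] (c : DualPoly K k n)
    (Y : Matrix (Fin k) (Fin (k + 1)) S) (lam : Matrix (Fin (k + 1)) (Fin (n + 1)) S) :
    aeval (pairPoint Y lam) (genericProduct c) = aevalRows c (Y * lam) := by
  rw [genericProduct, map_aevalRows, Matrix.map_mul]
  congr 2
  · ext; simp [pairPoint, genericLeft]
  · ext; simp [pairPoint, genericRight]

lemma eval_genericProduct (c : DualPoly K k n) (Y : Matrix (Fin k) (Fin (k + 1)) K)
    (lam : Matrix (Fin (k + 1)) (Fin (n + 1)) K) :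
    eval (pairPoint Y lam) (genericProduct c) = evalRows c (Y * lam) := by
  rw [← aevalRows_self, ← aeval_genericProduct]
  rfl

lemma eval_aeval {R σ τ : Type*} [CommSemiring R] (v : τ → R) (g : σ → MvPolynomial τ R)
    (p : MvPolynomial σ R) : eval v (aeval g p) = eval (fun s => eval v (g s)) p := by
  rw [← coe_aeval_eq_eval, ← coe_aeval_eq_eval, RingHom.coe_coe, RingHom.coe_coe,
    ← AlgHom.comp_apply, comp_aeval]

/-- The matrix `(I | 0)`. -/
def idZero (R : Type*) [CommRing R] (k : ℕ) : Matrix (Fin k) (Fin (k + 1)) R :=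
  (1 : Matrix (Fin (k + 1)) (Fin (k + 1)) R).submatrix Fin.castSucc id

lemma idZero_mul {R : Type*} [CommRing R] {l : ℕ} (lam : Matrix (Fin (k + 1)) (Fin l) R) :
    idZero R k * lam = lam.submatrix Fin.castSucc id := by
  ext i j
  simp [idZero, Matrix.mul_apply, Matrix.one_apply]

variable [IsAlgClosed K] {c : DualPoly K k n}

lemma genericProduct_ne_zero (hc0 : c ≠ 0) : genericProduct c ≠ 0 := by
  have : Infinite K := IsAlgClosed.instInfinite
  obtain ⟨v, hv⟩ := exists_eval_ne_zero hc0
  intro h0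
  have := eval_genericProduct c (idZero K k) (snocRow (Matrix.of fun i j => v (i, j)) 0)
  rw [h0, map_zero, idZero_mul] at this
  refine hv (Eq.trans ?_ this.symm)
  rw [evalRows]
  congr 2
  ext p
  simp

/-- A factor of `c(Y λ)` which does not vanish at `((I | 0), 0)` does not depend on `λ`. -/
lemma factor_eval_eq_zero_right (h : DetEquivariant D c) (hc0 : c ≠ 0)
    {A B : MvPolynomial ((Fin k × Fin (k + 1)) ⊕ (Fin (k + 1) × Fin (n + 1))) K}
    (hAB : A * B = genericProduct c) {Y₀ : Matrix (Fin k) (Fin (k + 1)) K}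
    (hA : eval (pairPoint Y₀ 0) A ≠ 0) (Y : Matrix (Fin k) (Fin (k + 1)) K)
    (lam : Matrix (Fin (k + 1)) (Fin (n + 1)) K) :
    eval (pairPoint Y lam) A = eval (pairPoint Y 0) A := by
  have : Infinite K := IsAlgClosed.instInfinite
  let A₀ : MvPolynomial ((Fin k × Fin (k + 1)) ⊕ (Fin (k + 1) × Fin (n + 1))) K :=
    aeval (Sum.elim (fun p => X (Sum.inl p)) 0) A
  have hA₀ : ∀ Y lam, eval (pairPoint Y lam) A₀ = eval (pairPoint Y 0) A := by
    intro Y lam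
    rw [eval_aeval]
    congr 2
    ext (p | p) <;> simp [pairPoint]
  have hne : A₀ ≠ 0 := fun h0 => hA (by rw [← hA₀ Y₀ 0, h0, map_zero])
  have key : genericProduct c * A₀ * (A - A₀) = 0 := by
    refine MvPolynomial.funext fun v => ?_
    obtain ⟨Y, lam, rfl⟩ := exists_pairPoint v
    rw [map_mul, map_zero, mul_eq_zero, or_iff_not_imp_left, map_mul, mul_eq_zero, not_or,
      map_sub, hA₀, sub_eq_zero, eval_genericProduct]
    rintro ⟨h1, h2⟩
    -- On the line through `(Y, 0)` and `(Y, lam)` the product `A * B` is a power of `t` times a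
    -- nonzero constant, so `A` can vanish only at `t = 0`, where it does not.
    have hline : ∀ t : K, pairPoint Y (t • lam) = pairPoint Y 0 + t • pairPoint 0 lam := by
      intro t
      ext (p | p) <;> simp [pairPoint]
    rw [← one_smul K lam, hline, one_smul]
    refine eval_add_eq_of_ne_zero fun t ht => ?_
    rcases eq_or_ne t 0 with rfl | ht0
    · rw [zero_smul, add_zero] at ht
      exact h2 ht
    · rw [← hline] at ht
      have h3 := eval_genericProduct c Y (t • lam)
      rw [← hAB, map_mul, ht, zero_mul, Matrix.mul_smul, ← aevalRows_self, h.aevalRows_smul,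
        aevalRows_self] at h3
      exact mul_ne_zero (pow_ne_zero _ ht0) h1 h3.symm
  have h1 := (mul_eq_zero.1 key).resolve_left (mul_ne_zero (genericProduct_ne_zero hc0) hne)
  rw [← hA₀ Y lam, ← sub_eq_zero, ← map_sub, h1, map_zero]

/-- A factor of `c(Y λ)` which does not depend on `λ` does not depend on the columns of `Y`. -/
lemma factor_eval_updateCol (hc0 : c ≠ 0)
    {A B : MvPolynomial ((Fin k × Fin (k + 1)) ⊕ (Fin (k + 1) × Fin (n + 1))) K}
    (hAB : A * B = genericProduct c)
    (hA : ∀ Y lam, eval (pairPoint Y lam) A = eval (pairPoint Y 0) A)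
    (Y : Matrix (Fin k) (Fin (k + 1)) K) (j : Fin (k + 1)) :
    eval (pairPoint (Y.updateCol j 0) 0) A = eval (pairPoint Y 0) A := by
  have : Infinite K := IsAlgClosed.instInfinite
  -- If the other columns of `Y` are independent, then `Y lam` can be any matrix, in particular one
  -- at which `c` is nonzero; hence the factor `A` is nonzero at `Y`.
  have hne : ∀ Y : Matrix (Fin k) (Fin (k + 1)) K, (Y.submatrix id j.succAbove).det ≠ 0 →
      eval (pairPoint Y 0) A ≠ 0 := by
    intro Y hY h0
    obtain ⟨v, hv⟩ := exists_eval_ne_zero hc0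
    let mu : Matrix (Fin k) (Fin (n + 1)) K := Matrix.of fun i s => v (i, s)
    let lam : Matrix (Fin (k + 1)) (Fin (n + 1)) K :=
      Matrix.of (j.insertNth (α := fun _ => Fin (n + 1) → K) 0
        ((Y.submatrix id j.succAbove)⁻¹ * mu))
    have hmul : Y * lam = mu := by
      have : Y * lam = Y.submatrix id j.succAbove * ((Y.submatrix id j.succAbove)⁻¹ * mu) := by
        ext i s
        have e1 : lam j = 0 := Fin.insertNth_apply_same (α := fun _ => Fin (n + 1) → K) _ _ _
        have e2 : ∀ i, lam (j.succAbove i) = ((Y.submatrix id j.succAbove)⁻¹ * mu) i :=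
          Fin.insertNth_apply_succAbove (α := fun _ => Fin (n + 1) → K) _ _ _
        rw [Matrix.mul_apply, Fin.sum_univ_succAbove _ j, Matrix.mul_apply]
        simp only [e1, e2, Pi.zero_apply, mul_zero, zero_add]
        rfl
      rw [this, Matrix.mul_nonsing_inv_cancel_left _ _ (isUnit_iff_ne_zero.2 hY)]
    have h1 := eval_genericProduct c Y lam
    rw [← hAB, map_mul, hA, h0, zero_mul, hmul] at h1
    exact hv h1.symm
  let Q := MvPolynomial (Fin k × Fin (k + 1)) K
  let Y' : Matrix (Fin k) (Fin (k + 1)) Q := Matrix.of fun i j => X (i, j)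
  let A₀ : Q := aeval (pairPoint Y' 0) A
  let A₁ : Q := aeval (pairPoint (Y'.updateCol j 0) 0) A
  have hA₀ : ∀ Y : Matrix (Fin k) (Fin (k + 1)) K,
      eval (fun p => Y p.1 p.2) A₀ = eval (pairPoint Y 0) A := by
    intro Y
    rw [eval_aeval]
    congr 2
    ext (p | p) <;> simp [pairPoint, Y']
  have hA₁ : ∀ Y : Matrix (Fin k) (Fin (k + 1)) K,
      eval (fun p => Y p.1 p.2) A₁ = eval (pairPoint (Y.updateCol j 0) 0) A := by
    intro Y
    rw [eval_aeval]
    congr 2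
    ext (p | p)
    · simp only [pairPoint, Y', Sum.elim_inl, Matrix.updateCol_apply]
      split_ifs <;> simp
    · simp [pairPoint]
  have hdet : ∀ Y : Matrix (Fin k) (Fin (k + 1)) K,
      eval (fun p => Y p.1 p.2) (Y'.submatrix id j.succAbove).det =
        (Y.submatrix id j.succAbove).det := by
    intro Y
    rw [RingHom.map_det]
    congr 1
    ext; simp [Y']
  have hdet0 : (Y'.submatrix id j.succAbove).det ≠ 0 := by
    intro h0
    have := hdet (Matrix.of fun i => j.insertNth (α := fun _ => K) 0
      ((1 : Matrix (Fin k) (Fin k) K) i))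
    rw [h0, map_zero] at this
    have h1 : (Matrix.of fun i => j.insertNth (α := fun _ => K) 0
      ((1 : Matrix (Fin k) (Fin k) K) i)).submatrix id j.succAbove = 1 := by
      ext; simp
    rw [h1, Matrix.det_one] at this
    exact zero_ne_one this
  have key : (Y'.submatrix id j.succAbove).det * (A₁ - A₀) = 0 := by
    refine MvPolynomial.funext fun v => ?_
    obtain ⟨Y, rfl⟩ : ∃ Y : Matrix (Fin k) (Fin (k + 1)) K, v = fun p => Y p.1 p.2 :=
      ⟨Matrix.of fun i j => v (i, j), rfl⟩
    rw [map_mul, map_zero, mul_eq_zero, or_iff_not_imp_left, hdet, map_sub, hA₀, hA₁, sub_eq_zero]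
    intro hY
    -- Rescaling column `j` does not affect the minor without it, so `A` has no zeros on this line
    -- and is constant along it.
    have hline : ∀ t : K, pairPoint (n := n) (Y.updateCol j (t • fun i => Y i j)) 0 =
        pairPoint (Y.updateCol j 0) 0 +
          t • pairPoint ((0 : Matrix (Fin k) (Fin (k + 1)) K).updateCol j fun i => Y i j) 0 := by
      intro t
      ext (p | p)
      · simp only [pairPoint, Sum.elim_inl, Pi.add_apply, Pi.smul_apply, Matrix.updateCol_apply]
        split_ifs <;> simp
      · simp [pairPoint]
    have h1 := hline 1
    rw [one_smul, one_smul, Matrix.updateCol_eq_self] at h1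
    rw [h1]
    refine (eval_add_eq_of_ne_zero fun t => ?_).symm
    rw [← hline]
    refine hne _ ?_
    convert hY using 2
    ext i l
    simp [Fin.succAbove_ne]
  have h1 := (mul_eq_zero.1 key).resolve_left hdet0
  rw [← hA₀ Y, ← hA₁ Y, ← sub_eq_zero, ← map_sub, h1, map_zero]

/-- `A` does not depend on `λ`, and the columns of `Y` can be replaced by zero one after another. -/
lemma factor_isUnit (h : DetEquivariant D c) (hc0 : c ≠ 0)
    {A B : MvPolynomial ((Fin k × Fin (k + 1)) ⊕ (Fin (k + 1) × Fin (n + 1))) K}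
    (hAB : A * B = genericProduct c) {Y₀ : Matrix (Fin k) (Fin (k + 1)) K}
    (hA : eval (pairPoint Y₀ 0) A ≠ 0) : IsUnit A := by
  classical
  have : Infinite K := IsAlgClosed.instInfinite
  have h1 := factor_eval_eq_zero_right h hc0 hAB hA
  have h2 : ∀ (s : Finset (Fin (k + 1))) (Y : Matrix (Fin k) (Fin (k + 1)) K),
      eval (pairPoint (Matrix.of fun i j => if j ∈ s then 0 else Y i j) 0) A =
        eval (pairPoint Y 0) A := by
    intro s Y
    induction s using Finset.induction_on with
    | empty => simp; rfl
    | insert j s hj ih =>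
      rw [← ih, ← factor_eval_updateCol hc0 hAB h1 (Matrix.of fun i j => if j ∈ s then 0 else Y i j) j]
      congr 3
      ext i l
      rw [Matrix.updateCol_apply]
      by_cases hl : l = j <;> simp [hl]
  have h3 : ∀ Y : Matrix (Fin k) (Fin (k + 1)) K,
      eval (pairPoint Y 0) A = eval (pairPoint 0 0) A := by
    intro Y
    rw [← h2 Finset.univ]
    simp
    rfl
  rw [h3] at hA
  have : A = C (eval (pairPoint 0 0) A) := eq_C_of_forall_eval_eq fun v => by
    obtain ⟨Y, lam, rfl⟩ := exists_pairPoint v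
    rw [h1, h3]
  rw [this]
  exact (isUnit_iff_ne_zero.2 hA).map C

/-- The value of an irreducible determinant-equivariant polynomial at a product of two indeterminate
matrices is irreducible. -/
theorem genericProduct_irreducible (h : DetEquivariant D c) (hc : Irreducible c) :
    Irreducible (genericProduct c) := by
  have : Infinite K := IsAlgClosed.instInfinite
  let lam : Matrix (Fin (k + 1)) (Fin (n + 1)) (DualPoly K k n) :=
    snocRow (Matrix.of fun i s => X (i, s)) 0
  -- This specialization sends `c(Yλ)` to `c`, so it sends one of two factors to a unit. Evaluating
  -- that unit at the origin shows that the factor is nonzero at a point with `λ = 0`.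
  let θ := aeval (R := K) (pairPoint (idZero (DualPoly K k n) k) lam)
  have hθ : θ (genericProduct c) = c := by
    rw [aeval_genericProduct, idZero_mul, aevalRows]
    have : (fun p : Fin k × Fin (n + 1) => lam.submatrix Fin.castSucc id p.1 p.2) = X := by
      ext1 p; simp [lam]
    rw [this, aeval_X_left_apply]
  have hfac : ∀ A B, A * B = genericProduct c → IsUnit (θ A) → IsUnit A := by
    intro A B hAB hu
    refine factor_isUnit h hc.ne_zero hAB (Y₀ := idZero K k) ?_
    have h1 := hu.map (eval (0 : Fin k × Fin (n + 1) → K))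
    rw [eval_aeval] at h1
    convert h1.ne_zero using 4 with q
    rcases q with p | ⟨i, s⟩
    · simp [pairPoint, idZero, Matrix.one_apply, apply_ite]
    · induction i using Fin.lastCases <;> simp [pairPoint, lam]
  refine ⟨fun hu => hc.not_isUnit (hθ ▸ hu.map θ), fun A B hAB => ?_⟩
  have h1 : c = θ A * θ B := by rw [← map_mul, ← hAB, hθ]
  rcases hc.isUnit_or_isUnit h1 with hu | hu
  · exact Or.inl (hfac A B hAB.symm hu)
  · exact Or.inr (hfac B A (by rw [mul_comm, ← hAB]) hu)

/-- `c(Y λ)`, for indeterminate `λ`, is irreducible as a polynomial in the rows of `Y`. -/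
theorem substRows_genericLam_irreducible (h : DetEquivariant D c) (hc : Irreducible c) :
    Irreducible (substRows (algebraMap K (LamRing K k n)) (genericLam K k n) k c) := by
  let e := sumAlgEquiv K (Fin k × Fin (k + 1)) (Fin (k + 1) × Fin (n + 1))
  have : e (genericProduct c) = substRows (algebraMap K (LamRing K k n)) (genericLam K k n) k c := by
    have := map_aevalRows e.toAlgHom c (genericLeft K k n * genericRight K k n)
    refine this.trans ?_
    rw [aevalRows, aeval_def]
    change eval₂ _ _ c = eval₂ _ _ c
    congr 1
    ext1 p
    simp [e, genericLam, genericLeft, genericRight, Matrix.mul_apply]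
  rw [← this]
  exact (MulEquiv.irreducible_iff e).2 (genericProduct_irreducible h hc)

end Irreducible

/-! ### Irreducibility of `P_λ` -/

section ProjForm

variable {K : Type*} [Field K] {m n : ℕ} {D : ℕ} {c : DualPoly K (m + 1) n}

lemma exists_cross_eq {z : Fin (m + 2) → K} (hz : z ≠ 0) :
    ∃ Y : Matrix (Fin (m + 1)) (Fin (m + 2)) K, cross Y = z := by
  obtain ⟨Y, u, hu, hc, -⟩ := exists_cross_eq_smul hz
  refine ⟨Y.updateRow 0 (u⁻¹ • Y 0), funext fun s => ?_⟩
  have : (Y.updateRow 0 (u⁻¹ • Y 0)).submatrix id s.succAbove =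
      (Y.submatrix id s.succAbove).updateRow 0 (u⁻¹ • (Y.submatrix id s.succAbove) 0) := by
    ext i j
    simp only [Matrix.submatrix_apply, Matrix.updateRow_apply]
    rfl
  have h1 := congr_fun hc s
  rw [cross, Pi.smul_apply, smul_eq_mul] at h1
  rw [cross, this, Matrix.det_updateRow_smul, Matrix.updateRow_eq_self, mul_left_comm, h1,
    inv_mul_cancel_left₀ hu]

/-- A polynomial is constant if its composition with `cross` is. -/
lemma eq_C_of_eval_cross_eq [Infinite K] {τ : Type*} {A : MvPolynomial (Fin (m + 2)) (MvPolynomial τ K)}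
    {a : MvPolynomial τ K}
    (h : eval (cross (Matrix.of fun i j => X (i, j))) (map C A) =
      (C a : DualPoly (MvPolynomial τ K) (m + 1) (m + 1))) : A = C a := by
  -- Every nonzero vector is of the form `cross Y`, so all values of `A` away from the origin are
  -- known.
  have hz : ∀ z : Fin (m + 2) → K, z ≠ 0 → ∀ t, eval z (map (eval t) A) = eval t a := by
    intro z hz t
    obtain ⟨Y, rfl⟩ := exists_cross_eq hz
    have := congr_arg (rowHom (eval t) Y) h
    rw [rowHom_C, eval₂_comp, eval₂_map, rowHom_comp_C] at this
    rw [← this, eval_map]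
    congr 1
    ext1 s
    rw [Function.comp_apply, map_cross]
    congr 1
    ext; simp
  have h0 : ∀ t, X 0 * (map (eval t) A - C (eval t a)) = 0 := fun t =>
    MvPolynomial.funext fun z => by
      rw [map_mul, map_zero, mul_eq_zero, map_sub, eval_C, sub_eq_zero]
      rcases eq_or_ne z 0 with rfl | h0
      · left; simp
      · exact Or.inr (hz z h0 t)
  ext b : 1
  refine MvPolynomial.funext fun t => ?_
  have := congr_arg (coeff b) (sub_eq_zero.1 ((mul_eq_zero.1 (h0 t)).resolve_left (X_ne_zero 0)))
  rw [coeff_map] at this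
  rw [this, ← coeff_map, map_C]

/-- The projected form `P_lam` is irreducible, for indeterminate `lam`. -/
theorem projForm_irreducible [IsAlgClosed K] (h : DetEquivariant D c) (hc : Irreducible c) :
    Irreducible (projForm c D (genericLam K (m + 1) n)) := by
  have : Infinite K := IsAlgClosed.instInfinite
  let R := LamRing K (m + 1) n
  let θ : MvPolynomial (Fin (m + 2)) R →+* DualPoly R (m + 1) (m + 1) :=
    (eval (cross (Matrix.of fun i j => X (i, j)))).comp (map C)
  have hθ : θ (projForm c D (genericLam K (m + 1) n)) =
      substRows (algebraMap K R) (genericLam K (m + 1) n) (m + 1) c :=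
    eval_cross_projForm h _
  have hirr := substRows_genericLam_irreducible h hc
  rw [← hθ] at hirr
  have hfac : ∀ A, IsUnit (θ A) → IsUnit A := by
    intro A hA
    obtain ⟨a, ha, hAa⟩ := isUnit_iff_eq_C_of_isReduced.1 hA
    rw [eq_C_of_eval_cross_eq hAa]
    exact ha.map C
  exact ⟨fun hu => hirr.not_isUnit (hu.map θ), fun A B hAB =>
    (hirr.isUnit_or_isUnit (by rw [hAB, map_mul])).imp (hfac A) (hfac B)⟩

end ProjForm

/-! ### Values of the generic form -/

section GenericForm

variable {M Ω B : Type*} [CommRing M] [CommRing Ω] [CommRing B] {m d D : ℕ}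

lemma eval₂_formOfCoeffs (φ : M →+* B) (v : Expo m d → M) (x : Fin (m + 1) → B) :
    eval₂ φ x (formOfCoeffs m d v) = ∑ a, φ (v a) * ∏ s, x s ^ a.1 s := by
  simp [formOfCoeffs, eval₂_sum, eval₂_monomial, Finsupp.prod_pow]

/-- The value of the generic form of degree `d` at `x`. -/
def genericValue (d : ℕ) (x : Fin (m + 1) → Ω) : MvPolynomial (Expo m d) Ω :=
  ∑ a, X a * C (∏ s, x s ^ a.1 s)

lemma eval₂_genericValue (κ : Ω →+* B) {G : MvPolynomial (Fin (m + 1)) B} (hG : G.IsHomogeneous d)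
    (x : Fin (m + 1) → Ω) :
    eval₂ κ (fun a : Expo m d => coeff a.1 G) (genericValue d x) = eval (fun s => κ (x s)) G := by
  conv_rhs => rw [← formOfCoeffs_coeff hG, ← eval₂_id, eval₂_formOfCoeffs]
  simp [genericValue, eval₂_sum, eval₂_mul]

lemma coeff_genericValue (x : Fin (m + 1) → Ω) (a : Expo m d) :
    coeff (Finsupp.single a 1) (genericValue d x) = ∏ s, x s ^ a.1 s := by
  simp only [genericValue, coeff_sum, mul_comm (X _) (C _), coeff_C_mul, coeff_X,
    Finsupp.single_left_inj one_ne_zero]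
  simp

lemma genericValue_isHomogeneous (x : Fin (m + 1) → Ω) : (genericValue d x).IsHomogeneous 1 := by
  refine IsHomogeneous.sum _ _ _ fun a _ => ?_
  simpa using (isHomogeneous_X Ω a).mul (isHomogeneous_C (Expo m d) (∏ s, x s ^ a.1 s))

/-- It is linear in the coefficients, and that of the pure power of a variable with `x_s ≠ 0` is
multiplied by `x_s ^ d`. -/
lemma genericValue_prime {F : Type*} [Field F] {x : Fin (m + 1) → F} (hx : x ≠ 0) :
    Prime (genericValue d x) := by
  obtain ⟨s, hs⟩ : ∃ s, x s ≠ 0 := by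
    by_contra! h; exact hx (funext h)
  let a : Expo m d := ⟨Finsupp.single s d, by
    rw [Finset.mem_finsuppAntidiag, ← Finsupp.degree_eq_sum]; simp⟩
  have ha : coeff (Finsupp.single a 1) (genericValue d x) ≠ 0 := by
    rw [coeff_genericValue, Finset.prod_eq_single s]
    · simpa [a] using pow_ne_zero d hs
    · intro t _ ht
      simp [a, Finsupp.single_eq_of_ne ht]
    · simp
  have h0 : genericValue d x ≠ 0 := ne_zero_iff.2 ⟨_, ha⟩
  refine (irreducible_of_totalDegree_eq_one ((genericValue_isHomogeneous x).totalDegree h0) ?_).prime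
  intro c hc
  refine isUnit_iff_ne_zero.2 fun hc0 => ha ?_
  simpa [hc0] using hc (Finsupp.single a 1)

end GenericForm

/-! ### Wedging with one generic form preserves irreducibility -/

section Step

variable {M Ω : Type*} [CommRing M] [Field Ω] {α : M →+* Ω} {m d D : ℕ}

/-- The wedge of a generic form with `g` is the product of its values at the factors of `g`. -/
lemma HasWedge.exists_genericValue [IsAlgClosed Ω] (α : M →+* Ω) {Ω₁ Ω₂ : Type*} [Field Ω₁]
    [Field Ω₂] [IsAlgClosed Ω₂] {j : MvPolynomial (Expo m d) Ω →+* Ω₂}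
    (hj : Function.Injective j) {φ : MvPolynomial (Expo m d) M →+* Ω₁}
    (hφ : Function.Injective φ) {g : MvPolynomial (Fin (m + 1)) M}
    {w : MvPolynomial (Expo m d) M} (hw : HasWedge φ d D (formOfCoeffs m d X) (map C g) w) :
    ∃ (y : Ω) (x : Fin D → Fin (m + 1) → Ω), map α g = C y * ∏ i, linForm (x i) ∧
      map α w = C (y ^ d) * ∏ i, genericValue d (x i) := by
  have hF : (formOfCoeffs m d (X : Expo m d → MvPolynomial (Expo m d) M)).IsHomogeneous d :=
    formOfCoeffs_isHomogeneous m d _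
  -- As `g` does not involve the coefficients of the generic form, setting these to zero gives a
  -- splitting of `g` over `Ω` itself. Its image over `Ω₂` may be used to compute `w`.
  obtain ⟨y, x, h1, -⟩ := HasWedge.specialize hφ (α.comp constantCoeff) hF hw
  have hc : (α.comp constantCoeff).comp (C : M →+* MvPolynomial (Expo m d) M) = α := by
    ext; simp
  rw [map_map, hc] at h1
  refine ⟨y, x, h1, hj ?_⟩
  obtain ⟨y', x', h1', h2'⟩ := HasWedge.specialize hφ (j.comp (map α)) hF hw
  have hcomp : (j.comp (map α)).comp (C : M →+* MvPolynomial (Expo m d) M) = (j.comp C).comp α := by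
    ext a
    simp only [RingHom.comp_apply, map_C]
  have h3 : map (j.comp (map α)) (map C g) =
      C (j (C y)) * ∏ i, linForm (fun s => j (C (x i s))) := by
    rw [map_map, hcomp, ← map_map, h1]
    simp [map_prod]
  change (j.comp (map α)) w = _
  rw [h2', splitting_value_unique hF (h1'.symm.trans h3), map_mul, map_prod, C_pow, map_pow]
  refine congr_arg₂ _ rfl (Finset.prod_congr rfl fun i _ => ?_)
  rw [eval₂_formOfCoeffs, genericValue, map_sum]
  refine Finset.sum_congr rfl fun a _ => ?_
  simp [map_prod]

/-- Specialization of the coefficients of the generic form to those of `G`. -/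
def specializeForm (d : ℕ) (G : MvPolynomial (Fin (m + 1)) (MvPolynomial (Fin (m + 1)) M)) :
    MvPolynomial (Expo m d) M →+* MvPolynomial (Fin (m + 1)) M :=
  eval₂Hom C fun a => coeff a.1 G

lemma map_specializeForm {G : MvPolynomial (Fin (m + 1)) (MvPolynomial (Fin (m + 1)) M)}
    (hG : G.IsHomogeneous d) {u : MvPolynomial (Expo m d) M} {ι : Type*} {t : Finset ι}
    {β : Ω} {x : ι → Fin (m + 1) → Ω} (hu : map α u = C β * ∏ i ∈ t, genericValue d (x i)) :
    map α (specializeForm d G u) =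
      C β * ∏ i ∈ t, eval (fun s => C (x i s)) (map (map α) G) := by
  have hsq : (map α).comp (specializeForm d G) =
      (eval₂Hom C fun a : Expo m d => coeff a.1 (map (map α) G)).comp (map α) := by
    apply MvPolynomial.ringHom_ext <;> intros <;> simp [specializeForm, coeff_map]
  change ((map α).comp (specializeForm d G)) u = _
  rw [hsq, RingHom.comp_apply, hu, map_mul, map_prod, coe_eval₂Hom, eval₂_C]
  have hx : ∀ i, eval₂ C (fun a : Expo m d => coeff a.1 (map (map α) G)) (genericValue d (x i)) =
      eval (fun s => C (x i s)) (map (map α) G) := fun i =>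
    eval₂_genericValue C (hG.map (map α)) (x i)
  rw [Finset.prod_congr rfl fun i _ => hx i]

lemma eq_C_of_map_eq_C {A B σ : Type*} [CommRing A] [CommRing B] {φ : A →+* B}
    (hφ : Function.Injective φ) {p : MvPolynomial σ A} {b : B} (h : map φ p = C b) :
    p = C (constantCoeff p) := by
  apply map_injective φ hφ
  rw [h, map_C, C_inj]
  have := congr_arg constantCoeff h
  rw [constantCoeff_C] at this
  rw [← this, constantCoeff_map]

variable [IsDomain M] [UniqueFactorizationMonoid M]

/-- A divisor of `g ^ e` is associated to a power of `g`, and only the zeroth power has degree `0`.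
-/
lemma isUnit_of_C_dvd_pow {g : MvPolynomial (Fin (m + 1)) M} (hg : Irreducible g) (hD : 1 ≤ D)
    (hgD : g.IsHomogeneous D) {v : M} {e : ℕ} (h : C v ∣ g ^ e) : IsUnit v := by
  obtain ⟨k, -, hk⟩ := (dvd_prime_pow hg.prime e).1 h
  have h0 : g ^ k ≠ 0 := pow_ne_zero _ hg.ne_zero
  obtain ⟨r, hr⟩ := hk
  obtain ⟨a, -, ha⟩ := isUnit_iff_eq_C_of_isReduced.1 r.isUnit
  have hdeg := (hgD.pow k).totalDegree h0
  rw [← hr, ha, ← C_mul, totalDegree_C, eq_comm, Nat.mul_eq_zero] at hdeg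
  obtain rfl := hdeg.resolve_left (by omega)
  rw [pow_zero] at hr
  have := (IsUnit.of_mul_eq_one _ hr).map constantCoeff
  rwa [constantCoeff_C] at this

/-- In a factorization `w = u v` the `D` prime values are distributed among `u` and `v`.
Specializing the generic form to `L · ℓ ^ (d-1)`, with `L` the universal linear form and `ℓ` its
value at a point `p` where `g(p) ≠ 0`, turns `w` into `g · g(p) ^ (d-1)`; so `g` divides the image
of `u`, say, and by degree `u` takes all `D` values. Then `v` is a constant. Specializing to `L ^ d`
turns `w` into `g ^ d`, so `v` divides a power of `g` and is a unit. -/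
theorem irreducible_of_map_eq_prod_genericValue [Infinite M] (hα : Function.Injective α)
    (hd : 1 ≤ d) (hD : 1 ≤ D) {g : MvPolynomial (Fin (m + 1)) M} (hg : Irreducible g)
    {w : MvPolynomial (Expo m d) M} {y : Ω} {x : Fin D → Fin (m + 1) → Ω}
    (hgx : map α g = C y * ∏ i, linForm (x i))
    (hwx : map α w = C (y ^ d) * ∏ i, genericValue d (x i)) : Irreducible w := by
  classical
  obtain ⟨e, rfl⟩ : ∃ e, d = e + 1 := ⟨d - 1, by omega⟩
  have hinj : Function.Injective (map (σ := Fin (m + 1)) α) := map_injective _ hα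
  have hgα : map α g ≠ 0 := fun h0 => hg.ne_zero (hinj (by rw [h0, map_zero]))
  have hx : ∀ i, x i ≠ 0 := fun i hi => hgα <| by
    rw [hgx, Finset.prod_eq_zero (Finset.mem_univ i) (by rw [hi, linForm_zero]), mul_zero]
  have hy : y ≠ 0 := fun hy => hgα (by rw [hgx, hy]; simp)
  have hgD : g.IsHomogeneous D := by
    refine IsHomogeneous.of_map (f := α) hα ?_
    rw [hgx]
    simpa using (isHomogeneous_C (Fin (m + 1)) y).mul
      (prod_linForm_isHomogeneous Finset.univ x)
  obtain ⟨p, hp⟩ : ∃ p, eval p g ≠ 0 := by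
    by_contra! h
    exact hg.ne_zero (MvPolynomial.funext fun p => by rw [h, map_zero])
  have hgp : α (eval p g) = y * ∏ i, ∑ s, x i s * α (p s) := by
    have : α (eval p g) = eval (fun s => α (p s)) (map α g) := by
      rw [eval_map, eval₂_comp]; rfl
    rw [this, hgx, map_mul, eval_C, map_prod]
    simp
  -- the two specializations
  let G₁ : MvPolynomial (Fin (m + 1)) (MvPolynomial (Fin (m + 1)) M) :=
    linForm X * linForm (fun s => C (p s)) ^ e
  let G₂ : MvPolynomial (Fin (m + 1)) (MvPolynomial (Fin (m + 1)) M) := linForm X ^ (e + 1)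
  have hG₁ : G₁.IsHomogeneous (e + 1) := by
    have := (linForm_isHomogeneous (X : Fin (m + 1) → MvPolynomial (Fin (m + 1)) M)).mul
      ((linForm_isHomogeneous (fun s => C (p s) : Fin (m + 1) → MvPolynomial (Fin (m + 1)) M)).pow e)
    simpa only [one_mul, add_comm 1 e] using this
  have hG₂ : G₂.IsHomogeneous (e + 1) := by
    have := (linForm_isHomogeneous (X : Fin (m + 1) → MvPolynomial (Fin (m + 1)) M)).pow (e + 1)
    rwa [one_mul] at this
  have hlin : ∀ z : Fin (m + 1) → Ω, ∑ s, X s * C (z s) = linForm z := fun z => by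
    simp only [linForm, mul_comm]
  have hv₁ : ∀ z : Fin (m + 1) → Ω, eval (fun s => C (z s)) (map (map α) G₁) =
      linForm z * C ((∑ s, z s * α (p s)) ^ e) := by
    intro z
    simp only [G₁, map_mul, map_pow, map_linForm, map_X, map_C, eval_linForm, hlin, map_sum,
      mul_comm (C (α _)) (C (z _))]
  have hv₂ : ∀ z : Fin (m + 1) → Ω, eval (fun s => C (z s)) (map (map α) G₂) =
      linForm z ^ (e + 1) := by
    intro z
    simp only [G₂, map_pow, map_linForm, map_X, eval_linForm, hlin]
  have hw₁ : specializeForm (e + 1) G₁ w = g * C (eval p g ^ e) := by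
    apply hinj
    rw [map_specializeForm hG₁ hwx, Finset.prod_congr rfl fun i _ => hv₁ (x i),
      Finset.prod_mul_distrib, ← map_prod C, Finset.prod_pow, map_mul (map α), map_C, map_pow α,
      hgp, hgx, mul_pow, C_mul, pow_succ, C_mul]
    ring
  have hw₂ : specializeForm (e + 1) G₂ w = g ^ (e + 1) := by
    apply hinj
    rw [map_specializeForm hG₂ hwx, Finset.prod_congr rfl fun i _ => hv₂ (x i),
      Finset.prod_pow, map_pow (map α), hgx, mul_pow, C_pow]
  have hw₁0 : specializeForm (e + 1) G₁ w ≠ 0 := by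
    rw [hw₁]
    exact mul_ne_zero hg.ne_zero (by rw [Ne, C_eq_zero]; exact pow_ne_zero _ hp)
  -- the cofactor of a factor divisible by `g` after specialization is a unit
  have key : ∀ (u v : MvPolynomial (Expo m (e + 1)) M) (t t' : Finset (Fin D)) (β γ : Ω),
      u * v = w → t ∪ t' = Finset.univ → Disjoint t t' →
      map α u = C β * ∏ i ∈ t, genericValue (e + 1) (x i) →
      map α v = C γ * ∏ i ∈ t', genericValue (e + 1) (x i) →
      g ∣ specializeForm (e + 1) G₁ u → IsUnit v := by
    intro u v t t' β γ huv htt hdis hu hv hdvd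
    have hu0 : specializeForm (e + 1) G₁ u ≠ 0 := fun h0 => hw₁0 <| by
      rw [← huv, map_mul, h0, zero_mul]
    have hhom : (specializeForm (e + 1) G₁ u).IsHomogeneous t.card := by
      refine IsHomogeneous.of_map (f := α) hα ?_
      rw [map_specializeForm hG₁ hu, Finset.prod_congr rfl fun i _ => hv₁ (x i),
        Finset.prod_mul_distrib, ← map_prod C]
      have := (isHomogeneous_C (Fin (m + 1)) β).mul ((prod_linForm_isHomogeneous t x).mul
        (isHomogeneous_C (Fin (m + 1)) (∏ i ∈ t, (∑ s, x i s * α (p s)) ^ e)))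
      rwa [zero_add, add_zero] at this
    -- Each prime value in `u` specializes to a linear form times a constant, so the degree of the
    -- image counts them.
    have hle : D ≤ t.card := by
      obtain ⟨q, hq⟩ := hdvd
      have hq0 : q ≠ 0 := fun h => hu0 (by rw [hq, h, mul_zero])
      rw [← hhom.totalDegree hu0, hq, totalDegree_mul_of_isDomain hg.ne_zero hq0,
        hgD.totalDegree hg.ne_zero]
      exact Nat.le_add_right _ _
    have ht : t = Finset.univ := Finset.eq_univ_of_card t
      (le_antisymm (Finset.card_le_univ t) (by rwa [Fintype.card_fin]))
    have ht' : t' = ∅ := by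
      rw [ht] at hdis
      exact Finset.eq_empty_of_forall_notMem fun i => Finset.disjoint_left.1 hdis (Finset.mem_univ i)
    rw [ht', Finset.prod_empty, mul_one] at hv
    have hvC := eq_C_of_map_eq_C hα hv
    rw [hvC]
    refine (isUnit_of_C_dvd_pow hg hD hgD (e := e + 1) ⟨specializeForm (e + 1) G₂ u, ?_⟩).map C
    rw [← hw₂, ← huv, map_mul, mul_comm]
    have h3 : specializeForm (e + 1) G₂ v = C (constantCoeff v) := by
      conv_lhs => rw [hvC]
      exact eval₂_C _ _ _
    rw [h3]
  refine ⟨fun hu => hg.not_isUnit ?_, fun u v huv => ?_⟩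
  · have := hu.map (specializeForm (e + 1) G₂)
    rw [hw₂] at this
    exact (isUnit_pow_iff (Nat.succ_ne_zero e)).1 this
  · have h1 : map α u * map α v = C (y ^ (e + 1)) * ∏ i, genericValue (e + 1) (x i) := by
      rw [← map_mul, ← huv, hwx]
    obtain ⟨t, t', b, c, htt, hdis, hbc, hu, hv⟩ :=
      mul_eq_mul_prime_prod (fun i _ => genericValue_prime (hx i)) h1
    have hunit : IsUnit (b * c) := by
      rw [← hbc]
      exact (isUnit_iff_ne_zero.2 (pow_ne_zero _ hy)).map C
    obtain ⟨β, -, rfl⟩ := isUnit_iff_eq_C_of_isReduced.1 (isUnit_of_mul_isUnit_left hunit)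
    obtain ⟨γ, -, rfl⟩ := isUnit_iff_eq_C_of_isReduced.1 (isUnit_of_mul_isUnit_right hunit)
    have hdvd : g ∣ specializeForm (e + 1) G₁ u * specializeForm (e + 1) G₁ v := by
      rw [← map_mul, ← huv, hw₁]
      exact dvd_mul_right _ _
    rcases hg.prime.dvd_or_dvd hdvd with h | h
    · exact Or.inr (key u v t t' β γ huv.symm htt hdis hu hv h)
    · exact Or.inl (key v u t' t γ β (by rw [huv, mul_comm]) (by rw [Finset.union_comm, htt])
        hdis.symm hv hu h)

/-- The wedge of an irreducible polynomial with a generic form of positive degree is irreducible. -/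
theorem IsWedge.generic_irreducible [Infinite M] (hd : 1 ≤ d) (hD : 1 ≤ D)
    {g : MvPolynomial (Fin (m + 1)) M} (hg : Irreducible g) {w : MvPolynomial (Expo m d) M}
    (hw : IsWedge d D (formOfCoeffs m d X) (map C g) w) : Irreducible w := by
  obtain ⟨y, x, h1, h2⟩ := HasWedge.exists_genericValue (algebraMap M (FracClosure M))
    (j := algebraMap _ (FracClosure (MvPolynomial (Expo m d) (FracClosure M))))
    algebraMap_fracClosure_injective algebraMap_fracClosure_injective hw
  exact irreducible_of_map_eq_prod_genericValue algebraMap_fracClosure_injective hd hD hg h1 h2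

end Step

/-! ### The last group as an isomorphism -/

section LastGroupEquiv

variable (A : Type*) [CommRing A] (k n : ℕ)

/-- `lastGroup` as an isomorphism of rings. -/
def lastGroupEquiv : DualPoly A (k + 1) n ≃+* MvPolynomial (Fin (n + 1)) (DualPoly A k n) :=
  RingEquiv.ofRingHom (lastGroupHom A k n)
    (eval₂Hom (rename fun p : Fin k × Fin (n + 1) => (p.1.castSucc, p.2)).toRingHom
      fun s => X (Fin.last k, s))
    (by
      apply MvPolynomial.ringHom_ext
      · intro p
        simp only [RingHom.comp_apply, coe_eval₂Hom, eval₂_C, RingHom.id_apply]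
        induction p using MvPolynomial.induction_on with
        | C a => simp [lastGroupHom_apply]
        | add p q hp hq => simp only [map_add, hp, hq]
        | mul_X p i hp => rw [map_mul, map_mul, hp, map_mul]; simp [lastGroupHom_apply]
      · intro s; simp [lastGroupHom_apply])
    (by apply dualPoly_hom_ext <;> intros <;> simp [lastGroupHom_apply])

variable {A k n}

lemma lastGroup_irreducible {c : DualPoly A (k + 1) n} (hc : Irreducible c) :
    Irreducible (lastGroup c) :=
  (MulEquiv.irreducible_iff (lastGroupEquiv A k n)).2 hc

end LastGroupEquiv

/-! ### Iterated wedges with generic forms -/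

section GenericIteration

variable {M : Type u} [CommRing M] {m k : ℕ}

/-- The polynomial ring in the coefficients of generic forms of degrees `d i`. -/
abbrev CoeffRing (M : Type*) [CommRing M] (m : ℕ) {k : ℕ} (d : Fin k → ℕ) :=
  MvPolynomial (Σ i : Fin k, Expo m (d i)) M

/-- The generic forms of degrees `d i`. -/
def genericForm (M : Type*) [CommRing M] (m : ℕ) {k : ℕ} (d : Fin k → ℕ) (i : Fin k) :
    MvPolynomial (Fin (m + 1)) (CoeffRing M m d) :=
  formOfCoeffs m (d i) fun a => X ⟨i, a⟩

lemma genericForm_isHomogeneous (d : Fin k → ℕ) (i : Fin k) :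
    (genericForm M m d i).IsHomogeneous (d i) := formOfCoeffs_isHomogeneous _ _ _

/-- Separating the coefficients of the last generic form. -/
def coeffRingEquiv (M : Type*) [CommRing M] (m : ℕ) {k : ℕ} (d : Fin (k + 1) → ℕ) :
    CoeffRing (MvPolynomial (Expo m (d (Fin.last k))) M) m (fun i : Fin k => d i.castSucc) ≃+*
      CoeffRing M m d :=
  RingEquiv.ofRingHom
    (eval₂Hom (eval₂Hom C fun a => X ⟨Fin.last k, a⟩) fun p => X ⟨p.1.castSucc, p.2⟩)
    (eval₂Hom (C.comp C) fun p => Fin.lastCases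
      (motive := fun i => Expo m (d i) →
        CoeffRing (MvPolynomial (Expo m (d (Fin.last k))) M) m (fun i : Fin k => d i.castSucc))
      (fun a => C (X a)) (fun i a => X ⟨i, a⟩) p.1 p.2)
    (by
      apply MvPolynomial.ringHom_ext
      · intro; simp
      · rintro ⟨i, a⟩
        induction i using Fin.lastCases <;> simp)
    (by
      apply MvPolynomial.ringHom_ext
      · intro p
        induction p using MvPolynomial.induction_on with
        | C a => simp
        | add p q hp hq => simp only [map_add, hp, hq]
        | mul_X p i hp => rw [map_mul, map_mul, hp, map_mul]; simp
      · rintro ⟨i, a⟩; simp)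

lemma coeffRingEquiv_C_C (d : Fin (k + 1) → ℕ) (a : M) :
    coeffRingEquiv M m d (C (C a)) = C a := by
  simp [coeffRingEquiv]

lemma coeffRingEquiv_C_X (d : Fin (k + 1) → ℕ) (a) :
    coeffRingEquiv M m d (C (X a)) = X ⟨Fin.last k, a⟩ := by
  simp [coeffRingEquiv]

lemma coeffRingEquiv_X (d : Fin (k + 1) → ℕ) (p) :
    coeffRingEquiv M m d (X p) = X ⟨p.1.castSucc, p.2⟩ := by
  simp [coeffRingEquiv]

lemma map_genericForm_castSucc (d : Fin (k + 1) → ℕ) (i : Fin k) :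
    map (coeffRingEquiv M m d).toRingHom (genericForm _ m (fun i : Fin k => d i.castSucc) i) =
      genericForm M m d i.castSucc := by
  rw [genericForm, map_formOfCoeffs]
  simp only [RingEquiv.toRingHom_eq_coe, RingEquiv.coe_toRingHom, coeffRingEquiv_X]
  rfl

/-- Restricting to the coefficients of the last generic form. -/
def lastCoeffs (M : Type*) [CommRing M] (m : ℕ) {k : ℕ} (d : Fin (k + 1) → ℕ) :
    DualPoly (CoeffRing M m d) k m →+*
      MvPolynomial (Expo m (d (Fin.last k))) (DualPoly M k m) :=
  eval₂Hom (eval₂Hom (C.comp C) fun p => Fin.lastCases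
    (motive := fun i => Expo m (d i) → MvPolynomial (Expo m (d (Fin.last k))) (DualPoly M k m))
    (fun a => X a) (fun _ _ => 0) p.1 p.2) fun p => C (X p)

lemma lastCoeffs_comp_map (d : Fin (k + 1) → ℕ) :
    (lastCoeffs M m d).comp (map C) = (C : DualPoly M k m →+* _) := by
  apply MvPolynomial.ringHom_ext <;> intros <;> simp [lastCoeffs]

lemma lastCoeffs_C_X (d : Fin (k + 1) → ℕ) (a) :
    lastCoeffs M m d (C (X ⟨Fin.last k, a⟩)) = X a := by
  simp [lastCoeffs]

/-- Viewing a polynomial in the coefficients of the last generic form as one in all of them. -/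
def fromLastCoeffs (M : Type*) [CommRing M] (m : ℕ) {k : ℕ} (d : Fin (k + 1) → ℕ) :
    MvPolynomial (Expo m (d (Fin.last k))) (DualPoly M k m) →+* DualPoly (CoeffRing M m d) k m :=
  ((map (coeffRingEquiv M m d).toRingHom).comp (map C)).comp
    (commAlgEquiv M (Expo m (d (Fin.last k))) (Fin k × Fin (m + 1))).toRingEquiv.toRingHom

lemma fromLastCoeffs_apply (d : Fin (k + 1) → ℕ)
    (w : MvPolynomial (Expo m (d (Fin.last k))) (DualPoly M k m)) : fromLastCoeffs M m d w =
      map (coeffRingEquiv M m d).toRingHom (map C (commAlgEquiv M _ _ w)) := rfl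

lemma fromLastCoeffs_comp_C (d : Fin (k + 1) → ℕ) :
    (fromLastCoeffs M m d).comp C = (map C : DualPoly M k m →+* DualPoly (CoeffRing M m d) k m) := by
  have h : ((coeffRingEquiv M m d).toRingHom.comp C).comp C = C :=
    RingHom.ext fun a => coeffRingEquiv_C_C d a
  refine RingHom.ext fun p => ?_
  rw [RingHom.comp_apply, fromLastCoeffs_apply, commAlgEquiv_C, map_map, map_map, h]

lemma fromLastCoeffs_X (d : Fin (k + 1) → ℕ) (a) :
    fromLastCoeffs M m d (X a) = C (X ⟨Fin.last k, a⟩) := by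
  rw [fromLastCoeffs_apply, commAlgEquiv_X, map_C, map_C]
  exact congr_arg C (coeffRingEquiv_C_X d a)

lemma map_lastCoeffs_lastGroup (d : Fin (k + 1) → ℕ) (c : DualPoly M (k + 1) m) :
    map (lastCoeffs M m d) (lastGroup (map C c)) = map C (lastGroup c) := by
  rw [lastGroup_map]
  exact (map_map _ _ _).trans
    (congr_arg (fun θ => map θ (lastGroup c)) (lastCoeffs_comp_map d))

lemma map_fromLastCoeffs_lastGroup (d : Fin (k + 1) → ℕ) (c : DualPoly M (k + 1) m) :
    map (fromLastCoeffs M m d) (map C (lastGroup c)) = lastGroup (map C c) := by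
  rw [lastGroup_map]
  exact (map_map _ _ _).trans
    (congr_arg (fun θ => map θ (lastGroup c)) (fromLastCoeffs_comp_C d))

lemma map_lastCoeffs_genericForm (d : Fin (k + 1) → ℕ) :
    map (lastCoeffs M m d) (map C (genericForm M m d (Fin.last k))) =
      formOfCoeffs m (d (Fin.last k)) X := by
  rw [genericForm, map_formOfCoeffs, map_formOfCoeffs]
  exact congr_arg (formOfCoeffs m (d (Fin.last k))) (_root_.funext fun a => lastCoeffs_C_X d a)

lemma map_fromLastCoeffs_formOfCoeffs (d : Fin (k + 1) → ℕ) :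
    map (fromLastCoeffs M m d) (formOfCoeffs m (d (Fin.last k)) X) =
      map C (genericForm M m d (Fin.last k)) := by
  rw [genericForm, map_formOfCoeffs, map_formOfCoeffs]
  exact congr_arg (formOfCoeffs m (d (Fin.last k))) (_root_.funext fun a => fromLastCoeffs_X d a)

lemma IsWedge.map {A B : Type*} [CommRing A] [IsDomain A] [CommRing B] [IsDomain B]
    (θ : A →+* B) {d D : ℕ} {f g : MvPolynomial (Fin (m + 1)) A} {a : A} (hf : f.IsHomogeneous d)
    (h : IsWedge d D f g a) : IsWedge d D (MvPolynomial.map θ f) (MvPolynomial.map θ g) (θ a) := by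
  rw [isWedge_iff, hasWedge_map]
  exact HasWedge.specialize algebraMap_fracClosure_injective _ hf h

variable [IsDomain M]

/-- The wedge with the last generic form, as a polynomial over the ring of its coefficients. -/
lemma exists_wedgeLast_generic {d : Fin (k + 1) → ℕ} {D : ℕ} {c : DualPoly M (k + 1) m}
    (h : ∃ a, IsWedge (d (Fin.last k)) D (map C (genericForm M m d (Fin.last k)))
      (lastGroup (map C c)) a) :
    ∃ w : MvPolynomial (Expo m (d (Fin.last k))) (DualPoly M k m),
      IsWedge (d (Fin.last k)) D (formOfCoeffs m (d (Fin.last k)) X) (map C (lastGroup c)) w ∧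
      wedgeLast (d (Fin.last k)) D (genericForm M m d (Fin.last k)) (map C c) =
        fromLastCoeffs M m d w := by
  obtain ⟨a, ha⟩ := h
  have hF := (genericForm_isHomogeneous (M := M) (m := m) d (Fin.last k)).map
    (C : _ →+* DualPoly (CoeffRing M m d) k m)
  have hw := ha.map (lastCoeffs M m d) hF
  rw [map_lastCoeffs_genericForm, map_lastCoeffs_lastGroup] at hw
  refine ⟨_, hw, ?_⟩
  have hw' := hw.map (fromLastCoeffs M m d) (formOfCoeffs_isHomogeneous m _ _)
  rw [map_fromLastCoeffs_formOfCoeffs, map_fromLastCoeffs_lastGroup] at hw'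
  exact hw'.wedge_eq hF

/-- Iterated wedges commute with homomorphisms; the inverse isomorphism carries their existence back
to `A`. -/
lemma irreducible_iterWedge_map {A B : Type*} [CommRing A] [IsDomain A] [CommRing B] [IsDomain B]
    (e : A ≃+* B) {d : Fin k → ℕ} {D : ℕ} {f : Fin k → MvPolynomial (Fin (m + 1)) A}
    (hf : ∀ i, (f i).IsHomogeneous (d i)) {c : DualPoly A k m}
    (h : IterWedgeDefined k d D (fun i => MvPolynomial.map e.toRingHom (f i))
      (MvPolynomial.map e.toRingHom c))
    (hirr : IterWedgeDefined k d D f c → Irreducible (iterWedge k d D f c)) :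
    Irreducible (iterWedge k d D (fun i => MvPolynomial.map e.toRingHom (f i))
      (MvPolynomial.map e.toRingHom c)) := by
  have hsymm : e.symm.toRingHom.comp e.toRingHom = RingHom.id _ :=
    RingHom.ext fun x => e.symm_apply_apply x
  have hdef := (iterWedge_map e.symm.toRingHom _ _ (fun i => (hf i).map e.toRingHom) h).1
  simp only [map_map, hsymm, map_id] at hdef
  rw [(iterWedge_map e.toRingHom _ _ hf hdef).2]
  exact (MulEquiv.irreducible_iff e).2 (hirr hdef)

/-- The iterated wedge of an irreducible polynomial with generic forms of positive degrees is
irreducible. -/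
theorem iterWedge_generic_irreducible (k : ℕ) {M : Type u} [CommRing M] [IsDomain M]
    [UniqueFactorizationMonoid M] [Infinite M] (d : Fin k → ℕ) (hd : ∀ i, 1 ≤ d i) {D : ℕ}
    (hD : 1 ≤ D) {c : DualPoly M k m} (hc : Irreducible c)
    (h : IterWedgeDefined k d D (genericForm M m d) (map C c)) :
    Irreducible (iterWedge k d D (genericForm M m d) (map C c)) := by
  induction k generalizing M D with
  | zero =>
    obtain ⟨a, rfl⟩ := C_surjective (Fin 0 × Fin (m + 1)) c
    have ha : Irreducible a :=
      (MulEquiv.irreducible_iff (isEmptyRingEquiv M (Fin 0 × Fin (m + 1))).symm).1 hc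
    rw [iterWedge, map_C, constantCoeff_C]
    exact (MulEquiv.irreducible_iff (isEmptyRingEquiv M (Σ i : Fin 0, Expo m (d i))).symm).2 ha
  | succ k ih =>
    obtain ⟨w, hw, hwl⟩ := exists_wedgeLast_generic h.1.exists
    have hwirr := hw.generic_irreducible (hd _) hD (lastGroup_irreducible hc)
    -- The coefficients of the last form join the base ring, which remains an infinite factorial
    -- domain; the induction therefore varies `M`.
    let c' := commAlgEquiv M (Expo m (d (Fin.last k))) (Fin k × Fin (m + 1)) w
    have hc' : Irreducible c' := (MulEquiv.irreducible_iff (commAlgEquiv M _ _)).2 hwirr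
    have h2 := h.2
    rw [hwl, fromLastCoeffs_apply, ← _root_.funext (map_genericForm_castSucc d)] at h2
    rw [iterWedge, hwl, fromLastCoeffs_apply, ← _root_.funext (map_genericForm_castSucc d)]
    exact irreducible_iterWedge_map (coeffRingEquiv M m d) (fun i => genericForm_isHomogeneous _ i)
      h2 (ih (fun i => d i.castSucc) (fun i => hd _) (Nat.mul_pos (hd (Fin.last k)) hD) hc')

end GenericIteration

/-! ### Irreducibility of the wedge with `P_λ` -/

section GenericWedge

variable {K : Type u} [Field K] {m n D : ℕ}

lemma map_substRows {R R' S : Type*} [CommRing R] [CommRing R'] [CommRing S] {k : ℕ}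
    (φ : R' →+* S) (θ : R →+* R') (Λ : Matrix (Fin (m + 1)) (Fin (n + 1)) R')
    (c : DualPoly R k n) :
    map φ (substRows θ Λ k c) = substRows (φ.comp θ) (Λ.map φ) k c := by
  have : (map φ).comp (substRows θ Λ k) = substRows (n := n) (φ.comp θ) (Λ.map φ) k := by
    apply MvPolynomial.ringHom_ext <;> intros <;> simp
  exact congr_arg (fun f => f c) this

/-- The coefficients of generic forms over `K[lam]` as elements of `K[lam, f]`. -/
def lamFRingEquiv (K : Type*) [Field K] (m n : ℕ) (d : Fin m → ℕ) :
    CoeffRing (LamRing K m n) m d ≃+* LamFRing K m n d :=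
  ((sumAlgEquiv K _ _).symm.trans (renameEquiv K (Equiv.sumComm _ _))).toRingEquiv

lemma lamFRingEquiv_C_X (d : Fin m → ℕ) (p) :
    lamFRingEquiv K m n d (C (X p)) = X (Sum.inl p) := by
  simp [lamFRingEquiv]

lemma lamFRingEquiv_X (d : Fin m → ℕ) (p) :
    lamFRingEquiv K m n d (X p) = X (Sum.inr p) := by
  simp [lamFRingEquiv]

lemma lamFRingEquiv_C_C (d : Fin m → ℕ) (a : K) :
    lamFRingEquiv K m n d (C (C a)) = C a := by
  simp [lamFRingEquiv]

lemma map_lamFRingEquiv_genericForm (d : Fin m → ℕ) (i : Fin m) :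
    map (lamFRingEquiv K m n d).toRingHom (genericForm (LamRing K m n) m d i) =
      genericF K m n d i := by
  rw [genericForm, map_formOfCoeffs]
  exact congr_arg (formOfCoeffs m (d i)) (_root_.funext fun a => lamFRingEquiv_X d ⟨i, a⟩)

lemma genericF_isHomogeneous (d : Fin m → ℕ) (i : Fin m) :
    (genericF K m n d i).IsHomogeneous (d i) := formOfCoeffs_isHomogeneous _ _ _

lemma map_lamFRingEquiv_substRows (d : Fin m → ℕ) (c : DualPoly K m n) :
    map (lamFRingEquiv K m n d).toRingHom
        (map C (substRows (algebraMap K (LamRing K m n)) (genericLam K m n) m c)) =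
      substRows (algebraMap K (LamFRing K m n d)) (genericLam' K m n d) m c := by
  rw [map_map, map_substRows]
  congr 2
  · exact RingHom.ext fun a => lamFRingEquiv_C_C d a
  · ext1 i s
    exact lamFRingEquiv_C_X d (i, s)

/-- For `D = 0`, equivariance under the zero matrix would make `c` constant. -/
lemma DetEquivariant.one_le_of_irreducible [Infinite K] {k : ℕ} {c : DualPoly K k n}
    (h : DetEquivariant D c) (hc : Irreducible c) : 1 ≤ D := by
  refine Nat.one_le_iff_ne_zero.2 ?_
  rintro rfl
  refine ChowProj.Irreducible.not_forall_eval_eq hc (evalRows c 0) fun v => ?_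
  have := h 0 (Matrix.of fun i s => v (i, s))
  rw [Matrix.zero_mul, pow_zero, one_mul] at this
  exact this.symm

/-- The wedge of `P_lam` with generic forms is irreducible, for indeterminate `lam`. -/
theorem formWedge_generic_irreducible [IsAlgClosed K] {c : DualPoly K (m + 1) n}
    {Z : Set (Fin (n + 1) → K)} (h : ChowLike D c Z) (hZ : ∀ p ∈ Z, p ≠ 0) (hc : Irreducible c)
    (d : Fin (m + 1) → ℕ) (hd : ∀ i, 1 ≤ d i) :
    Irreducible (formWedge d D (genericF K (m + 1) n d)
      (projForm c D (genericLam' K (m + 1) n d))) := by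
  have : Infinite K := IsAlgClosed.instInfinite
  -- The wedge is rewritten as an iterated wedge of the generic forms with `c(Yλ)`, which is
  -- irreducible over `K[λ]` and does not involve their coefficients.
  obtain ⟨-, hdef, heq⟩ := formWedge_projForm h hZ (genericLam' K (m + 1) n d) d
    (genericF K (m + 1) n d) (genericF_isHomogeneous d)
  obtain ⟨h1, h2⟩ := iterWedge_substRows (θ := RingHom.id _) (Λ := genericLam' K (m + 1) n d)
    (f' := genericF K (m + 1) n d) d D
    (fun i => compForms_isHomogeneous (genericF_isHomogeneous d i) _) (genericF_isHomogeneous d)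
    (fun i => (map_id _).symm) hdef
  have heq' := heq.trans h2.symm
  rw [substRows_map, RingHom.id_comp, ← map_lamFRingEquiv_substRows,
    ← _root_.funext (map_lamFRingEquiv_genericForm d)] at h1
  rw [heq', substRows_map, RingHom.id_comp, ← map_lamFRingEquiv_substRows]
  have hF := _root_.funext (map_lamFRingEquiv_genericForm (K := K) (n := n) d)
  rw [show genericF K (m + 1) n d = _ from hF.symm]
  exact irreducible_iterWedge_map (lamFRingEquiv K (m + 1) n d)
    (fun i => genericForm_isHomogeneous d i) h1 (iterWedge_generic_irreducible (m + 1) d hd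
      (h.det.one_le_of_irreducible hc) (substRows_genericLam_irreducible h.det hc))

end GenericWedge

end ChowProj

end

theorem mainTheorem10 (K : Type u) [Field K] [IsAlgClosed K] (n ν : ℕ) (hν : 0 < ν)
    (W : Set (ChowProj.PSpace K n)) (hW : ChowProj.IsAlgebraicSet W)
    (c : ChowProj.DualPoly K ν n) (hc : ChowProj.IsChowFormFor W c) (hc0 : c ≠ 0)
    (D : ℕ) (hD : ChowProj.groupDegree ⟨0, hν⟩ c = D) :
    -- `c^♯` is a polynomial
    algebraMap (ChowProj.SharpPoly K ν n) (FractionRing (ChowProj.SharpPoly K ν n))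
        (ChowProj.sharp c D) = ChowProj.sharpFrac c D ∧
    -- the zero set of `P_lam`
    (∀ lam : Matrix (Fin (ν + 1)) (Fin (n + 1)) K,
      (ChowProj.projForm c D lam).IsHomogeneous D ∧
      (ChowProj.projForm c D lam = 0 ↔ ChowProj.MeetsForms W lam) ∧
      (¬ ChowProj.MeetsForms W lam →
        {q : ChowProj.PSpace K ν | eval q.rep (ChowProj.projForm c D lam) = 0} =
          ChowProj.projImage lam W)) ∧
    -- `f ∧ P_lam = (f ∘ lam) ∧ c`
    (∀ (R : Type v) [CommRing R] [IsDomain R] [Algebra K R]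
      (lam : Matrix (Fin (ν + 1)) (Fin (n + 1)) R)
      (d : Fin ν → ℕ) (f : Fin ν → MvPolynomial (Fin (ν + 1)) R),
      (∀ i, (f i).IsHomogeneous (d i)) →
      ChowProj.FormWedgeDefined d D f (ChowProj.projForm c D lam) ∧
      ChowProj.IterWedgeDefined ν d D (fun i => ChowProj.compForms (f i) lam)
        (map (algebraMap K R) c) ∧
      ChowProj.formWedge d D f (ChowProj.projForm c D lam) =
        ChowProj.iterWedge ν d D (fun i => ChowProj.compForms (f i) lam)
          (map (algebraMap K R) c)) ∧
    -- irreducibility for indeterminate `lam` and `f`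
    (Irreducible c →
      Irreducible (ChowProj.projForm c D (ChowProj.genericLam K ν n)) ∧
      ∀ d : Fin ν → ℕ, (∀ i, 1 ≤ d i) →
        ChowProj.formWedge d D (ChowProj.genericF K ν n d)
            (ChowProj.projForm c D (ChowProj.genericLam' K ν n d)) =
          ChowProj.iterWedge ν d D
            (fun i => ChowProj.compForms (ChowProj.genericF K ν n d i)
              (ChowProj.genericLam' K ν n d))
            (map (algebraMap K (ChowProj.LamFRing K ν n d)) c) ∧
        Irreducible (ChowProj.formWedge d D (ChowProj.genericF K ν n d)
          (ChowProj.projForm c D (ChowProj.genericLam' K ν n d)))) := by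
  obtain ⟨m, rfl⟩ : ∃ m, ν = m + 1 := ⟨ν - 1, by omega⟩
  have : Infinite K := IsAlgClosed.instInfinite
  have h := hc.chowLike hc0 ⟨0, hν⟩
  rw [hD] at h
  have hZ := ChowProj.repSet_ne_zero (W := W)
  refine ⟨(ChowProj.algebraMap_sharp h.det).1, fun lam =>
    ⟨ChowProj.projForm_isHomogeneous h.det lam, ChowProj.projForm_eq_zero_iff hc hc0 h.det h lam,
      ChowProj.zeros_projForm hc h.det lam⟩,
    fun R _ _ _ lam d f hf => ChowProj.formWedge_projForm h hZ lam d f hf,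
    fun hirr => ⟨ChowProj.projForm_irreducible h.det hirr, fun d hd =>
      ⟨?_, ChowProj.formWedge_generic_irreducible h hZ hirr d hd⟩⟩⟩
  exact (ChowProj.formWedge_projForm h hZ _ d _ (ChowProj.genericF_isHomogeneous d)).2.2
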